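/- Let $d\ge 1$, $a,m_1,m_2\in\mathbb R$ with $m_1\neq 0$, and let $\mathbb S^d\subset\mathbb R^{d+1}$ be the unit sphere. Put $$Z_1=\frac{(0,\dots,0,a,-1)}{\sqrt{1+a^2}},\qquad Z_2=\frac{(0,\dots,0,-a,-1)}{\sqrt{1+a^2}},$$ let $\theta_i$ be the central angle between $q\in\mathbb S^d$ and $Z_i$, and on $T\mathbb S^d=\{(q,v)\in\mathbb R^{d+1}\times\mathbb R^{d+1}:|q|=1,\ \langle q,v\rangle=0\}$ set $$E_{sKep}=\tfrac12|v|^2-m_1\sqrt{1+a^2}\,\cot\theta_1,\qquad V_{sph,2}=-m_2\sqrt{1+a^2}\,\cot\theta_2 .$$ Equip $T\mathbb S^d$ with the Poisson bracket transported from $T^*\mathbb S^d$ by the Legendre transformation of the round metric, that is, the bracket of the restriction of the form $\sum_i dq_i\wedge dv_i$. Let $\mathcal R_{sph}\subset T\mathbb S^d$ be the set of states whose orbit under the spherical Kepler problem $\nabla_{\dot q}\dot q=-\operatorname{grad}(-m_1\sqrt{1+a^2}\cot\theta_1)$ is non-singular (it exists for all times and avoids $\pm Z_1$) and does not pass through $\pm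 Z_2$. Let $Q=q-\langle Z_1,q\rangle Z_1$, $U=v-\langle Z_1,v\rangle Z_1$, $W=v_{d+1}Q-q_{d+1}U$, $T=(0,\dots,0,1,a)/\sqrt{1+a^2}$, $h=a/\sqrt{1+a^2}$, and $$D=C^2-2hA_1,\quad C^2=|Q|^2|U|^2-\langle Q,U\rangle^2,\quad A_1=-\Big\langle\langle U,W\rangle Q-\langle Q,W\rangle U-m_1\tfrac{Q}{|Q|},\,T\Big\rangle .$$ (On the hemisphere $q_{d+1}<0$, use the coordinates $\xi\in\mathbb R^d$ obtained from the central projection $x=-(q_1,\dots,q_d)/q_{d+1}$ by replacing $x_d$ with $(x_d-a)/\sqrt{1+a^2}$, and the velocity $\dot\xi=q_{d+1}^2\,d\xi(v)$. Then $C^2=|\xi|^2|\dot\xi|^2-\langle\xi,\dot\xi\rangle^2$ is the squared angular momentum, and $A_1$ is the component in the direction $(0,\dots,0,-1)$ of the projected second center of the Laplace--Runge--Lenz vector $|\dot\xi|^2\xi-\langle\xi,\dot\xi\rangle\dot\xi-m_1\xi/|\xi|$.) Then every spherical Kepler orbit starting in $\mathcal R_{sph}$ is closed, the partially averaged Hamiltonian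 $$E_{sph,a}=E_{sKep}+\langle V_{sph,2}\rangle,\qquad \langle V_{sph,2}\rangle(z)=\frac1{T_z}\int_0^{T_z}V_{sph,2}(q_z(t))\,dt,$$ where $q_z$ is the Kepler orbit starting at $z$ and $T_z>0$ is a period of it, and the function $D$ are differentiable at every point of $\mathcal R_{sph}$, and $D$ is a first integral of the partially averaged system: $$\{E_{sph,a},D\}=0\quad\text{on }\mathcal R_{sph}.$$ -/

import Mathlib

open scoped RealInnerProductSpace

noncomputable section

namespace SphericalTwoCenter

/-! ### The tangent bundle of the unit sphere and its Poisson bracket -/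

section Symplectic

variable {E : Type*} [NormedAddCommGroup E] [InnerProductSpace ℝ E]

/-- The tangent bundle of the unit sphere of `E`, as the set of pairs (position, velocity). -/
def tangentSphere (E : Type*) [NormedAddCommGroup E] [InnerProductSpace ℝ E] : Set (E × E) :=
  {z | ‖z.1‖ = 1 ∧ ⟪z.1, z.2⟫ = 0}

/-- The tangent space of the manifold `tangentSphere E` at `z`: the pairs `(δq, δv)` that satisfy
the linearized equations `⟪q, δq⟫ = 0` and `⟪δq, v⟫ + ⟪q, δv⟫ = 0`. -/
def tangentAt (z : E × E) : Set (E × E) :=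
  {X | ⟪z.1, X.1⟫ = 0 ∧ ⟪X.1, z.2⟫ + ⟪z.1, X.2⟫ = 0}

/-- The symplectic form `dq ∧ dv`. Restricted to the tangent spaces of `tangentSphere E` it is the
canonical form of the cotangent bundle of the sphere, transported by the Legendre transformation
of the round metric (which is `v ↦ ⟪v, ·⟫`). -/
def symplecticForm (X Y : E × E) : ℝ := ⟪X.1, Y.2⟫ - ⟪Y.1, X.2⟫

/-- `X` is the value at `z` of the Hamiltonian vector field of the function `F` on the tangent
bundle of the sphere: `ω(X, Y) = dF(Y)` for all tangent `Y`. Only the values of `F` on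
`tangentSphere E` matter. -/
structure IsHamiltonianVector (F : E × E → ℝ) (z X : E × E) : Prop where
  mem : X ∈ tangentAt z
  eq : ∀ Y ∈ tangentAt z, symplecticForm X Y = fderivWithin ℝ F (tangentSphere E) z Y

/-- The symplectic form is nondegenerate on each tangent space. -/
theorem existsUnique_isHamiltonianVector [CompleteSpace E] (F : E × E → ℝ) {z : E × E}
    (hz : z ∈ tangentSphere E) : ∃! X, IsHamiltonianVector F z X := by
  obtain ⟨q, v⟩ := z
  obtain ⟨hq, hqv⟩ := hz
  simp only at hq hqv
  have hqq : ⟪q, q⟫ = 1 := by rw [real_inner_self_eq_norm_sq, hq]; norm_num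
  set f := fderivWithin ℝ F (tangentSphere E) (q, v) with hf
  set g₁ := (InnerProductSpace.toDual ℝ E).symm (f.comp (ContinuousLinearMap.inl ℝ E E)) with hg₁
  set g₂ := (InnerProductSpace.toDual ℝ E).symm (f.comp (ContinuousLinearMap.inr ℝ E E)) with hg₂
  have h₁ : ∀ u, ⟪g₁, u⟫ = f (u, 0) := fun u => by
    rw [hg₁, InnerProductSpace.toDual_symm_apply]; simp
  have h₂ : ∀ u, ⟪g₂, u⟫ = f (0, u) := fun u => by
    rw [hg₂, InnerProductSpace.toDual_symm_apply]; simp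
  have hfY : ∀ Y : E × E, f Y = ⟪g₁, Y.1⟫ + ⟪g₂, Y.2⟫ := fun Y => by
    rw [h₁, h₂, ← map_add]; simp
  refine ⟨(g₂ - ⟪g₂, q⟫ • q,
    -(g₁ - ⟪g₁, q⟫ • q - ⟪g₂, q⟫ • v) - ⟪g₂, v⟫ • q), ⟨⟨?_, ?_⟩, ?_⟩, ?_⟩
  · simp only [inner_sub_right, inner_smul_right, hqq]
    rw [real_inner_comm]; ring
  · simp only [inner_sub_left, inner_sub_right, inner_smul_left, inner_smul_right, inner_neg_right,
      hqq, hqv, RCLike.conj_to_real, real_inner_comm g₁ q]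
    ring
  · rintro ⟨b, w⟩ ⟨hb, hw⟩
    simp only at hb hw
    rw [← hf, hfY]
    have hqw : ⟪q, w⟫ = -⟪b, v⟫ := by linarith
    have hbq : ⟪b, q⟫ = 0 := by rw [real_inner_comm]; exact hb
    simp only [symplecticForm, inner_sub_left, inner_sub_right, inner_smul_left, inner_smul_right,
      inner_neg_right, RCLike.conj_to_real, hqw, hbq, real_inner_comm g₁ b]
    ring
  · rintro ⟨b, w⟩ hX
    have key : ∀ Y ∈ tangentAt (q, v), symplecticForm (b, w) Y = f Y := hX.eq
    obtain ⟨hb, hw⟩ := hX.mem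
    simp only at hb hw
    have hqw : ⟪q, w⟫ = -⟪b, v⟫ := by linarith
    have hbq : ⟪b, q⟫ = 0 := by rw [real_inner_comm]; exact hb
    have hvq : ⟪v, q⟫ = 0 := by rw [real_inner_comm]; exact hqv
    have hb' : b = g₂ - ⟪g₂, q⟫ • q := by
      refine ext_inner_right ℝ fun u => ?_
      have := key (0, u - ⟪q, u⟫ • q) (by
        simp [tangentAt, inner_sub_right, inner_smul_right, hq])
      rw [hfY] at this
      simp only [symplecticForm, inner_sub_right, inner_smul_right, inner_zero_left,
        inner_zero_right, hbq] at this
      simp only [inner_sub_left, inner_smul_left, RCLike.conj_to_real]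
      linarith
    have hw' : w = -(g₁ - ⟪g₁, q⟫ • q - ⟪g₂, q⟫ • v) - ⟪g₂, v⟫ • q := by
      refine ext_inner_right ℝ fun u => ?_
      have := key (u - ⟪q, u⟫ • q, -⟪u, v⟫ • q) (by
        simp [tangentAt, inner_sub_right, inner_sub_left, inner_smul_right, inner_smul_left, hq,
          hqv])
      rw [hfY] at this
      have hbv : ⟪b, v⟫ = ⟪g₂, v⟫ := by
        rw [hb', inner_sub_left, inner_smul_left, hqv]; simp
      simp only [symplecticForm, inner_sub_right, inner_sub_left, inner_smul_right,
        inner_smul_left, hbq, hqw, hbv, RCLike.conj_to_real] at this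
      simp only [inner_sub_left, inner_smul_left, inner_neg_left, RCLike.conj_to_real]
      rw [real_inner_comm u w, real_inner_comm u v]
      linarith
    rw [← hb', ← hw']

open Classical in
/-- The Hamiltonian vector field of `F` on the tangent bundle of the sphere. -/
def hamiltonianVector (F : E × E → ℝ) (z : E × E) : E × E :=
  if h : ∃ X, IsHamiltonianVector F z X then h.choose else 0

theorem isHamiltonianVector_hamiltonianVector [CompleteSpace E] (F : E × E → ℝ) {z : E × E}
    (hz : z ∈ tangentSphere E) : IsHamiltonianVector F z (hamiltonianVector F z) := by
  have h := (existsUnique_isHamiltonianVector F hz).exists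
  rw [hamiltonianVector, dif_pos h]
  exact h.choose_spec

/-- The Poisson bracket `{F, G} = ω(X_F, X_G)` on the tangent bundle of the sphere. -/
def poissonBracket (F G : E × E → ℝ) (z : E × E) : ℝ :=
  symplecticForm (hamiltonianVector F z) (hamiltonianVector G z)

end Symplectic

/-! ### The Kepler problem on the sphere and averaging along its closed orbits -/

section Kepler

variable {E : Type*} [NormedAddCommGroup E] [InnerProductSpace ℝ E]

/-- The potential `-M cot θ`, with `θ` the central angle between `q` and the center `Z`. It is
extended to the ambient space as a function of the direction of `q`. -/
def keplerPotential (Z : E) (M : ℝ) (q : E) : ℝ :=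
  -M * Real.cot (InnerProductGeometry.angle q Z)

/-- The energy of the spherical Kepler problem. -/
def keplerEnergy (Z : E) (M : ℝ) (z : E × E) : ℝ :=
  ‖z.2‖ ^ 2 / 2 + keplerPotential Z M z.1

/-- `γ` is a non-singular orbit of the spherical Kepler problem with center `Z` and mass `M`: a
curve in the tangent bundle of the sphere, defined for all times, that avoids the singular points
`Z`, `-Z` and solves `∇_{q'} q' = -grad V`. The covariant derivative is the tangential part of the
acceleration, so the equation is tested against the vectors tangent to the sphere. -/
structure IsKeplerOrbit (Z : E) (M : ℝ) (γ : ℝ → E × E) : Prop where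
  mem : ∀ t, γ t ∈ tangentSphere E
  ne_center : ∀ t, (γ t).1 ≠ Z
  ne_antipode : ∀ t, (γ t).1 ≠ -Z
  velocity : ∀ t, HasDerivAt (fun s => (γ s).1) (γ t).2 t
  newton : ∀ t, ∃ acc : E, HasDerivAt (fun s => (γ s).2) acc t ∧
    ∀ u, ⟪(γ t).1, u⟫ = 0 → ⟪acc, u⟫ = -fderiv ℝ (keplerPotential Z M) (γ t).1 u

/-- `γ` is the closed Kepler orbit with initial state `z`, and `T > 0` is a period of it. -/
def IsClosedKeplerOrbit (Z : E) (M : ℝ) (z : E × E) (γ : ℝ → E × E) (T : ℝ) : Prop :=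
  IsKeplerOrbit Z M γ ∧ γ 0 = z ∧ 0 < T ∧ Function.Periodic γ T

open Classical in
/-- The average of a function `W` of the position over the closed Kepler orbit through `z`,
with respect to time normalized to total length one. -/
def keplerAverage (Z : E) (M : ℝ) (W : E → ℝ) (z : E × E) : ℝ :=
  if h : ∃ p : (ℝ → E × E) × ℝ, IsClosedKeplerOrbit Z M z p.1 p.2 then
    (h.choose.2)⁻¹ * ∫ t in (0 : ℝ)..h.choose.2, W (h.choose.1 t).1
  else 0

end Kepler

/-! ### The two-center problem on `S^d ⊂ ℝ^(d+1)` -/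

section TwoCenter

/-- The Euclidean space `ℝ^(d+1)` that contains the sphere `S^d`. -/
abbrev Ambient (d : ℕ) : Type := EuclideanSpace ℝ (Fin (d + 1))

/-- The last coordinate vector; the hemisphere of points with negative last coordinate is
projected to `ℝ^d × {-1}`. -/
def lastAxis (d : ℕ) : Ambient d := EuclideanSpace.single (Fin.last d) 1

/-- The last but one coordinate vector, which is the last coordinate vector of `ℝ^d`. -/
def centerAxis (d : ℕ) : Ambient d := EuclideanSpace.single ⟨d - 1, by omega⟩ 1

/-- The point `(0, …, 0, b, -1) / √(1 + b²)` of `S^d`, which the central projection sends to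
`(0, …, 0, b)`. The two centers are `center d a` and `center d (-a)`. -/
def center (d : ℕ) (b : ℝ) : Ambient d :=
  (√(1 + b ^ 2))⁻¹ • (b • centerAxis d - lastAxis d)

variable {d : ℕ}

/-- The energy of the spherical Kepler problem of the first center. -/
def firstEnergy (a m₁ : ℝ) : Ambient d × Ambient d → ℝ :=
  keplerEnergy (center d a) (m₁ * √(1 + a ^ 2))

/-- The potential of the second center. -/
def secondPotential (a m₂ : ℝ) : Ambient d → ℝ :=
  keplerPotential (center d (-a)) (m₂ * √(1 + a ^ 2))

/-- The averaging region: the states in the tangent bundle of `S^d` whose orbit in the Kepler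
problem of the first center is non-singular and avoids the second center and its antipode. -/
def averagingRegion (d : ℕ) (a m₁ : ℝ) : Set (Ambient d × Ambient d) :=
  {z | ∃ γ, IsKeplerOrbit (center d a) (m₁ * √(1 + a ^ 2)) γ ∧ γ 0 = z ∧
    ∀ t, (γ t).1 ≠ center d (-a) ∧ (γ t).1 ≠ -center d (-a)}

/-- The Hamiltonian of the partially averaged two-center problem. -/
def averagedEnergy (a m₁ m₂ : ℝ) (z : Ambient d × Ambient d) : ℝ :=
  firstEnergy a m₁ z +
    keplerAverage (center d a) (m₁ * √(1 + a ^ 2)) (secondPotential a m₂) z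

/-! #### The function `D = C² - 2 h A₁` -/

/-- `D = C² - 2 h A₁` for the Kepler problem in `ℝ^d` with mass `m₁` and center at the origin, as a
function of position and velocity. Here `C² = |ξ|²|ξ'|² - ⟪ξ, ξ'⟫²` is the square of the total
angular momentum, `A₁` is the component of the Laplace-Runge-Lenz vector
`|ξ'|² ξ - ⟪ξ, ξ'⟫ ξ' - m₁ ξ / |ξ|` in the direction `(0, …, 0, -1)` of the second center
`(0, …, 0, -2h)`, and `h = a / √(1 + a²)`. -/
def chartD (hd : 1 ≤ d) (a m₁ : ℝ) (ξ η : EuclideanSpace ℝ (Fin d)) : ℝ :=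
  (‖ξ‖ ^ 2 * ‖η‖ ^ 2 - ⟪ξ, η⟫ ^ 2) - 2 * (a / √(1 + a ^ 2)) *
    -(‖η‖ ^ 2 • ξ - ⟪ξ, η⟫ • η - (m₁ / ‖ξ‖) • ξ : EuclideanSpace ℝ (Fin d)) ⟨d - 1, by omega⟩

/-- The chart of the lower hemisphere: the central projection `x = -(q₁, …, q_d) / q_(d+1)`
followed by the affine change of the last coordinate `y ↦ (y - a) / √(1 + a²)`. -/
def chartPosition (d : ℕ) (a : ℝ) (q : Ambient d) : EuclideanSpace ℝ (Fin d) :=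
  WithLp.toLp 2 fun i =>
    if i.val = d - 1 then (-(q i.castSucc / q (Fin.last d)) - a) / √(1 + a ^ 2)
    else -(q i.castSucc / q (Fin.last d))

/-- The velocity in the chart with respect to the time of the corresponding system in `ℝ^d`. This
is `q_(d+1)² = 1 / (1 + |x|²)` times the derivative of `chartPosition` along the velocity `v`. -/
def chartVelocity (d : ℕ) (a : ℝ) (q v : Ambient d) : EuclideanSpace ℝ (Fin d) :=
  q (Fin.last d) ^ 2 • fderiv ℝ (chartPosition d a) q v

/-- The part of `q` orthogonal to the first center; its norm on the sphere is the sine of the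
central angle. -/
def orthPart (a : ℝ) (q : Ambient d) : Ambient d := q - ⟪center d a, q⟫ • center d a

/-- The unit vector orthogonal to the first center, in the plane of the two centers, that points
away from the second center. -/
def poleAxis (d : ℕ) (a : ℝ) : Ambient d :=
  (√(1 + a ^ 2))⁻¹ • (centerAxis d + a • lastAxis d)

/-- The square of the total angular momentum with respect to the first center. -/
def angularSq (a : ℝ) (z : Ambient d × Ambient d) : ℝ :=
  ‖orthPart a z.1‖ ^ 2 * ‖orthPart a z.2‖ ^ 2 - ⟪orthPart a z.1, orthPart a z.2⟫ ^ 2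

/-- The vector that represents `chartVelocity` in the orthogonal complement of the first
center. -/
def projVelocity (a : ℝ) (z : Ambient d × Ambient d) : Ambient d :=
  z.2 (Fin.last d) • orthPart a z.1 - z.1 (Fin.last d) • orthPart a z.2

/-- The Laplace-Runge-Lenz vector of the corresponding Kepler problem in `ℝ^d`, written without
the chart. -/
def lrlVector (a m₁ : ℝ) (z : Ambient d × Ambient d) : Ambient d :=
  ⟪orthPart a z.2, projVelocity a z⟫ • orthPart a z.1 -
    ⟪orthPart a z.1, projVelocity a z⟫ • orthPart a z.2 -
    (m₁ / ‖orthPart a z.1‖) • orthPart a z.1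

/-- The function `D = C² - 2 h A₁` on the tangent bundle of the sphere without the points over the
first center and its antipode: the analytic function that is given on the lower hemisphere by
`chartD`, see `integralD_eq_chartD`. -/
def integralD (a m₁ : ℝ) (z : Ambient d × Ambient d) : ℝ :=
  angularSq a z - 2 * (a / √(1 + a ^ 2)) * ⟪lrlVector a m₁ z, -poleAxis d a⟫

/-- Orthonormal coordinates on the orthogonal complement of the first center. -/
def orthCoord (d : ℕ) (a : ℝ) : Ambient d →ₗ[ℝ] EuclideanSpace ℝ (Fin d) where
  toFun x := WithLp.toLp 2 fun i =>
    if i.val = d - 1 then (x i.castSucc + a * x (Fin.last d)) / √(1 + a ^ 2) else x i.castSucc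
  map_add' x y := by
    ext i
    by_cases h : i.val = d - 1 <;> simp [h] ; ring
  map_smul' r x := by
    ext i
    by_cases h : i.val = d - 1 <;> simp [h] ; ring

theorem inner_center (hd : 1 ≤ d) (a : ℝ) (x : Ambient d) :
    ⟪center d a, x⟫ = (√(1 + a ^ 2))⁻¹ * (a * x ⟨d - 1, by omega⟩ - x (Fin.last d)) := by
  simp only [center, centerAxis, lastAxis, inner_smul_left, inner_sub_left,
    EuclideanSpace.inner_single_left, RCLike.conj_to_real, one_mul]

theorem inner_poleAxis (hd : 1 ≤ d) (a : ℝ) (x : Ambient d) :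
    ⟪poleAxis d a, x⟫ = (√(1 + a ^ 2))⁻¹ * (x ⟨d - 1, by omega⟩ + a * x (Fin.last d)) := by
  simp only [poleAxis, centerAxis, lastAxis, inner_smul_left, inner_add_left,
    EuclideanSpace.inner_single_left, RCLike.conj_to_real, one_mul]

theorem inner_center_self (hd : 1 ≤ d) (a : ℝ) : ⟪center d a, center d a⟫ = 1 := by
  have hs : √(1 + a ^ 2) ^ 2 = 1 + a ^ 2 := Real.sq_sqrt (by positivity)
  have hs0 : √(1 + a ^ 2) ≠ 0 := (Real.sqrt_pos.2 (by positivity)).ne'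
  have h1 : (⟨d - 1, by omega⟩ : Fin (d + 1)) ≠ Fin.last d := by
    simp [Fin.ext_iff]; omega
  rw [inner_center hd]
  simp [center, centerAxis, lastAxis, h1, h1.symm]
  field_simp
  rw [hs]; ring

theorem inner_poleAxis_center (hd : 1 ≤ d) (a : ℝ) : ⟪poleAxis d a, center d a⟫ = 0 := by
  have h1 : (⟨d - 1, by omega⟩ : Fin (d + 1)) ≠ Fin.last d := by
    simp [Fin.ext_iff]; omega
  rw [inner_poleAxis hd]
  simp [center, centerAxis, lastAxis, h1, h1.symm]
  ring_nf
  simp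

theorem orthCoord_last (hd : 1 ≤ d) (a : ℝ) (x : Ambient d) :
    orthCoord d a x ⟨d - 1, by omega⟩ = ⟪orthPart a x, poleAxis d a⟫ := by
  rw [orthPart, inner_sub_left, inner_smul_left, real_inner_comm (poleAxis d a) (center d a),
    inner_poleAxis_center hd, real_inner_comm (poleAxis d a) x, inner_poleAxis hd]
  simp [orthCoord]
  ring

theorem inner_orthCoord (hd : 1 ≤ d) (a : ℝ) (x y : Ambient d) :
    ⟪orthCoord d a x, orthCoord d a y⟫ = ⟪orthPart a x, orthPart a y⟫ := by
  have hs : √(1 + a ^ 2) ^ 2 = 1 + a ^ 2 := Real.sq_sqrt (by positivity)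
  have hs0 : √(1 + a ^ 2) ≠ 0 := (Real.sqrt_pos.2 (by positivity)).ne'
  have h1 : ⟪orthPart a x, orthPart a y⟫ = ⟪x, y⟫ - ⟪center d a, x⟫ * ⟪center d a, y⟫ := by
    simp only [orthPart, inner_sub_left, inner_sub_right, inner_smul_left, inner_smul_right,
      inner_center_self hd, real_inner_comm (center d a) x, RCLike.conj_to_real]
    ring
  rw [h1, inner_center hd, inner_center hd]
  obtain ⟨k, rfl⟩ : ∃ k, d = k + 1 := ⟨d - 1, by omega⟩
  have h2 : (⟨k + 1 - 1, by omega⟩ : Fin (k + 1 + 1)) = (Fin.last k).castSucc := rfl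
  rw [h2]
  simp only [PiLp.inner_apply, Fin.sum_univ_castSucc (n := k + 1), Fin.sum_univ_castSucc (n := k)]
  simp [orthCoord]
  have h4 : ∀ i : Fin k, i.val ≠ k := fun i => i.isLt.ne
  simp only [h4, if_false]
  field_simp
  rw [hs]
  ring

theorem chartPosition_eq (a : ℝ) {q : Ambient d} (hq : q (Fin.last d) ≠ 0) :
    chartPosition d a q = -(q (Fin.last d))⁻¹ • orthCoord d a q := by
  have hs0 : √(1 + a ^ 2) ≠ 0 := (Real.sqrt_pos.2 (by positivity)).ne'
  ext i
  by_cases h : i.val = d - 1 <;> simp [chartPosition, orthCoord, h] <;> field_simp <;> ring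

theorem chartVelocity_eq (a : ℝ) {q : Ambient d} (v : Ambient d) (hq : q (Fin.last d) ≠ 0) :
    chartVelocity d a q v =
      v (Fin.last d) • orthCoord d a q - q (Fin.last d) • orthCoord d a v := by
  have hev : chartPosition d a =ᶠ[nhds q]
      fun x : Ambient d => -(x (Fin.last d))⁻¹ • (orthCoord d a).toContinuousLinearMap x := by
    have hc : ContinuousAt (fun x : Ambient d => x (Fin.last d)) q := by fun_prop
    filter_upwards [hc.eventually_ne hq] with x hx
    rw [chartPosition_eq a hx]; rfl
  have hl : HasFDerivAt (fun x : Ambient d => x (Fin.last d))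
      (EuclideanSpace.proj (Fin.last d) : Ambient d →L[ℝ] ℝ) q :=
    (EuclideanSpace.proj (Fin.last d) : Ambient d →L[ℝ] ℝ).hasFDerivAt
  have hi := ((hasDerivAt_inv hq).comp_hasFDerivAt q hl).neg
  have hB := (orthCoord d a).toContinuousLinearMap.hasFDerivAt (x := q)
  have hder := (hi.smul hB).congr_of_eventuallyEq hev
  rw [chartVelocity, hder.fderiv]
  ext i
  simp
  field_simp
  ring

theorem integralD_eq_chartD (hd : 1 ≤ d) (a m₁ : ℝ) (q v : Ambient d)
    (hq : q (Fin.last d) < 0) :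
    integralD a m₁ (q, v) = chartD hd a m₁ (chartPosition d a q) (chartVelocity d a q v) := by
  rw [chartPosition_eq a hq.ne, chartVelocity_eq a v hq.ne]
  have hn : ‖-(q (Fin.last d))⁻¹ • orthCoord d a q‖ = -(q (Fin.last d))⁻¹ * ‖orthPart a q‖ := by
    rw [norm_smul, Real.norm_of_nonneg (by simpa using (inv_lt_zero.2 hq).le)]
    congr 1
    rw [← sq_eq_sq₀ (norm_nonneg _) (norm_nonneg _), ← real_inner_self_eq_norm_sq,
      ← real_inner_self_eq_norm_sq, inner_orthCoord hd]
  rw [integralD, chartD, hn]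
  simp only [angularSq, lrlVector, projVelocity, mul_pow, PiLp.sub_apply, PiLp.smul_apply,
    smul_eq_mul, orthCoord_last hd, inner_neg_right, ← real_inner_self_eq_norm_sq,
    inner_sub_left, inner_sub_right, inner_smul_left, inner_smul_right, inner_orthCoord hd,
    RCLike.conj_to_real, real_inner_comm (orthPart a q) (orthPart a v)]
  have h0 := hq.ne
  by_cases hz : ‖orthPart a q‖ = 0
  · have hz' : orthPart a q = 0 := norm_eq_zero.1 hz
    simp [hz']
  · field_simp
    ring

end TwoCenter

end SphericalTwoCenter

end

open scoped RealInnerProductSpace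

noncomputable section

namespace SphericalTwoCenter

open Set Filter Topology MeasureTheory
open scoped Interval

/-! ### Calculus tools -/

/-! The function `D` is a first integral `G` of the Kepler problem of the first center: with the
second center written as `c Z + k T`, it is a combination of the conserved quantities `momentumSq`,
`lrlComponent` and `momentumSqAlong` (`integralD_eq_twoCenterIntegral`,
`hasDerivAt_twoCenterIntegral`). Hence `{E_sKep, G} = 0`, and it remains to treat the average of the
second potential `W`. The Hamiltonian flow of `G` commutes with the Kepler flow, so `{⟨W⟩, G}`
should be the average of `{W, G}` over the Kepler orbit. As `W` depends on the position only, `{W,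
G}` is the vertical derivative `dG (0, grad W)`, and this is the time derivative along Kepler orbits
of a function `Φ` of the position (`fderivWithin_twoCenterIntegral_vertical`,
`hasDerivAt_secondCenterFunction`). Its average over a closed orbit is zero. Equivalently, `G + Φ`
is the integral of the unaveraged two-center problem.

The averaging argument is carried out without the flow of `G`. Non-singular orbits have nonzero
angular momentum because `m₁ ≠ 0` (`IsKeplerOrbit.momentumSq_pos`), so they are the conics `cot θ =
M / C² + α cos ψ + β sin ψ`, with data depending smoothly on the initial state. In the angle `ψ` all
orbits have period `2π`, and the average is a quotient of two integrals over `[0, 2π]`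
(`keplerAverage_eq`), which can be differentiated under the integral sign.

For the Hamiltonian vector `X` of `G`, the variation of the orbit at fixed angle is a Jacobi field
of the time-changed Kepler problem. Conservation of the symplectic form along such fields shows that
its position part is that of the Hamiltonian vector of `G` at the moving point, plus `σ` times the
velocity, where `σ` is the accumulated variation of time (`inner_stateVariation`). Periodicity
forces `σ (2π) = 0`, so the period does not change in the direction `X`. The varied integrand of `W`
is then the derivative of `Φ + σ W`, and its integral over one revolution vanishes
(`fderiv_revolutionIntegral_eq_zero`). -/

theorem _root_.ContinuousOn.aestronglyMeasurable_uIoc {G : Type*} [NormedAddCommGroup G]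
    {g : ℝ → G} {a b : ℝ} (hg : ContinuousOn g (uIcc a b)) :
    AEStronglyMeasurable g (volume.restrict (Ι a b)) :=
  (hg.aestronglyMeasurable_of_isCompact isCompact_uIcc measurableSet_uIcc).mono_measure
    (Measure.restrict_mono uIoc_subset_uIcc le_rfl)

/-- Differentiation under an interval integral of a jointly `C¹` integrand. -/
theorem hasFDerivAt_intervalIntegral_of_contDiffAt {H : Type*} [NormedAddCommGroup H]
    [NormedSpace ℝ H] {f : H → ℝ → ℝ} {x₀ : H} {a b : ℝ}
    (hf : ∀ t ∈ uIcc a b, ContDiffAt ℝ 1 (fun p : H × ℝ => f p.1 p.2) (x₀, t)) :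
    HasFDerivAt (fun x => ∫ t in a..b, f x t)
      (∫ t in a..b, fderiv ℝ (fun x => f x t) x₀) x₀ := by
  set F : H × ℝ → ℝ := fun p => f p.1 p.2 with hF
  set F' : H × ℝ → (H →L[ℝ] ℝ) :=
    fun p => (fderiv ℝ F p).comp (ContinuousLinearMap.inl ℝ H ℝ) with hF'
  have hcont : ∀ t ∈ uIcc a b, ContinuousAt F' (x₀, t) := by
    intro t ht
    have h1 : ContinuousAt (fderiv ℝ F) (x₀, t) :=
      ((hf t ht).fderiv_right (m := 0) (by norm_num)).continuousAt
    exact h1.clm_comp continuousAt_const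
  have hpart : ∀ p : H × ℝ, DifferentiableAt ℝ F p →
      HasFDerivAt (fun x => f x p.2) (F' p) p.1 := by
    intro p hp
    have h1 : HasFDerivAt (fun x : H => (x, p.2)) (ContinuousLinearMap.inl ℝ H ℝ) p.1 :=
      hasFDerivAt_prodMk_left p.1 p.2
    exact HasFDerivAt.comp (g := F) p.1 hp.hasFDerivAt h1
  have hev : ∀ t ∈ uIcc a b, ∀ᶠ p in 𝓝 (x₀, t),
      ContDiffAt ℝ 1 F p ∧ ‖F' p‖ ≤ ‖F' (x₀, t)‖ + 1 := by
    intro t ht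
    refine ((hf t ht).eventually (by simp)).and ?_
    have := (hcont t ht).norm.eventually (gt_mem_nhds (lt_add_one ‖F' (x₀, t)‖))
    exact this.mono fun p hp => hp.le
  obtain ⟨B, hB⟩ : ∃ B, ∀ t ∈ uIcc a b, ‖F' (x₀, t)‖ ≤ B := by
    have hc : ContinuousOn (fun t => F' (x₀, t)) (uIcc a b) := fun t ht =>
      ((hcont t ht).comp (f := fun t : ℝ => (x₀, t)) (by fun_prop)).continuousWithinAt
    exact isCompact_uIcc.exists_bound_of_continuousOn hc
  -- The smoothness hypothesis is pointwise in `t`; compactness of the interval yields one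
  -- neighbourhood of `x₀` with a bound uniform in `t`, as dominated convergence requires.
  obtain ⟨s, hs, hsub⟩ : ∃ s ∈ 𝓝 x₀, ∀ x ∈ s, ∀ t ∈ uIcc a b,
      ContDiffAt ℝ 1 F (x, t) ∧ ‖F' (x, t)‖ ≤ B + 1 := by
    have : ∀ᶠ x in 𝓝 x₀, ∀ t ∈ uIcc a b, ContDiffAt ℝ 1 F (x, t) ∧ ‖F' (x, t)‖ ≤ B + 1 := by
      refine isCompact_uIcc.eventually_forall_of_forall_eventually fun t ht => ?_
      filter_upwards [hev t ht] with p hp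
      exact ⟨hp.1, hp.2.trans (by have := hB t ht; linarith)⟩
    exact ⟨_, this, fun x hx => hx⟩
  have hFc : ∀ x ∈ s, ContinuousOn (fun t => f x t) (uIcc a b) := fun x hx t ht =>
    (((hsub x hx t ht).1.continuousAt).comp (f := fun t : ℝ => (x, t))
      (by fun_prop)).continuousWithinAt
  have hx₀ := mem_of_mem_nhds hs
  have hF'c : ContinuousOn (fun t => F' (x₀, t)) (uIcc a b) := fun t ht =>
    ((hcont t ht).comp (f := fun t : ℝ => (x₀, t)) (by fun_prop)).continuousWithinAt
  have key := intervalIntegral.hasFDerivAt_integral_of_dominated_of_fderiv_le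
    (μ := volume) (F := f) (F' := fun x t => F' (x, t)) (a := a) (b := b)
    (bound := fun _ => B + 1) hs
    (by filter_upwards [hs] with x hx using
      (hFc x hx).aestronglyMeasurable_uIoc)
    (hFc x₀ hx₀).intervalIntegrable
    hF'c.aestronglyMeasurable_uIoc
    (ae_of_all _ fun t ht x hx => (hsub x hx t (uIoc_subset_uIcc ht)).2)
    (by simp)
    (ae_of_all _ fun t ht x hx => hpart (x, t)
      ((hsub x hx t (uIoc_subset_uIcc ht)).1.differentiableAt (by simp)))
  have heq : ∫ t in a..b, fderiv ℝ (fun x => f x t) x₀ = ∫ t in a..b, F' (x₀, t) :=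
    intervalIntegral.integral_congr fun t ht =>
      (hpart (x₀, t) ((hf t ht).differentiableAt (by simp))).fderiv
  rw [heq]
  exact key

/-- Makes the operator-valued integrands of the differentiated integrals continuous, so that these
integrals can be evaluated at a vector under the integral sign. -/
theorem continuousAt_fderiv_left {H : Type*} [NormedAddCommGroup H] [NormedSpace ℝ H]
    {f : H → ℝ → ℝ} {x₀ : H} {t : ℝ}
    (hf : ContDiffAt ℝ 1 (fun p : H × ℝ => f p.1 p.2) (x₀, t)) :
    ContinuousAt (fun t' => fderiv ℝ (fun x => f x t') x₀) t := by
  have h1 : ContinuousAt (fun t' : ℝ => (fderiv ℝ (fun p : H × ℝ => f p.1 p.2) (x₀, t')).comp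
      (ContinuousLinearMap.inl ℝ H ℝ)) t :=
    ((((hf.fderiv_right (m := 0) (by norm_num)).continuousAt).comp
      (f := fun t' : ℝ => (x₀, t')) (by fun_prop)).clm_comp continuousAt_const)
  refine h1.congr ?_
  have hc : Tendsto (fun t' : ℝ => (x₀, t')) (𝓝 t) (𝓝 (x₀, t)) :=
    Continuous.tendsto (by fun_prop) t
  filter_upwards [hc.eventually (hf.eventually (by simp))] with t' ht'
  have hp : HasFDerivAt (fun x : H => (x, t')) (ContinuousLinearMap.inl ℝ H ℝ) x₀ :=
    hasFDerivAt_prodMk_left x₀ t'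
  exact (HasFDerivAt.comp (g := fun p : H × ℝ => f p.1 p.2) x₀
    (ht'.differentiableAt (by simp)).hasFDerivAt hp).fderiv.symm

/-- Symmetry of mixed partial derivatives: if `∂₂ u (·, t)` agrees near `0` with a function whose
derivative at `0` is `w'`, then `∂₁ u (0, ·)` has derivative `w'` at `t`. -/
theorem hasDerivAt_deriv_comm {G : Type*} [NormedAddCommGroup G] [NormedSpace ℝ G]
    {u : ℝ → ℝ → G} {t : ℝ} (hu : ContDiffAt ℝ 2 (fun p : ℝ × ℝ => u p.1 p.2) (0, t))
    {w : ℝ → G} {w' : G} (hw : ∀ᶠ s in 𝓝 0, HasDerivAt (fun t' => u s t') (w s) t)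
    (hw' : HasDerivAt w w' 0) :
    HasDerivAt (fun t' => deriv (fun s => u s t') 0) w' t := by
  set f : ℝ × ℝ → G := fun p => u p.1 p.2 with hf
  have hd : ∀ᶠ p in 𝓝 ((0 : ℝ), t), DifferentiableAt ℝ f p := by
    filter_upwards [hu.eventually (by simp)] with p hp
    exact hp.differentiableAt (by simp)
  have hf2 : DifferentiableAt ℝ (fderiv ℝ f) (0, t) :=
    (hu.fderiv_right (m := 1) (by norm_num)).differentiableAt (by simp)
  have h1 : ∀ p : ℝ × ℝ, DifferentiableAt ℝ f p →
      HasDerivAt (fun s => u s p.2) (fderiv ℝ f p (1, 0)) p.1 := by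
    intro p hp
    have h := hp.hasFDerivAt.comp_hasDerivAt_of_eq (f := fun s : ℝ => (s, p.2)) p.1
      ((hasDerivAt_id p.1).prodMk (hasDerivAt_const p.1 p.2)) rfl
    exact h
  have h2 : ∀ p : ℝ × ℝ, DifferentiableAt ℝ f p →
      HasDerivAt (fun t' => u p.1 t') (fderiv ℝ f p (0, 1)) p.2 := by
    intro p hp
    have h := hp.hasFDerivAt.comp_hasDerivAt_of_eq (f := fun s : ℝ => (p.1, s)) p.2
      ((hasDerivAt_const p.2 p.1).prodMk (hasDerivAt_id p.2)) rfl
    exact h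
  have hc1 : Tendsto (fun t' : ℝ => ((0 : ℝ), t')) (𝓝 t) (𝓝 (0, t)) :=
    Continuous.tendsto (by fun_prop) t
  have hc2 : Tendsto (fun s : ℝ => (s, t)) (𝓝 0) (𝓝 (0, t)) :=
    Continuous.tendsto (by fun_prop) 0
  have e1 : (fun t' => deriv (fun s => u s t') 0) =ᶠ[𝓝 t] fun t' => fderiv ℝ f (0, t') (1, 0) := by
    filter_upwards [hc1.eventually hd] with t' ht'
    exact (h1 _ ht').deriv
  have e2 : w =ᶠ[𝓝 0] fun s => fderiv ℝ f (s, t) (0, 1) := by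
    filter_upwards [hc2.eventually hd, hw] with s hs hws
    exact hws.unique (h2 _ hs)
  have d1 : HasDerivAt (fun t' => fderiv ℝ f (0, t') (1, 0))
      (fderiv ℝ (fderiv ℝ f) (0, t) (0, 1) (1, 0)) t := by
    have h := hf2.hasFDerivAt.comp_hasDerivAt_of_eq (f := fun s : ℝ => ((0 : ℝ), s)) t
      ((hasDerivAt_const t (0 : ℝ)).prodMk (hasDerivAt_id t)) rfl
    exact (h.clm_apply (hasDerivAt_const t ((1 : ℝ), (0 : ℝ)))).congr_deriv (by simp)
  have d2 : HasDerivAt (fun s => fderiv ℝ f (s, t) (0, 1))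
      (fderiv ℝ (fderiv ℝ f) (0, t) (1, 0) (0, 1)) 0 := by
    have h := hf2.hasFDerivAt.comp_hasDerivAt_of_eq (f := fun s : ℝ => (s, t)) 0
      ((hasDerivAt_id (0 : ℝ)).prodMk (hasDerivAt_const (0 : ℝ) t)) rfl
    exact (h.clm_apply (hasDerivAt_const 0 ((0 : ℝ), (1 : ℝ)))).congr_deriv (by simp)
  have hsymm : IsSymmSndFDerivAt ℝ f (0, t) := hu.isSymmSndFDerivAt (by simp)
  have hval : w' = fderiv ℝ (fderiv ℝ f) (0, t) (0, 1) (1, 0) := by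
    rw [hsymm.eq]
    exact (hw'.congr_of_eventuallyEq e2.symm).unique d2
  rw [hval]
  exact d1.congr_of_eventuallyEq e1

/-- The mean of a continuous periodic function does not depend on the period. -/
theorem average_eq_of_periodic {f : ℝ → ℝ} (hf : Continuous f) {S T : ℝ} (hS : 0 < S) (hT : 0 < T)
    (hfS : Function.Periodic f S) (hfT : Function.Periodic f T) :
    S⁻¹ * ∫ t in (0 : ℝ)..S, f t = T⁻¹ * ∫ t in (0 : ℝ)..T, f t := by
  have hInt : ∀ a b, IntervalIntegrable f volume a b := fun a b => hf.intervalIntegrable a b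
  -- The primitive minus its mean growth is periodic and continuous, hence bounded. Two different
  -- means would give a bounded nonzero linear function.
  have bdd : ∀ R : ℝ, 0 < R → Function.Periodic f R →
      ∃ B, ∀ t, |(∫ x in (0 : ℝ)..t, f x) - (R⁻¹ * ∫ x in (0 : ℝ)..R, f x) * t| ≤ B := by
    intro R hR hfR
    set g : ℝ → ℝ := fun t => (∫ x in (0 : ℝ)..t, f x) - (R⁻¹ * ∫ x in (0 : ℝ)..R, f x) * t
      with hg
    have hgp : Function.Periodic g R := by
      intro t
      have h1 : ∫ x in (0 : ℝ)..(t + R), f x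
          = (∫ x in (0 : ℝ)..t, f x) + ∫ x in (0 : ℝ)..R, f x := by
        rw [← intervalIntegral.integral_add_adjacent_intervals (hInt 0 t) (hInt t (t + R)),
          hfR.intervalIntegral_add_eq t 0, zero_add]
      simp only [hg, h1]
      field_simp
      ring
    have hgc : Continuous g := by
      have := intervalIntegral.continuous_primitive hInt 0
      fun_prop
    obtain ⟨B, hB⟩ := (isCompact_Icc (a := (0 : ℝ)) (b := R)).exists_bound_of_continuousOn
      hgc.continuousOn
    refine ⟨B, fun t => ?_⟩
    obtain ⟨y, hy, hgy⟩ := hgp.exists_mem_Ico₀ hR t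
    have := hB y ⟨hy.1, hy.2.le⟩
    change |g t| ≤ B
    rw [hgy]
    exact this
  obtain ⟨B₁, h₁⟩ := bdd S hS hfS
  obtain ⟨B₂, h₂⟩ := bdd T hT hfT
  by_contra hne
  set p := S⁻¹ * ∫ t in (0 : ℝ)..S, f t
  set r := T⁻¹ * ∫ t in (0 : ℝ)..T, f t
  have hpos : 0 < |p - r| := abs_pos.2 (sub_ne_zero.2 hne)
  set t := (B₁ + B₂ + 1) / |p - r|
  have k1 := h₁ t
  have k2 := h₂ t
  have hB1 := (abs_nonneg _).trans k1
  have hB2 := (abs_nonneg _).trans k2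
  have k3 : |(p - r) * t| ≤ B₁ + B₂ := by
    have e : (p - r) * t = ((∫ x in (0 : ℝ)..t, f x) - r * t)
      - ((∫ x in (0 : ℝ)..t, f x) - p * t) := by ring
    rw [e]
    exact (abs_sub _ _).trans (by linarith)
  rw [abs_mul, abs_of_nonneg (show 0 ≤ t by positivity), mul_div_cancel₀ _ hpos.ne'] at k3
  linarith

/-- A function on the line whose second derivative is bounded below by a positive constant is
unbounded above. -/
theorem exists_gt_of_second_deriv_ge {h h' h'' : ℝ → ℝ} (hh : ∀ t, HasDerivAt h (h' t) t)
    (hh' : ∀ t, HasDerivAt h' (h'' t) t) {ε : ℝ} (hε : 0 < ε) (hge : ∀ t, ε ≤ h'' t) (B : ℝ) :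
    ∃ t, B < h t := by
  have m1 : Monotone fun t => h' t - ε * t := by
    refine monotone_of_hasDerivAt_nonneg (f' := fun t => h'' t - ε)
      (fun t => ?_) fun t => sub_nonneg.2 (hge t)
    exact ((hh' t).sub ((hasDerivAt_id t).const_mul ε)).congr_deriv (by simp)
  have m2 : MonotoneOn (fun t => h t - h' 0 * t - ε * t ^ 2 / 2) (Ici 0) := by
    have hd : ∀ t, HasDerivAt (fun t => h t - h' 0 * t - ε * t ^ 2 / 2)
        (h' t - h' 0 - ε * t) t := fun t => by
      have h3 := (((hasDerivAt_pow 2 t).const_mul ε).div_const 2)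
      refine (((hh t).sub ((hasDerivAt_id t).const_mul (h' 0))).sub h3).congr_deriv ?_
      simp; ring
    refine monotoneOn_of_deriv_nonneg (convex_Ici 0)
      (fun t _ => (hd t).continuousAt.continuousWithinAt)
      (fun t _ => (hd t).differentiableAt.differentiableWithinAt) fun t ht => ?_
    rw [(hd t).deriv]
    rw [interior_Ici] at ht
    have := m1 (le_of_lt (show (0 : ℝ) < t from ht))
    simp only [mul_zero, sub_zero] at this
    linarith
  -- Chosen so that `h' 0 + ε t / 2` is at least `|B - h 0| + 1`; since `t ≥ 1`, the quadratic lower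
  -- bound for `h t` from `m2` then exceeds `B`.
  set t := (|h' 0| + |B - h 0| + 1) * 2 / ε + 1 with ht
  have ht1 : 1 ≤ t := by rw [ht]; simp only [le_add_iff_nonneg_left]; positivity
  refine ⟨t, ?_⟩
  have k := m2 (by simp : (0 : ℝ) ∈ Ici 0) (by simp; linarith : t ∈ Ici (0 : ℝ)) (by linarith)
  simp only [mul_zero, sub_zero] at k
  have h5 : ε * t ≥ (|h' 0| + |B - h 0| + 1) * 2 := by
    rw [ht, mul_add, mul_div_cancel₀ _ hε.ne']; linarith
  have h6 := neg_abs_le (h' 0)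
  have h7 := le_abs_self (B - h 0)
  have h8 : (h' 0 + ε * t / 2) * 1 ≤ (h' 0 + ε * t / 2) * t :=
    mul_le_mul_of_nonneg_left ht1 (by have := abs_nonneg (B - h 0); linarith)
  nlinarith

variable {E : Type*} [NormedAddCommGroup E] [InnerProductSpace ℝ E]

/-! ### Derivatives along the tangent bundle of the sphere -/

/-- Every tangent vector of the tangent bundle of the sphere is the velocity of a smooth curve. -/
theorem exists_curve_of_mem_tangentAt {z Y : E × E} (hz : z ∈ tangentSphere E)
    (hY : Y ∈ tangentAt z) :
    ∃ c : ℝ → E × E, c 0 = z ∧ HasDerivAt c Y 0 ∧ ContDiff ℝ 2 c ∧ ∀ s, c s ∈ tangentSphere E := by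
  obtain ⟨q, v⟩ := z
  obtain ⟨b, w⟩ := Y
  obtain ⟨hq, hqv⟩ := hz
  obtain ⟨hb, hw⟩ := hY
  simp only at hq hqv hb hw
  have hqq : ⟪q, q⟫ = 1 := by rw [real_inner_self_eq_norm_sq, hq]; norm_num
  have hpos : ∀ s : ℝ, 0 < 1 + s ^ 2 * ‖b‖ ^ 2 := fun s => by positivity
  have hn : ∀ s : ℝ, ‖q + s • b‖ ^ 2 = 1 + s ^ 2 * ‖b‖ ^ 2 := fun s => by
    rw [norm_add_sq_real, hq, inner_smul_right, hb, norm_smul, mul_pow, Real.norm_eq_abs, sq_abs]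
    ring
  -- The linearized constraints give `⟪q + s b, v + s w⟫ = s² ⟪b, w⟫`. Normalizing the position and
  -- removing this component from the velocity are corrections of second order in `s`, so the
  -- velocity of the curve at `0` is still `(b, w)`.
  set c : ℝ → E × E := fun s => ((√(1 + s ^ 2 * ‖b‖ ^ 2))⁻¹ • (q + s • b),
    v + s • w - (s ^ 2 * ⟪b, w⟫ / (1 + s ^ 2 * ‖b‖ ^ 2)) • (q + s • b)) with hc
  have hroot : ContDiff ℝ 2 fun s : ℝ => √(1 + s ^ 2 * ‖b‖ ^ 2) :=
    ContDiff.sqrt (by fun_prop) fun s => (hpos s).ne'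
  have hcd : ContDiff ℝ 2 c := by
    refine ContDiff.prodMk ?_ ?_
    · exact (hroot.inv fun s => (Real.sqrt_pos.2 (hpos s)).ne').smul (by fun_prop)
    · refine ContDiff.sub (by fun_prop) (ContDiff.smul ?_ (by fun_prop))
      exact ContDiff.div (by fun_prop) (by fun_prop) fun s => (hpos s).ne'
  refine ⟨c, by simp [hc], ?_, hcd, fun s => ⟨?_, ?_⟩⟩
  · have hp : HasDerivAt (fun s : ℝ => 1 + s ^ 2 * ‖b‖ ^ 2) 0 0 := by
      have := ((hasDerivAt_pow 2 (0 : ℝ)).mul_const (‖b‖ ^ 2)).const_add 1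
      simpa using this
    have hl : ∀ x y : E, HasDerivAt (fun s : ℝ => x + s • y) y 0 := fun x y => by
      simpa using ((hasDerivAt_id (0 : ℝ)).smul_const y).const_add x
    have h1 : HasDerivAt (fun s : ℝ => (√(1 + s ^ 2 * ‖b‖ ^ 2))⁻¹) 0 0 := by
      exact ((hp.sqrt (by simp)).inv (by simp)).congr_deriv (by simp)
    have h2 : HasDerivAt (fun s : ℝ => s ^ 2 * ⟪b, w⟫ / (1 + s ^ 2 * ‖b‖ ^ 2)) 0 0 := by
      exact (((hasDerivAt_pow 2 (0 : ℝ)).mul_const ⟪b, w⟫).div hp (by simp)).congr_deriv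
        (by simp)
    refine HasDerivAt.prodMk ?_ ?_
    · exact (h1.smul (hl q b)).congr_deriv (by simp)
    · exact ((hl v w).sub (h2.smul (hl q b))).congr_deriv (by simp)
  · change ‖(√(1 + s ^ 2 * ‖b‖ ^ 2))⁻¹ • (q + s • b)‖ = 1
    rw [norm_smul, norm_inv, Real.norm_of_nonneg (Real.sqrt_nonneg _), ← hn,
      Real.sqrt_sq (norm_nonneg _)]
    refine inv_mul_cancel₀ fun h => ?_
    have := hn s
    rw [h] at this
    nlinarith [hpos s]
  · change ⟪(√(1 + s ^ 2 * ‖b‖ ^ 2))⁻¹ • (q + s • b),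
      v + s • w - (s ^ 2 * ⟪b, w⟫ / (1 + s ^ 2 * ‖b‖ ^ 2)) • (q + s • b)⟫ = 0
    rw [inner_smul_left, inner_sub_right, inner_smul_right (q + s • b),
      real_inner_self_eq_norm_sq, hn, div_mul_cancel₀ _ (hpos s).ne']
    have : ⟪q + s • b, v + s • w⟫ = s ^ 2 * ⟪b, w⟫ := by
      simp only [inner_add_left, inner_add_right, inner_smul_left, inner_smul_right, hqv,
        RCLike.conj_to_real]
      linear_combination s * hw
    rw [this]; simp

theorem hasDerivAt_comp_of_mem_tangentSphere {F : E × E → ℝ} {z Y : E × E} {c : ℝ → E × E}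
    (hF : DifferentiableWithinAt ℝ F (tangentSphere E) z) {t : ℝ} (h0 : c t = z)
    (hc : HasDerivAt c Y t) (hmem : ∀ᶠ s in 𝓝 t, c s ∈ tangentSphere E) :
    HasDerivAt (fun s => F (c s)) (fderivWithin ℝ F (tangentSphere E) z Y) t := by
  have h := hF.hasFDerivWithinAt.comp_hasDerivWithinAt_of_eq (f := c) t
    (s := {s | c s ∈ tangentSphere E}) hc.hasDerivWithinAt (fun s hs => hs) h0.symm
  exact h.hasDerivAt hmem

/-- On tangent vectors the derivative within the tangent bundle of the sphere is given by any
ambient derivative. -/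
theorem fderivWithin_tangentSphere_apply {F G : E × E → ℝ} {z Y : E × E} {G' : E × E →L[ℝ] ℝ}
    (hz : z ∈ tangentSphere E) (hY : Y ∈ tangentAt z) (hG : HasFDerivAt G G' z)
    (hFG : F =ᶠ[𝓝[tangentSphere E] z] G) :
    fderivWithin ℝ F (tangentSphere E) z Y = G' Y := by
  -- Derivatives within `tangentSphere E` are not unique as linear maps on `E × E`; a curve inside
  -- the set with velocity `Y` determines the value on the tangent vector `Y`.
  obtain ⟨c, h0, hc, -, hmem⟩ := exists_curve_of_mem_tangentAt hz hY
  have hFG' : F z = G z := hFG.eq_of_nhdsWithin hz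
  have hF : DifferentiableWithinAt ℝ F (tangentSphere E) z :=
    (hG.hasFDerivWithinAt.congr_of_eventuallyEq hFG hFG').differentiableWithinAt
  rw [hFG.fderivWithin_eq hFG']
  have hGd : DifferentiableWithinAt ℝ G (tangentSphere E) z :=
    hG.hasFDerivWithinAt.differentiableWithinAt
  refine (hasDerivAt_comp_of_mem_tangentSphere hGd h0 hc (Eventually.of_forall hmem)).unique ?_
  exact hG.comp_hasDerivAt_of_eq (0 : ℝ) hc h0.symm

theorem poissonBracket_eq [CompleteSpace E] (F G : E × E → ℝ) {z : E × E}
    (hz : z ∈ tangentSphere E) :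
    poissonBracket F G z = fderivWithin ℝ F (tangentSphere E) z (hamiltonianVector G z) :=
  (isHamiltonianVector_hamiltonianVector F hz).eq _
    (isHamiltonianVector_hamiltonianVector G hz).mem

/-! ### The Kepler field -/

/-- The coefficient `M / sin³ θ` of the Kepler force. -/
def keplerCoeff (Z : E) (M : ℝ) (q : E) : ℝ := M / √(1 - ⟪Z, q⟫ ^ 2) ^ 3

/-- The acceleration in the ambient space of the Kepler problem on the sphere. -/
def keplerForce (Z : E) (M : ℝ) (z : E × E) : E :=
  -(‖z.2‖ ^ 2 + ⟪Z, z.1⟫ * keplerCoeff Z M z.1) • z.1 + keplerCoeff Z M z.1 • Z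

/-- No condition on `q` is needed: if `q` is zero or parallel to `Z`, both sides are `0` by the
conventions for division by zero. -/
theorem cot_angle {Z : E} (hZ : ‖Z‖ = 1) (q : E) :
    Real.cot (InnerProductGeometry.angle q Z) = ⟪Z, q⟫ * (√(‖q‖ ^ 2 - ⟪Z, q⟫ ^ 2))⁻¹ := by
  by_cases hq : q = 0
  · simp [hq, Real.cot_eq_cos_div_sin]
  have hn : 0 < ‖q‖ := norm_pos_iff.2 hq
  have habs : |⟪q, Z⟫ / (‖q‖ * ‖Z‖)| ≤ 1 := abs_real_inner_div_norm_mul_norm_le_one q Z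
  rw [hZ, mul_one, abs_le] at habs
  rw [InnerProductGeometry.angle, hZ, mul_one, Real.cot_eq_cos_div_sin,
    Real.cos_arccos habs.1 habs.2, Real.sin_arccos, real_inner_comm]
  have : 1 - (⟪Z, q⟫ / ‖q‖) ^ 2 = (‖q‖ ^ 2 - ⟪Z, q⟫ ^ 2) / ‖q‖ ^ 2 := by
    field_simp
  rw [this, Real.sqrt_div' _ (by positivity), Real.sqrt_sq hn.le]
  field_simp

theorem keplerPotential_eq {Z : E} (hZ : ‖Z‖ = 1) (M : ℝ) :
    keplerPotential Z M = fun q : E => -M * (⟪Z, q⟫ * (√(‖q‖ ^ 2 - ⟪Z, q⟫ ^ 2))⁻¹) := by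
  funext q
  rw [keplerPotential, cot_angle hZ]

theorem contDiffAt_keplerPotential {Z : E} (hZ : ‖Z‖ = 1) (M : ℝ) {q : E}
    (hq : 0 < ‖q‖ ^ 2 - ⟪Z, q⟫ ^ 2) {n : WithTop ℕ∞} :
    ContDiffAt ℝ n (keplerPotential Z M) q := by
  rw [keplerPotential_eq hZ]
  have h1 : ContDiffAt ℝ n (fun q : E => ⟪Z, q⟫) q := contDiffAt_const.inner ℝ contDiffAt_id
  have h2 : ContDiffAt ℝ n (fun q : E => ‖q‖ ^ 2) q := (contDiff_norm_sq ℝ).contDiffAt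
  refine contDiffAt_const.mul (h1.mul (((h2.sub (h1.pow 2)).sqrt hq.ne').inv ?_))
  exact (Real.sqrt_pos.2 hq).ne'

/-- The potential was extended as a function of the direction of `q`, so at points of the sphere the
ambient gradient is already tangent and no projection is needed. -/
theorem hasFDerivAt_keplerPotential {Z : E} (hZ : ‖Z‖ = 1) (M : ℝ) {q : E} (hq : ‖q‖ = 1)
    (hlt : ⟪Z, q⟫ ^ 2 < 1) :
    HasFDerivAt (keplerPotential Z M)
      (innerSL ℝ (-keplerCoeff Z M q • (Z - ⟪Z, q⟫ • q))) q := by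
  have hpos : 0 < ‖q‖ ^ 2 - ⟪Z, q⟫ ^ 2 := by rw [hq]; linarith
  have hr := Real.sqrt_pos.2 hpos
  rw [keplerPotential_eq hZ]
  have h1 : HasFDerivAt (fun q : E => ⟪Z, q⟫) (innerSL ℝ Z) q := (innerSL ℝ Z).hasFDerivAt
  have h2 : HasFDerivAt (fun q : E => ‖q‖ ^ 2) (2 • innerSL ℝ q) q :=
    (hasStrictFDerivAt_norm_sq q).hasFDerivAt
  have h3 := ((h2.sub (h1.pow 2)).sqrt hpos.ne')
  have h4 := (hasDerivAt_inv hr.ne').comp_hasFDerivAt q h3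
  refine ((h1.mul h4).const_mul (-M)).congr_fderiv ?_
  ext u
  have hs : √(1 - ⟪Z, q⟫ ^ 2) ^ 2 = 1 - ⟪Z, q⟫ ^ 2 := Real.sq_sqrt (by linarith)
  rw [hq, one_pow] at hr
  have hr' := hr.ne'
  simp [keplerCoeff, hq]
  field_simp
  linear_combination (-M * ⟪Z, u⟫) * hs

/-- The equality case of Cauchy-Schwarz. It turns avoidance of `±Z` into an open inequality, the
form in which it is used below. -/
theorem inner_sq_lt_one {Z q : E} (hZ : ‖Z‖ = 1) (hq : ‖q‖ = 1) (h1 : q ≠ Z) (h2 : q ≠ -Z) :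
    ⟪Z, q⟫ ^ 2 < 1 := by
  have h : ‖q - ⟪Z, q⟫ • Z‖ ^ 2 = 1 - ⟪Z, q⟫ ^ 2 := by
    rw [norm_sub_sq_real, inner_smul_right, norm_smul, hq, hZ, real_inner_comm, Real.norm_eq_abs,
      mul_pow, sq_abs]
    ring
  rcases (sub_nonneg.1 (h ▸ sq_nonneg _) : ⟪Z, q⟫ ^ 2 ≤ 1).lt_or_eq with hlt | heq
  · exact hlt
  · exfalso
    rw [heq, sub_self, sq_eq_zero_iff, norm_eq_zero, sub_eq_zero] at h
    rcases sq_eq_one_iff.1 heq with h3 | h3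
    · exact h1 (by simpa [h3] using h)
    · exact h2 (by simpa [h3] using h)

theorem ne_of_inner_sq_lt_one {Z q : E} (hZ : ‖Z‖ = 1) (h : ⟪Z, q⟫ ^ 2 < 1) : q ≠ Z ∧ q ≠ -Z := by
  constructor
  · rintro rfl
    rw [real_inner_self_eq_norm_sq, hZ] at h
    norm_num at h
  · rintro rfl
    rw [inner_neg_right, real_inner_self_eq_norm_sq, hZ] at h
    norm_num at h

theorem keplerForce_inner_of_orthogonal (Z : E) (M : ℝ) {z : E × E} {u : E} (hu : ⟪z.1, u⟫ = 0) :
    ⟪keplerForce Z M z, u⟫ = keplerCoeff Z M z.1 * ⟪Z, u⟫ := by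
  simp [keplerForce, inner_add_left, inner_smul_left, hu]

/-- Newton's equation fixes the tangential part of the acceleration. Its normal part `-‖v‖²` follows
by differentiating `⟪q, v⟫ = 0`, so the orbit solves an ordinary differential equation in the
ambient space. -/
theorem IsKeplerOrbit.hasDerivAt_velocity {Z : E} (hZ : ‖Z‖ = 1) {M : ℝ} {γ : ℝ → E × E}
    (h : IsKeplerOrbit Z M γ) (t : ℝ) :
    HasDerivAt (fun s => (γ s).2) (keplerForce Z M (γ t)) t := by
  obtain ⟨acc, hacc, hN⟩ := h.newton t
  obtain ⟨hq, hqv⟩ := h.mem t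
  have hlt := inner_sq_lt_one hZ hq (h.ne_center t) (h.ne_antipode t)
  have hd := (hasFDerivAt_keplerPotential hZ M hq hlt).fderiv
  set q := (γ t).1
  set v := (γ t).2
  have hqq : ⟪q, q⟫ = 1 := by rw [real_inner_self_eq_norm_sq, hq]; norm_num
  have hn : ⟪acc, q⟫ = -‖v‖ ^ 2 := by
    have h1 : HasDerivAt (fun s => ⟪(γ s).1, (γ s).2⟫) (⟪q, acc⟫ + ⟪v, v⟫) t :=
      (h.velocity t).inner ℝ hacc
    have h2 : (fun s => ⟪(γ s).1, (γ s).2⟫) = fun _ => 0 := funext fun s => (h.mem s).2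
    rw [h2] at h1
    have := h1.unique (hasDerivAt_const t 0)
    rw [real_inner_self_eq_norm_sq, real_inner_comm] at this
    linarith
  have : acc = keplerForce Z M (γ t) := by
    refine ext_inner_right ℝ fun u => ?_
    have h1 := hN (u - ⟪q, u⟫ • q) (by rw [inner_sub_right, inner_smul_right, hqq]; ring)
    rw [hd] at h1
    have hqZ := real_inner_comm q Z
    simp only [inner_sub_right, inner_smul_right, hn, innerSL_apply_apply, inner_smul_left,
      inner_sub_left, hqq, RCLike.conj_to_real] at h1
    change ⟪acc, u⟫ = ⟪-(‖v‖ ^ 2 + ⟪Z, q⟫ * keplerCoeff Z M q) • q + keplerCoeff Z M q • Z, u⟫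
    simp only [inner_add_left, inner_smul_left, RCLike.conj_to_real]
    linear_combination h1
  rwa [← this]

theorem isKeplerOrbit_of_hasDerivAt {Z : E} (hZ : ‖Z‖ = 1) {M : ℝ} {γ : ℝ → E × E}
    (hmem : ∀ t, γ t ∈ tangentSphere E) (hlt : ∀ t, ⟪Z, (γ t).1⟫ ^ 2 < 1)
    (h1 : ∀ t, HasDerivAt (fun s => (γ s).1) (γ t).2 t)
    (h2 : ∀ t, HasDerivAt (fun s => (γ s).2) (keplerForce Z M (γ t)) t) :
    IsKeplerOrbit Z M γ where
  mem := hmem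
  ne_center t := (ne_of_inner_sq_lt_one hZ (hlt t)).1
  ne_antipode t := (ne_of_inner_sq_lt_one hZ (hlt t)).2
  velocity := h1
  newton t := by
    refine ⟨_, h2 t, fun u hu => ?_⟩
    rw [(hasFDerivAt_keplerPotential hZ M (hmem t).1 (hlt t)).fderiv,
      keplerForce_inner_of_orthogonal Z M hu]
    simp [hu]

theorem contDiffAt_keplerCoeff (Z : E) (M : ℝ) {q : E} (hlt : ⟪Z, q⟫ ^ 2 < 1) {n : WithTop ℕ∞} :
    ContDiffAt ℝ n (keplerCoeff Z M) q := by
  have h1 : ContDiffAt ℝ n (fun q : E => ⟪Z, q⟫) q := contDiffAt_const.inner ℝ contDiffAt_id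
  have hpos : 0 < 1 - ⟪Z, q⟫ ^ 2 := by linarith
  exact contDiffAt_const.div (((contDiffAt_const.sub (h1.pow 2)).sqrt hpos.ne').pow 3)
    (pow_pos (Real.sqrt_pos.2 hpos) 3).ne'

theorem contDiffAt_keplerForce (Z : E) (M : ℝ) {z : E × E} (hlt : ⟪Z, z.1⟫ ^ 2 < 1)
    {n : WithTop ℕ∞} : ContDiffAt ℝ n (keplerForce Z M) z := by
  have h1 : ContDiffAt ℝ n (fun z : E × E => ⟪Z, z.1⟫) z := contDiffAt_const.inner ℝ contDiffAt_fst
  have h2 : ContDiffAt ℝ n (fun z : E × E => ‖z.2‖ ^ 2) z := contDiffAt_snd.norm_sq ℝ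
  have h3 : ContDiffAt ℝ n (fun z : E × E => keplerCoeff Z M z.1) z :=
    (contDiffAt_keplerCoeff Z M hlt).comp z contDiffAt_fst
  exact ((h2.add (h1.mul h3)).neg.smul contDiffAt_fst).add (h3.smul contDiffAt_const)

/-- A Kepler orbit is determined by its initial state. -/
theorem IsKeplerOrbit.eq_of_eq {Z : E} (hZ : ‖Z‖ = 1) {M : ℝ} {γ δ : ℝ → E × E}
    (hγ : IsKeplerOrbit Z M γ) (hδ : IsKeplerOrbit Z M δ) (h0 : γ 0 = δ 0) : γ = δ := by
  have hder : ∀ {γ : ℝ → E × E}, IsKeplerOrbit Z M γ →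
      ∀ t, HasDerivAt γ ((γ t).2, keplerForce Z M (γ t)) t := fun h t =>
    (h.velocity t).prodMk (h.hasDerivAt_velocity hZ t)
  have hcont : ∀ {γ : ℝ → E × E}, IsKeplerOrbit Z M γ → Continuous γ := fun h =>
    continuous_iff_continuousAt.2 fun t => (hder h t).continuousAt
  have hclosed : IsClosed {t | γ t = δ t} := isClosed_eq (hcont hγ) (hcont hδ)
  -- The field is smooth near every point of the orbit, hence locally Lipschitz. Local uniqueness
  -- makes the coincidence set open, and connectedness of the line does the rest.
  have hopen : IsOpen {t | γ t = δ t} := by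
    rw [isOpen_iff_mem_nhds]
    intro t ht
    have hlt := inner_sq_lt_one hZ (hγ.mem t).1 (hγ.ne_center t) (hγ.ne_antipode t)
    have hX : ContDiffAt ℝ 1 (fun z : E × E => (z.2, keplerForce Z M z)) (γ t) :=
      contDiffAt_snd.prodMk (contDiffAt_keplerForce Z M hlt)
    obtain ⟨K, s, hs, hK⟩ := hX.exists_lipschitzOnWith
    have := ODE_solution_unique_of_eventually (v := fun _ z => (z.2, keplerForce Z M z))
      (s := fun _ => s) (t₀ := t) (f := γ) (g := δ) (K := K) (Eventually.of_forall fun _ => hK)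
      (by filter_upwards [(hcont hγ).continuousAt hs] with t' ht' using ⟨hder hγ t', ht'⟩)
      (by
        have : s ∈ 𝓝 (δ t) := by rw [← (show γ t = δ t from ht)]; exact hs
        filter_upwards [(hcont hδ).continuousAt this] with t' ht' using ⟨hder hδ t', ht'⟩)
      ht
    exact this
  have huniv := IsClopen.eq_univ ⟨hclosed, hopen⟩ ⟨0, h0⟩
  funext t
  exact (Set.eq_univ_iff_forall.1 huniv t : _)

/-! ### Angular momentum -/

/-- The part of `x` orthogonal to the unit vector `Z`. -/
def perp (Z x : E) : E := x - ⟪Z, x⟫ • Z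

/-- The square of the angular momentum with respect to the axis `Z`. -/
def momentumSq (Z : E) (z : E × E) : ℝ :=
  ‖perp Z z.1‖ ^ 2 * ‖perp Z z.2‖ ^ 2 - ⟪perp Z z.1, perp Z z.2⟫ ^ 2

theorem perp_add (Z x y : E) : perp Z (x + y) = perp Z x + perp Z y := by
  simp only [perp, inner_add_right, add_smul]; abel

theorem perp_smul (Z : E) (r : ℝ) (x : E) : perp Z (r • x) = r • perp Z x := by
  simp only [perp, inner_smul_right, smul_sub, smul_smul]

theorem perp_self {Z : E} (hZ : ‖Z‖ = 1) : perp Z Z = 0 := by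
  simp [perp, hZ]

theorem perp_of_orthogonal {Z x : E} (h : ⟪Z, x⟫ = 0) : perp Z x = x := by
  simp [perp, h]

theorem inner_perp_right {Z : E} (hZ : ‖Z‖ = 1) (x : E) : ⟪Z, perp Z x⟫ = 0 := by
  simp [perp, inner_sub_right, inner_smul_right, hZ]

theorem inner_perp_perp {Z : E} (hZ : ‖Z‖ = 1) (x y : E) :
    ⟪perp Z x, perp Z y⟫ = ⟪x, y⟫ - ⟪Z, x⟫ * ⟪Z, y⟫ := by
  have hZZ : ⟪Z, Z⟫ = 1 := by rw [real_inner_self_eq_norm_sq, hZ]; norm_num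
  simp only [perp, inner_sub_left, inner_sub_right, inner_smul_left, inner_smul_right, hZZ,
    RCLike.conj_to_real, real_inner_comm Z x]
  ring

theorem norm_perp_sq {Z : E} (hZ : ‖Z‖ = 1) (x : E) :
    ‖perp Z x‖ ^ 2 = ‖x‖ ^ 2 - ⟪Z, x⟫ ^ 2 := by
  rw [← real_inner_self_eq_norm_sq, inner_perp_perp hZ, real_inner_self_eq_norm_sq]; ring

theorem momentumSq_nonneg (Z : E) (z : E × E) : 0 ≤ momentumSq Z z := by
  have h := abs_real_inner_le_norm (perp Z z.1) (perp Z z.2)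
  have := sq_le_sq' ((neg_le_of_abs_le h)) (le_of_abs_le h)
  rw [mul_pow] at this
  exact sub_nonneg.2 this

theorem momentumSq_eq {Z : E} (hZ : ‖Z‖ = 1) {z : E × E} (hz : z ∈ tangentSphere E) :
    momentumSq Z z = (1 - ⟪Z, z.1⟫ ^ 2) * ‖z.2‖ ^ 2 - ⟪Z, z.2⟫ ^ 2 := by
  rw [momentumSq, norm_perp_sq hZ, norm_perp_sq hZ, inner_perp_perp hZ, hz.1, hz.2]
  ring

theorem hasDerivAt_perp {Z : E} {q : ℝ → E} {q' : E} {t : ℝ} (hq : HasDerivAt q q' t) :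
    HasDerivAt (fun s => perp Z (q s)) (perp Z q') t := by
  have h : HasDerivAt (fun s => ⟪Z, q s⟫) ⟪Z, q'⟫ t := by
    simpa using (hasDerivAt_const t Z).inner ℝ hq
  exact hq.sub (h.smul_const Z)

/-- The projected motion is central: the projection of the force is a multiple of the projected
position. Functions of the bivector of projected position and velocity are therefore conserved. -/
theorem perp_keplerForce {Z : E} (hZ : ‖Z‖ = 1) (M : ℝ) (z : E × E) :
    perp Z (keplerForce Z M z) =
      -(‖z.2‖ ^ 2 + ⟪Z, z.1⟫ * keplerCoeff Z M z.1) • perp Z z.1 := by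
  rw [keplerForce, perp_add, perp_smul, perp_smul, perp_self hZ, smul_zero, add_zero]

/-- The angular momentum is conserved, in any parametrization of the orbit. -/
theorem hasDerivAt_momentumSq {Z : E} (hZ : ‖Z‖ = 1) {M ρ t : ℝ} {q v : ℝ → E}
    (hq : HasDerivAt q (ρ • v t) t) (hv : HasDerivAt v (ρ • keplerForce Z M (q t, v t)) t) :
    HasDerivAt (fun s => momentumSq Z (q s, v s)) 0 t := by
  have hQ := hasDerivAt_perp (Z := Z) hq
  have hU := hasDerivAt_perp (Z := Z) hv
  rw [perp_smul] at hQ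
  rw [perp_smul, perp_keplerForce hZ, smul_smul] at hU
  refine (((hQ.norm_sq).mul (hU.norm_sq)).sub ((hQ.inner ℝ hU).pow 2)).congr_deriv ?_
  simp only [inner_smul_left, inner_smul_right, RCLike.conj_to_real, real_inner_self_eq_norm_sq,
    real_inner_comm (perp Z (q t)) (perp Z (v t))]
  push_cast
  ring

/-- An orbit of the attracting or repelling Kepler problem that exists for all times has nonzero
angular momentum. -/
theorem IsKeplerOrbit.momentumSq_pos {Z : E} (hZ : ‖Z‖ = 1) {M : ℝ} (hM : M ≠ 0)
    {γ : ℝ → E × E} (h : IsKeplerOrbit Z M γ) : 0 < momentumSq Z (γ 0) := by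
  refine (momentumSq_nonneg Z _).lt_of_ne' fun h0 => ?_
  have hder : ∀ t, HasDerivAt (fun s => momentumSq Z (γ s)) 0 t := fun t =>
    hasDerivAt_momentumSq (q := fun s => (γ s).1) (v := fun s => (γ s).2) (ρ := 1) (M := M) hZ
      (by simpa using h.velocity t) (by simpa using h.hasDerivAt_velocity hZ t)
  have hC : ∀ t, momentumSq Z (γ t) = 0 := fun t => by
    rw [is_const_of_deriv_eq_zero (fun t => (hder t).differentiableAt) (fun t => (hder t).deriv)
      t 0, h0]
  have hlt : ∀ t, ⟪Z, (γ t).1⟫ ^ 2 < 1 := fun t =>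
    inner_sq_lt_one hZ (h.mem t).1 (h.ne_center t) (h.ne_antipode t)
  set w : ℝ → ℝ := fun t => ⟪Z, (γ t).1⟫ with hw
  set p : ℝ → ℝ := fun t => ⟪Z, (γ t).2⟫ with hp
  have hwd : ∀ t, HasDerivAt w (p t) t := fun t => by
    simpa using (hasDerivAt_const t Z).inner ℝ (h.velocity t)
  have hpd : ∀ t, HasDerivAt p ⟪Z, keplerForce Z M (γ t)⟫ t := fun t => by
    simpa using (hasDerivAt_const t Z).inner ℝ (h.hasDerivAt_velocity hZ t)
  -- With zero angular momentum the central angle satisfies `θ'' = -M / sin² θ`. So `-M θ` has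
  -- second derivative at least `M² > 0`, although it is bounded by `|M| π`.
  have hd1 : ∀ t, HasDerivAt (fun s => -M * Real.arccos (w s)) (M * (p t / √(1 - w t ^ 2))) t := by
    intro t
    have hl := abs_lt.1 ((sq_lt_one_iff_abs_lt_one _).1 (hlt t))
    refine (((Real.hasDerivAt_arccos hl.1.ne' hl.2.ne).comp t (hwd t)).const_mul
      (-M)).congr_deriv ?_
    ring
  have hd2 : ∀ t, HasDerivAt (fun s => M * (p s / √(1 - w s ^ 2))) (M ^ 2 / (1 - w t ^ 2)) t := by
    intro t
    have hpos : 0 < 1 - w t ^ 2 := by have := hlt t; simp only [hw]; linarith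
    have hr := Real.sqrt_pos.2 hpos
    have hs : √(1 - w t ^ 2) ^ 2 = 1 - w t ^ 2 := Real.sq_sqrt hpos.le
    have h1 := ((((hwd t).pow 2).const_sub 1).sqrt hpos.ne')
    refine (((hpd t).div h1 hr.ne').const_mul M).congr_deriv ?_
    have hZZ : ⟪Z, Z⟫ = 1 := by rw [real_inner_self_eq_norm_sq, hZ]; norm_num
    have hF : ⟪Z, keplerForce Z M (γ t)⟫ =
        -(‖(γ t).2‖ ^ 2 + w t * (M / √(1 - w t ^ 2) ^ 3)) * w t + M / √(1 - w t ^ 2) ^ 3 := by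
      simp only [keplerForce, inner_add_right, inner_smul_right, hZZ, keplerCoeff, hw]
      ring
    have hmom : √(1 - w t ^ 2) ^ 2 * ‖(γ t).2‖ ^ 2 = p t ^ 2 := by
      have := hC t
      rw [momentumSq_eq hZ (h.mem t)] at this
      rw [hs]
      linear_combination this
    have hR : M ^ 2 / (1 - w t ^ 2) = M ^ 2 / √(1 - w t ^ 2) ^ 2 := by rw [hs]
    rw [hF, hR]
    simp only [Pi.pow_apply, Nat.cast_ofNat, Nat.add_one_sub_one, pow_one]
    set r := √(1 - w t ^ 2) with hr_def
    have hr' := hr.ne'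
    field_simp
    linear_combination (-r * w t) * hmom - M * hs
  have hge : ∀ t, M ^ 2 ≤ M ^ 2 / (1 - w t ^ 2) := fun t => by
    have hpos : 0 < 1 - w t ^ 2 := by have := hlt t; simp only [hw]; linarith
    rw [le_div_iff₀ hpos]
    nlinarith [sq_nonneg (M * w t)]
  obtain ⟨t, ht⟩ := exists_gt_of_second_deriv_ge hd1 hd2 (by positivity) hge (|M| * Real.pi)
  have h1 : -M * Real.arccos (w t) ≤ |M| * Real.pi :=
    mul_le_mul (neg_le_abs M) (Real.arccos_le_pi _) (Real.arccos_nonneg _) (abs_nonneg M)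
  linarith

/-! ### The conics on the sphere -/

/-- The data of an orbit with center `Z`: an orthonormal frame of the orbital plane in the
orthogonal complement of `Z`, the angular momentum and the coefficients of the conic
`cot θ = M / C² + α cos ψ + β sin ψ`. -/
@[ext]
structure Conic (E : Type*) where
  /-- The direction of the angle `0`. -/
  e : E
  /-- The direction of the angle `π / 2`. -/
  f : E
  /-- The angular momentum. -/
  C : ℝ
  /-- The coefficient of `cos ψ`. -/
  α : ℝ
  /-- The coefficient of `sin ψ`. -/
  β : ℝ

namespace Conic

/-- The cotangent of the central angle. -/
def cot (k : Conic E) (M ψ : ℝ) : ℝ := M / k.C ^ 2 + k.α * Real.cos ψ + k.β * Real.sin ψ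

/-- The derivative of `Conic.cot`. -/
def cot' (k : Conic E) (ψ : ℝ) : ℝ := -k.α * Real.sin ψ + k.β * Real.cos ψ

/-- The sine of the central angle. -/
def sine (k : Conic E) (M ψ : ℝ) : ℝ := (√(1 + k.cot M ψ ^ 2))⁻¹

/-- The direction with angle `ψ`. -/
def dir (k : Conic E) (ψ : ℝ) : E := Real.cos ψ • k.e + Real.sin ψ • k.f

/-- The derivative of `Conic.dir`. -/
def dir' (k : Conic E) (ψ : ℝ) : E := -Real.sin ψ • k.e + Real.cos ψ • k.f

/-- The position with angle `ψ`. -/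
def pos (k : Conic E) (Z : E) (M ψ : ℝ) : E := k.sine M ψ • (k.dir ψ + k.cot M ψ • Z)

/-- The velocity with angle `ψ`. -/
def vel (k : Conic E) (Z : E) (M ψ : ℝ) : E :=
  (k.C * k.sine M ψ) • (-(k.cot M ψ * k.cot' ψ) • k.dir ψ + (1 + k.cot M ψ ^ 2) • k.dir' ψ +
    k.cot' ψ • Z)

/-- The derivative of time with respect to the angle. -/
def density (k : Conic E) (M ψ : ℝ) : ℝ := (k.C * (1 + k.cot M ψ ^ 2))⁻¹

/-- The state with angle `ψ`. -/
def state (k : Conic E) (Z : E) (M ψ : ℝ) : E × E := (k.pos Z M ψ, k.vel Z M ψ)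

/-- The frame is orthonormal and orthogonal to `Z`, and the angular momentum is positive. -/
structure IsFrame (k : Conic E) (Z : E) : Prop where
  inner_e : ⟪Z, k.e⟫ = 0
  inner_f : ⟪Z, k.f⟫ = 0
  inner_ef : ⟪k.e, k.f⟫ = 0
  norm_e : ‖k.e‖ = 1
  norm_f : ‖k.f‖ = 1
  pos_C : 0 < k.C

theorem sine_pos {E : Type*} (k : Conic E) (M ψ : ℝ) : 0 < k.sine M ψ :=
  inv_pos.2 (Real.sqrt_pos.2 (by positivity))

theorem sine_sq {E : Type*} (k : Conic E) (M ψ : ℝ) : k.sine M ψ ^ 2 * (1 + k.cot M ψ ^ 2) = 1 := by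
  have h : (0 : ℝ) < 1 + k.cot M ψ ^ 2 := by positivity
  rw [sine, inv_pow, Real.sq_sqrt h.le, inv_mul_cancel₀ h.ne']

theorem density_eq {E : Type*} (k : Conic E) (M ψ : ℝ) : k.density M ψ = k.C⁻¹ * k.sine M ψ ^ 2 := by
  have h : (0 : ℝ) < 1 + k.cot M ψ ^ 2 := by positivity
  rw [density, mul_inv, sine, inv_pow, Real.sq_sqrt h.le]

theorem hasDerivAt_cot {E : Type*} (k : Conic E) (M ψ : ℝ) :
    HasDerivAt (fun t => k.cot M t) (k.cot' ψ) ψ := by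
  refine ((((Real.hasDerivAt_cos ψ).const_mul k.α).const_add (M / k.C ^ 2)).add
    ((Real.hasDerivAt_sin ψ).const_mul k.β)).congr_deriv ?_
  simp [cot']

/-- The analogue of Binet's equation: as a function of the angle, `cot θ` is a harmonic oscillator
about `M / C²`. -/
theorem hasDerivAt_cot' {E : Type*} (k : Conic E) (M ψ : ℝ) :
    HasDerivAt (fun t => k.cot' t) (M / k.C ^ 2 - k.cot M ψ) ψ := by
  refine (((Real.hasDerivAt_sin ψ).const_mul (-k.α)).add
    ((Real.hasDerivAt_cos ψ).const_mul k.β)).congr_deriv ?_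
  simp only [cot]; ring

theorem hasDerivAt_sine {E : Type*} (k : Conic E) (M ψ : ℝ) :
    HasDerivAt (fun t => k.sine M t) (-(k.cot M ψ * k.cot' ψ * k.sine M ψ ^ 3)) ψ := by
  have h : (0 : ℝ) < 1 + k.cot M ψ ^ 2 := by positivity
  have hr := Real.sqrt_pos.2 h
  refine (((((k.hasDerivAt_cot M ψ).pow 2).const_add 1).sqrt h.ne').inv hr.ne').congr_deriv ?_
  simp only [sine, Pi.pow_apply, Nat.cast_ofNat, Nat.add_one_sub_one, pow_one]
  have := hr.ne'
  field_simp

variable {k : Conic E} {Z : E} {M : ℝ}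

theorem hasDerivAt_dir (k : Conic E) (ψ : ℝ) : HasDerivAt (fun t => k.dir t) (k.dir' ψ) ψ :=
  ((Real.hasDerivAt_cos ψ).smul_const k.e).add ((Real.hasDerivAt_sin ψ).smul_const k.f)

theorem hasDerivAt_dir' (k : Conic E) (ψ : ℝ) : HasDerivAt (fun t => k.dir' t) (-k.dir ψ) ψ := by
  refine (((Real.hasDerivAt_sin ψ).neg.smul_const k.e).add
    ((Real.hasDerivAt_cos ψ).smul_const k.f)).congr_deriv ?_
  simp only [dir]; module

theorem IsFrame.inner_dir (hk : k.IsFrame Z) (ψ : ℝ) : ⟪Z, k.dir ψ⟫ = 0 := by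
  simp [dir, inner_add_right, inner_smul_right, hk.inner_e, hk.inner_f]

theorem IsFrame.inner_dir' (hk : k.IsFrame Z) (ψ : ℝ) : ⟪Z, k.dir' ψ⟫ = 0 := by
  simp [dir', inner_add_right, inner_smul_right, hk.inner_e, hk.inner_f]

theorem IsFrame.inner_dir_dir (hk : k.IsFrame Z) (ψ : ℝ) : ⟪k.dir ψ, k.dir ψ⟫ = 1 := by
  have h := Real.sin_sq_add_cos_sq ψ
  simp only [dir, inner_add_right, inner_add_left, inner_smul_left, inner_smul_right,
    RCLike.conj_to_real, real_inner_self_eq_norm_sq, hk.norm_e, hk.norm_f,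
    real_inner_comm k.e k.f, hk.inner_ef]
  linear_combination h

theorem IsFrame.inner_dir'_dir' (hk : k.IsFrame Z) (ψ : ℝ) : ⟪k.dir' ψ, k.dir' ψ⟫ = 1 := by
  have h := Real.sin_sq_add_cos_sq ψ
  simp only [dir', inner_add_right, inner_add_left, inner_smul_left, inner_smul_right,
    RCLike.conj_to_real, real_inner_self_eq_norm_sq, hk.norm_e, hk.norm_f,
    real_inner_comm k.e k.f, hk.inner_ef]
  linear_combination h

theorem IsFrame.inner_dir_dir' (hk : k.IsFrame Z) (ψ : ℝ) : ⟪k.dir ψ, k.dir' ψ⟫ = 0 := by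
  simp only [dir, dir', inner_add_right, inner_add_left, inner_smul_left, inner_smul_right,
    RCLike.conj_to_real, real_inner_self_eq_norm_sq, hk.norm_e, hk.norm_f,
    real_inner_comm k.e k.f, hk.inner_ef]
  ring

theorem IsFrame.inner_pos (hk : k.IsFrame Z) (hZ : ‖Z‖ = 1) (ψ : ℝ) : ⟪Z, k.pos Z M ψ⟫ = k.sine M ψ * k.cot M ψ := by
  simp [pos, inner_smul_right, inner_add_right, hk.inner_dir, hZ]

theorem IsFrame.one_sub_inner_pos_sq (hk : k.IsFrame Z) (hZ : ‖Z‖ = 1) (ψ : ℝ) : 1 - ⟪Z, k.pos Z M ψ⟫ ^ 2 = k.sine M ψ ^ 2 := by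
  rw [hk.inner_pos hZ]
  linear_combination -k.sine_sq M ψ

theorem IsFrame.inner_pos_sq_lt_one (hk : k.IsFrame Z) (hZ : ‖Z‖ = 1) (ψ : ℝ) : ⟪Z, k.pos Z M ψ⟫ ^ 2 < 1 := by
  have := hk.one_sub_inner_pos_sq hZ (M := M) ψ
  have := pow_pos (k.sine_pos M ψ) 2
  linarith

theorem IsFrame.norm_vel_sq (hk : k.IsFrame Z) (hZ : ‖Z‖ = 1) (ψ : ℝ) :
    ‖k.vel Z M ψ‖ ^ 2 = k.C ^ 2 * (1 + k.cot M ψ ^ 2 + k.cot' ψ ^ 2) := by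
  have hZZ : ⟪Z, Z⟫ = 1 := by rw [real_inner_self_eq_norm_sq, hZ]; norm_num
  rw [← real_inner_self_eq_norm_sq]
  simp only [vel, inner_add_right, inner_add_left, inner_smul_left, inner_smul_right,
    RCLike.conj_to_real, hk.inner_dir, hk.inner_dir', hk.inner_dir_dir, hk.inner_dir'_dir',
    hk.inner_dir_dir', real_inner_comm (k.dir ψ) (k.dir' ψ), real_inner_comm Z, hZZ]
  linear_combination (k.C ^ 2 * (1 + k.cot M ψ ^ 2 + k.cot' ψ ^ 2)) * k.sine_sq M ψ

theorem IsFrame.state_mem (hk : k.IsFrame Z) (hZ : ‖Z‖ = 1) (ψ : ℝ) : k.state Z M ψ ∈ tangentSphere E := by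
  have hZZ : ⟪Z, Z⟫ = 1 := by rw [real_inner_self_eq_norm_sq, hZ]; norm_num
  constructor
  · change ‖k.pos Z M ψ‖ = 1
    rw [← sq_eq_sq₀ (norm_nonneg _) zero_le_one, ← real_inner_self_eq_norm_sq]
    simp only [pos, inner_add_right, inner_add_left, inner_smul_left, inner_smul_right,
      RCLike.conj_to_real, hk.inner_dir, hk.inner_dir_dir, real_inner_comm Z, hZZ]
    linear_combination k.sine_sq M ψ
  · change ⟪k.pos Z M ψ, k.vel Z M ψ⟫ = 0
    simp only [pos, vel, inner_add_right, inner_add_left, inner_smul_left, inner_smul_right,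
      RCLike.conj_to_real, hk.inner_dir, hk.inner_dir', hk.inner_dir_dir, hk.inner_dir_dir',
      real_inner_comm Z, hZZ]
    ring

theorem IsFrame.keplerCoeff_pos (hk : k.IsFrame Z) (hZ : ‖Z‖ = 1) (ψ : ℝ) :
    keplerCoeff Z M (k.pos Z M ψ) = M * (1 + k.cot M ψ ^ 2) ^ 2 * k.sine M ψ := by
  have hs := k.sine_pos M ψ
  rw [keplerCoeff, hk.one_sub_inner_pos_sq hZ, Real.sqrt_sq hs.le, div_eq_iff (by positivity)]
  have := k.sine_sq M ψ
  linear_combination (-M * (1 + k.sine M ψ ^ 2 * (1 + k.cot M ψ ^ 2))) * this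

/-- The area law `dψ/dt = C / sin² θ = C (1 + cot² θ)`: the density is `dt/dψ`, and angular
derivatives are the density times time derivatives. -/
theorem IsFrame.hasDerivAt_pos (hk : k.IsFrame Z) (M ψ : ℝ) :
    HasDerivAt (fun t => k.pos Z M t) (k.density M ψ • k.vel Z M ψ) ψ := by
  refine ((k.hasDerivAt_sine M ψ).smul ((k.hasDerivAt_dir ψ).add
    ((k.hasDerivAt_cot M ψ).smul_const Z))).congr_deriv ?_
  have hC := hk.pos_C.ne'
  have hs := k.sine_sq M ψ
  rw [density_eq, vel]
  simp only [Pi.add_apply]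
  set i := k.sine M ψ
  set x := k.cot M ψ
  set y := k.cot' ψ
  have h1 : i = i ^ 3 * (1 + x ^ 2) := by linear_combination -i * hs
  have h2 : k.C⁻¹ * i ^ 2 * (k.C * i) = i ^ 3 := by field_simp
  rw [smul_smul, h2]
  linear_combination (norm := module) h1 • (k.dir' ψ + y • Z)

theorem IsFrame.hasDerivAt_vel (hk : k.IsFrame Z) (hZ : ‖Z‖ = 1) (M ψ : ℝ) :
    HasDerivAt (fun t => k.vel Z M t) (k.density M ψ • keplerForce Z M (k.state Z M ψ)) ψ := by
  have hsum := ((((k.hasDerivAt_cot M ψ).mul (k.hasDerivAt_cot' M ψ)).neg.smul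
    (k.hasDerivAt_dir ψ)).add ((((k.hasDerivAt_cot M ψ).pow 2).const_add 1).smul
      (k.hasDerivAt_dir' ψ))).add ((k.hasDerivAt_cot' M ψ).smul_const Z)
  refine (((k.hasDerivAt_sine M ψ).const_mul k.C).smul hsum).congr_deriv ?_
  have hC := hk.pos_C.ne'
  have hs := k.sine_sq M ψ
  have hw := hk.inner_pos hZ (M := M) ψ
  have hv := hk.norm_vel_sq hZ (M := M) ψ
  have hf := hk.keplerCoeff_pos hZ (M := M) ψ
  have hforce : k.density M ψ • keplerForce Z M (k.state Z M ψ) =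
      (k.C * k.sine M ψ ^ 2) • (-(1 + k.cot M ψ ^ 2 + k.cot' ψ ^ 2 + k.sine M ψ * k.cot M ψ *
        (M / k.C ^ 2 * (1 + k.cot M ψ ^ 2) ^ 2 * k.sine M ψ)) • k.pos Z M ψ +
        (M / k.C ^ 2 * (1 + k.cot M ψ ^ 2) ^ 2 * k.sine M ψ) • Z) := by
    rw [keplerForce]
    simp only [state]
    rw [hw, hv, hf, density_eq, smul_add, smul_add, smul_smul, smul_smul, smul_smul, smul_smul]
    congr 2 <;> field_simp
  rw [hforce, pos]
  set i := k.sine M ψ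
  set x := k.cot M ψ
  set y := k.cot' ψ
  set μ := M / k.C ^ 2
  simp only [Pi.mul_apply, Pi.neg_apply, Pi.add_apply, Pi.smul_apply', Pi.pow_apply]
  push_cast
  -- The components along `dir`, `dir'` and `Z` are compared separately; each agrees modulo the
  -- relation `sin² θ (1 + cot² θ) = 1`.
  linear_combination (norm := module)
    ((k.C * (i * y ^ 2 + i * μ * x * (i ^ 2 * (1 + x ^ 2) + 1) + i)) * hs) • k.dir ψ
    - (k.C * x * y * i * hs) • k.dir' ψ
    + (k.C * (i * x + i * μ * (i ^ 2 * (1 + x ^ 2) * (1 + x ^ 2) - i ^ 2 * (1 + x ^ 2) - 1))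
      * hs) • Z

end Conic

/-! ### Smooth dependence of the conics on parameters -/

namespace Conic

section Smooth

variable {H : Type*} [NormedAddCommGroup H] [NormedSpace ℝ H]

/-- A family of conics depends smoothly on parameters near `h`. -/
structure SmoothAt (n : WithTop ℕ∞) (k : H → Conic E) (h : H) : Prop where
  e : ContDiffAt ℝ n (fun x => (k x).e) h
  f : ContDiffAt ℝ n (fun x => (k x).f) h
  C : ContDiffAt ℝ n (fun x => (k x).C) h
  α : ContDiffAt ℝ n (fun x => (k x).α) h
  β : ContDiffAt ℝ n (fun x => (k x).β) h
  ne : (k h).C ≠ 0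

variable {n : WithTop ℕ∞} {k : H → Conic E} {h : H}

theorem SmoothAt.cot (hk : SmoothAt n k h) (M ψ : ℝ) :
    ContDiffAt ℝ n (fun p : H × ℝ => (k p.1).cot M p.2) (h, ψ) := by
  have hC : ContDiffAt ℝ n (fun p : H × ℝ => (k p.1).C) (h, ψ) := hk.C.fst'
  have hα : ContDiffAt ℝ n (fun p : H × ℝ => (k p.1).α) (h, ψ) := hk.α.fst'
  have hβ : ContDiffAt ℝ n (fun p : H × ℝ => (k p.1).β) (h, ψ) := hk.β.fst'
  exact ((contDiffAt_const.div (hC.pow 2) (pow_ne_zero 2 hk.ne)).add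
    (hα.mul contDiffAt_snd.cos)).add (hβ.mul contDiffAt_snd.sin)

theorem SmoothAt.cot' (hk : SmoothAt n k h) (ψ : ℝ) :
    ContDiffAt ℝ n (fun p : H × ℝ => (k p.1).cot' p.2) (h, ψ) := by
  have hα : ContDiffAt ℝ n (fun p : H × ℝ => (k p.1).α) (h, ψ) := hk.α.fst'
  have hβ : ContDiffAt ℝ n (fun p : H × ℝ => (k p.1).β) (h, ψ) := hk.β.fst'
  exact (hα.neg.mul contDiffAt_snd.sin).add (hβ.mul contDiffAt_snd.cos)

theorem SmoothAt.sine (hk : SmoothAt n k h) (M ψ : ℝ) :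
    ContDiffAt ℝ n (fun p : H × ℝ => (k p.1).sine M p.2) (h, ψ) := by
  have hpos : 0 < 1 + (k h).cot M ψ ^ 2 := by positivity
  exact ((contDiffAt_const.add ((hk.cot M ψ).pow 2)).sqrt hpos.ne').inv
    (Real.sqrt_pos.2 hpos).ne'

theorem SmoothAt.dir (hk : SmoothAt n k h) (ψ : ℝ) :
    ContDiffAt ℝ n (fun p : H × ℝ => (k p.1).dir p.2) (h, ψ) := by
  have he : ContDiffAt ℝ n (fun p : H × ℝ => (k p.1).e) (h, ψ) := hk.e.fst'
  have hf : ContDiffAt ℝ n (fun p : H × ℝ => (k p.1).f) (h, ψ) := hk.f.fst'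
  exact (contDiffAt_snd.cos.smul he).add (contDiffAt_snd.sin.smul hf)

theorem SmoothAt.dir' (hk : SmoothAt n k h) (ψ : ℝ) :
    ContDiffAt ℝ n (fun p : H × ℝ => (k p.1).dir' p.2) (h, ψ) := by
  have he : ContDiffAt ℝ n (fun p : H × ℝ => (k p.1).e) (h, ψ) := hk.e.fst'
  have hf : ContDiffAt ℝ n (fun p : H × ℝ => (k p.1).f) (h, ψ) := hk.f.fst'
  exact (contDiffAt_snd.sin.neg.smul he).add (contDiffAt_snd.cos.smul hf)

theorem SmoothAt.pos (hk : SmoothAt n k h) (Z : E) (M ψ : ℝ) :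
    ContDiffAt ℝ n (fun p : H × ℝ => (k p.1).pos Z M p.2) (h, ψ) :=
  (hk.sine M ψ).smul ((hk.dir ψ).add ((hk.cot M ψ).smul contDiffAt_const))

theorem SmoothAt.vel (hk : SmoothAt n k h) (Z : E) (M ψ : ℝ) :
    ContDiffAt ℝ n (fun p : H × ℝ => (k p.1).vel Z M p.2) (h, ψ) := by
  have hC : ContDiffAt ℝ n (fun p : H × ℝ => (k p.1).C) (h, ψ) := hk.C.fst'
  exact (hC.mul (hk.sine M ψ)).smul (((((hk.cot M ψ).mul (hk.cot' ψ)).neg.smul (hk.dir ψ)).add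
    ((contDiffAt_const.add ((hk.cot M ψ).pow 2)).smul (hk.dir' ψ))).add
      ((hk.cot' ψ).smul contDiffAt_const))

theorem SmoothAt.density (hk : SmoothAt n k h) (M ψ : ℝ) :
    ContDiffAt ℝ n (fun p : H × ℝ => (k p.1).density M p.2) (h, ψ) := by
  have hpos : 0 < 1 + (k h).cot M ψ ^ 2 := by positivity
  have hC : ContDiffAt ℝ n (fun p : H × ℝ => (k p.1).C) (h, ψ) := hk.C.fst'
  exact (hC.mul (contDiffAt_const.add ((hk.cot M ψ).pow 2))).inv (mul_ne_zero hk.ne hpos.ne')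

theorem SmoothAt.comp (hk : SmoothAt n k h) {H' : Type*} [NormedAddCommGroup H'] [NormedSpace ℝ H']
    {g : H' → H} {h' : H'} (hg : ContDiffAt ℝ n g h') (hh : g h' = h) :
    SmoothAt n (fun x => k (g x)) h' := by
  subst hh
  exact ⟨hk.e.comp h' hg, hk.f.comp h' hg, hk.C.comp h' hg, hk.α.comp h' hg, hk.β.comp h' hg,
    hk.ne⟩

end Smooth

/-! ### Periodicity and rotation of the angle -/

theorem state_periodic (k : Conic E) (Z : E) (M : ℝ) :
    Function.Periodic (k.state Z M) (2 * Real.pi) := fun ψ => by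
  simp [state, pos, vel, sine, cot, cot', dir, dir']

theorem density_periodic {E : Type*} (k : Conic E) (M : ℝ) :
    Function.Periodic (k.density M) (2 * Real.pi) := fun ψ => by
  simp [density, cot]

theorem density_pos {Z : E} {k : Conic E} (hk : k.IsFrame Z) (M ψ : ℝ) : 0 < k.density M ψ :=
  inv_pos.2 (mul_pos hk.pos_C (by positivity))

theorem continuous_density {Z : E} {k : Conic E} (hk : k.IsFrame Z) (M : ℝ) :
    Continuous (k.density M) := by
  have h1 : Continuous (k.cot M) :=
    continuous_iff_continuousAt.2 fun ψ => (k.hasDerivAt_cot M ψ).continuousAt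
  exact (continuous_const.mul (continuous_const.add (h1.pow 2))).inv₀ fun ψ =>
    (mul_pos hk.pos_C (add_pos_of_pos_of_nonneg one_pos (sq_nonneg _))).ne'

/-- The same conic with the angle counted from the direction with angle `φ`. -/
def rotate (k : Conic E) (φ : ℝ) : Conic E where
  e := k.dir φ
  f := k.dir' φ
  C := k.C
  α := k.α * Real.cos φ + k.β * Real.sin φ
  β := k.cot' φ

theorem rotate_cot (k : Conic E) (M φ ψ : ℝ) : (k.rotate φ).cot M ψ = k.cot M (φ + ψ) := by
  simp only [rotate, cot, cot', Real.cos_add, Real.sin_add]; ring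

theorem rotate_cot' (k : Conic E) (φ ψ : ℝ) : (k.rotate φ).cot' ψ = k.cot' (φ + ψ) := by
  simp only [rotate, cot', Real.cos_add, Real.sin_add]; ring

theorem rotate_dir (k : Conic E) (φ ψ : ℝ) : (k.rotate φ).dir ψ = k.dir (φ + ψ) := by
  simp only [rotate, dir, dir', Real.cos_add, Real.sin_add]; module

theorem rotate_dir' (k : Conic E) (φ ψ : ℝ) : (k.rotate φ).dir' ψ = k.dir' (φ + ψ) := by
  simp only [rotate, dir, dir', Real.cos_add, Real.sin_add]; module

theorem rotate_state (k : Conic E) (Z : E) (M φ ψ : ℝ) :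
    (k.rotate φ).state Z M ψ = k.state Z M (φ + ψ) := by
  simp only [state, pos, vel, sine, rotate_cot, rotate_cot', rotate_dir, rotate_dir']
  rfl

theorem rotate_density (k : Conic E) (M φ ψ : ℝ) :
    (k.rotate φ).density M ψ = k.density M (φ + ψ) := by
  simp only [density, rotate_cot]
  rfl

theorem IsFrame.rotate {Z : E} {k : Conic E} (hk : k.IsFrame Z) (φ : ℝ) :
    (k.rotate φ).IsFrame Z where
  inner_e := hk.inner_dir φ
  inner_f := hk.inner_dir' φ
  inner_ef := hk.inner_dir_dir' φ
  norm_e := by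
    rw [← sq_eq_sq₀ (norm_nonneg _) zero_le_one, ← real_inner_self_eq_norm_sq, one_pow]
    exact hk.inner_dir_dir φ
  norm_f := by
    rw [← sq_eq_sq₀ (norm_nonneg _) zero_le_one, ← real_inner_self_eq_norm_sq, one_pow]
    exact hk.inner_dir'_dir' φ
  pos_C := hk.pos_C

end Conic

/-! ### The conic through a state -/

/-- The conic on which the Kepler orbit through `z` runs, with the angle counted from `z`. -/
def keplerConic (Z : E) (M : ℝ) (z : E × E) : Conic E where
  e := ‖perp Z z.1‖⁻¹ • perp Z z.1
  f := (‖perp Z z.1‖ / √(momentumSq Z z)) •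
    (perp Z z.2 - (⟪perp Z z.1, perp Z z.2⟫ / ‖perp Z z.1‖ ^ 2) • perp Z z.1)
  C := √(momentumSq Z z)
  α := ⟪Z, z.1⟫ / ‖perp Z z.1‖ - M / √(momentumSq Z z) ^ 2
  β := ⟪Z, z.2⟫ / (‖perp Z z.1‖ * √(momentumSq Z z))

theorem norm_perp_pos_of_momentumSq_pos {Z : E} {z : E × E} (h : 0 < momentumSq Z z) :
    0 < ‖perp Z z.1‖ := by
  refine norm_pos_iff.2 fun h0 => ?_
  simp [momentumSq, h0] at h

theorem contDiff_perp (Z : E) {n : WithTop ℕ∞} : ContDiff ℝ n (perp Z) :=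
  contDiff_id.sub ((contDiff_const.inner ℝ contDiff_id).smul contDiff_const)

theorem contDiff_momentumSq (Z : E) {n : WithTop ℕ∞} : ContDiff ℝ n (momentumSq Z) := by
  have h1 : ContDiff ℝ n (fun z : E × E => perp Z z.1) := (contDiff_perp Z).comp contDiff_fst
  have h2 : ContDiff ℝ n (fun z : E × E => perp Z z.2) := (contDiff_perp Z).comp contDiff_snd
  exact ((h1.norm_sq ℝ).mul (h2.norm_sq ℝ)).sub ((h1.inner ℝ h2).pow 2)

theorem smoothAt_keplerConic (Z : E) (M : ℝ) {z : E × E} (h : 0 < momentumSq Z z)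
    {n : WithTop ℕ∞} : Conic.SmoothAt n (keplerConic Z M) z := by
  have hn := norm_perp_pos_of_momentumSq_pos h
  have hC := Real.sqrt_pos.2 h
  have h1 : ContDiffAt ℝ n (fun z : E × E => perp Z z.1) z :=
    ((contDiff_perp Z).comp contDiff_fst).contDiffAt
  have h2 : ContDiffAt ℝ n (fun z : E × E => perp Z z.2) z :=
    ((contDiff_perp Z).comp contDiff_snd).contDiffAt
  have h3 : ContDiffAt ℝ n (fun z : E × E => ‖perp Z z.1‖) z := h1.norm ℝ (norm_pos_iff.1 hn)
  have h4 : ContDiffAt ℝ n (fun z : E × E => √(momentumSq Z z)) z :=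
    (contDiff_momentumSq Z).contDiffAt.sqrt h.ne'
  have h5 : ContDiffAt ℝ n (fun z : E × E => ⟪Z, z.1⟫) z := contDiffAt_const.inner ℝ contDiffAt_fst
  have h6 : ContDiffAt ℝ n (fun z : E × E => ⟪Z, z.2⟫) z := contDiffAt_const.inner ℝ contDiffAt_snd
  exact
    { e := (h3.inv hn.ne').smul h1
      f := (h3.div h4 hC.ne').smul
        (h2.sub (((h1.inner ℝ h2).div (h3.pow 2) (pow_pos hn 2).ne').smul h1))
      C := h4
      α := (h5.div h3 hn.ne').sub (contDiffAt_const.div (h4.pow 2) (pow_pos hC 2).ne')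
      β := h6.div (h3.mul h4) (mul_pos hn hC).ne'
      ne := hC.ne' }

theorem isFrame_keplerConic {Z : E} (hZ : ‖Z‖ = 1) (M : ℝ) {z : E × E} (h : 0 < momentumSq Z z) :
    (keplerConic Z M z).IsFrame Z := by
  have hn := norm_perp_pos_of_momentumSq_pos h
  have hC := Real.sqrt_pos.2 h
  have hC2 : √(momentumSq Z z) ^ 2 = ‖perp Z z.1‖ ^ 2 * ‖perp Z z.2‖ ^ 2 -
    ⟪perp Z z.1, perp Z z.2⟫ ^ 2 := Real.sq_sqrt h.le
  have hn' := hn.ne'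
  have hC' := hC.ne'
  refine ⟨?_, ?_, ?_, ?_, ?_, hC⟩
  · simp [keplerConic, inner_smul_right, inner_perp_right hZ]
  · simp [keplerConic, inner_smul_right, inner_sub_right, inner_perp_right hZ]
  · simp only [keplerConic, inner_smul_right, inner_smul_left, inner_sub_right,
      real_inner_self_eq_norm_sq, RCLike.conj_to_real]
    field_simp
    ring
  · simp only [keplerConic, norm_smul, norm_inv, norm_norm]
    exact inv_mul_cancel₀ hn'
  · rw [← sq_eq_sq₀ (norm_nonneg _) zero_le_one, ← real_inner_self_eq_norm_sq]
    simp only [keplerConic, inner_smul_right, inner_smul_left, inner_sub_right, inner_sub_left,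
      real_inner_self_eq_norm_sq, RCLike.conj_to_real,
      real_inner_comm (perp Z z.1) (perp Z z.2)]
    field_simp
    rw [hC2]
    ring

/-- Every state with nonzero angular momentum thus lies on an explicit conic, which supplies the
Kepler orbit through it. -/
theorem keplerConic_state_zero {Z : E} (hZ : ‖Z‖ = 1) (M : ℝ) {z : E × E}
    (hz : z ∈ tangentSphere E) (h : 0 < momentumSq Z z) : (keplerConic Z M z).state Z M 0 = z := by
  have hn := norm_perp_pos_of_momentumSq_pos h
  have hC := Real.sqrt_pos.2 h
  have hn' := hn.ne'
  have hC' := hC.ne'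
  have hr : ‖perp Z z.1‖ ^ 2 = 1 - ⟪Z, z.1⟫ ^ 2 := by rw [norm_perp_sq hZ, hz.1]; ring
  have hcot : (keplerConic Z M z).cot M 0 = ⟪Z, z.1⟫ / ‖perp Z z.1‖ := by
    simp [Conic.cot, keplerConic]
  have hcot' : (keplerConic Z M z).cot' 0 = ⟪Z, z.2⟫ / (‖perp Z z.1‖ * √(momentumSq Z z)) := by
    simp [Conic.cot', keplerConic]
  have h1 : 1 + (⟪Z, z.1⟫ / ‖perp Z z.1‖) ^ 2 = (‖perp Z z.1‖ ^ 2)⁻¹ := by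
    field_simp
    linear_combination hr
  have hsine : (keplerConic Z M z).sine M 0 = ‖perp Z z.1‖ := by
    rw [Conic.sine, hcot, h1, Real.sqrt_inv, inv_inv, Real.sqrt_sq hn.le]
  have hin : ⟪perp Z z.1, perp Z z.2⟫ = -(⟪Z, z.1⟫ * ⟪Z, z.2⟫) := by
    rw [inner_perp_perp hZ, hz.2, zero_sub]
  refine Prod.ext ?_ ?_
  · simp only [Conic.state, Conic.pos, hcot, hsine, Conic.dir, Real.cos_zero, Real.sin_zero]
    simp only [keplerConic]
    have e1 : ‖perp Z z.1‖ * ‖perp Z z.1‖⁻¹ = 1 := mul_inv_cancel₀ hn'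
    have e2 : ‖perp Z z.1‖ * (⟪Z, z.1⟫ / ‖perp Z z.1‖) = ⟪Z, z.1⟫ := by field_simp
    rw [one_smul, zero_smul, add_zero, smul_add, smul_smul, smul_smul, e1, e2, one_smul, perp]
    abel
  · simp only [Conic.state, Conic.vel, hcot, hcot', hsine, h1, Conic.dir, Conic.dir',
      Real.cos_zero, Real.sin_zero]
    simp only [keplerConic, hin]
    set r := ‖perp Z z.1‖
    set C := √(momentumSq Z z)
    have hz2 : z.2 = perp Z z.2 + ⟪Z, z.2⟫ • Z := by rw [perp]; abel
    conv_rhs => rw [hz2]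
    match_scalars <;> field_simp <;> ring

theorem Conic.IsFrame.perp_pos {Z : E} (hZ : ‖Z‖ = 1) {k : Conic E} (hk : k.IsFrame Z) (M φ : ℝ) :
    perp Z (k.pos Z M φ) = k.sine M φ • k.dir φ := by
  rw [Conic.pos, perp_smul, perp_add, perp_smul, perp_self hZ, smul_zero, add_zero,
    perp_of_orthogonal (hk.inner_dir φ)]

theorem Conic.IsFrame.perp_vel {Z : E} (hZ : ‖Z‖ = 1) {k : Conic E} (hk : k.IsFrame Z) (M φ : ℝ) :
    perp Z (k.vel Z M φ) = (k.C * k.sine M φ) • (-(k.cot M φ * k.cot' φ) • k.dir φ +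
      (1 + k.cot M φ ^ 2) • k.dir' φ) := by
  rw [Conic.vel, perp_smul, perp_add, perp_smul, perp_self hZ, smul_zero, add_zero, perp_add,
    perp_smul, perp_smul, perp_of_orthogonal (hk.inner_dir φ), perp_of_orthogonal (hk.inner_dir' φ)]

theorem Conic.IsFrame.norm_perp_pos {Z : E} (hZ : ‖Z‖ = 1) {k : Conic E} (hk : k.IsFrame Z)
    (M φ : ℝ) : ‖perp Z (k.pos Z M φ)‖ = k.sine M φ := by
  have h : ‖k.dir φ‖ = 1 := (hk.rotate φ).norm_e
  rw [hk.perp_pos hZ, norm_smul, h, mul_one, Real.norm_of_nonneg (k.sine_pos M φ).le]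

theorem momentumSq_state {Z : E} (hZ : ‖Z‖ = 1) {M : ℝ} {k : Conic E} (hk : k.IsFrame Z) (φ : ℝ) :
    momentumSq Z (k.state Z M φ) = k.C ^ 2 := by
  simp only [momentumSq, Conic.state]
  rw [hk.norm_perp_pos hZ, hk.perp_pos hZ, hk.perp_vel hZ, ← real_inner_self_eq_norm_sq]
  simp only [inner_add_right, inner_add_left, inner_smul_left, inner_smul_right,
    RCLike.conj_to_real, hk.inner_dir_dir, hk.inner_dir'_dir', hk.inner_dir_dir',
    real_inner_comm (k.dir φ) (k.dir' φ)]
  linear_combination (k.C ^ 2 * (k.sine M φ ^ 2 * (1 + k.cot M φ ^ 2) + 1)) * k.sine_sq M φ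

/-- Starting from another state of the orbit only shifts the origin of the angle. Variations based
at an arbitrary angle can therefore be transported along the same conic as those based at the
initial state. -/
theorem keplerConic_state {Z : E} (hZ : ‖Z‖ = 1) {M : ℝ} {k : Conic E} (hk : k.IsFrame Z) (φ : ℝ) :
    keplerConic Z M (k.state Z M φ) = k.rotate φ := by
  have hm := momentumSq_state hZ (M := M) hk φ
  have hn := hk.norm_perp_pos hZ M φ
  have hQ := hk.perp_pos hZ M φ
  have hU := hk.perp_vel hZ M φ
  have hC : √(momentumSq Z (k.state Z M φ)) = k.C := by rw [hm, Real.sqrt_sq hk.pos_C.le]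
  have hC0 := hk.pos_C.ne'
  have hi := (k.sine_pos M φ).ne'
  have hs := k.sine_sq M φ
  have hw := hk.inner_pos hZ (M := M) φ
  have hp : ⟪Z, k.vel Z M φ⟫ = k.C * k.sine M φ * k.cot' φ := by
    simp [Conic.vel, inner_add_right, inner_smul_right, hk.inner_dir, hk.inner_dir', hZ]
  have hin : ⟪perp Z (k.pos Z M φ), perp Z (k.vel Z M φ)⟫ =
      -(k.C * k.sine M φ ^ 2 * k.cot M φ * k.cot' φ) := by
    rw [hQ, hU]
    simp only [inner_add_right, inner_smul_left, inner_smul_right,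
      RCLike.conj_to_real, hk.inner_dir_dir, hk.inner_dir_dir']
    ring
  refine Conic.ext ?_ ?_ hC ?_ ?_
  · change ‖perp Z (k.pos Z M φ)‖⁻¹ • perp Z (k.pos Z M φ) = k.dir φ
    rw [hn, hQ, smul_smul, inv_mul_cancel₀ hi, one_smul]
  · change (‖perp Z (k.pos Z M φ)‖ / √(momentumSq Z (k.state Z M φ))) • (perp Z (k.vel Z M φ) -
      (⟪perp Z (k.pos Z M φ), perp Z (k.vel Z M φ)⟫ / ‖perp Z (k.pos Z M φ)‖ ^ 2) •
        perp Z (k.pos Z M φ)) = k.dir' φ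
    rw [hin, hn, hQ, hU, hC]
    match_scalars
    · field_simp
      ring
    · field_simp
      linear_combination hs
  · change ⟪Z, k.pos Z M φ⟫ / ‖perp Z (k.pos Z M φ)‖ - M / √(momentumSq Z (k.state Z M φ)) ^ 2 =
      k.α * Real.cos φ + k.β * Real.sin φ
    rw [hw, hn, hC, mul_div_cancel_left₀ _ hi, Conic.cot]
    ring
  · change ⟪Z, k.vel Z M φ⟫ / (‖perp Z (k.pos Z M φ)‖ * √(momentumSq Z (k.state Z M φ))) = k.cot' φ
    rw [hp, hn, hC]
    field_simp

/-! ### Time along the conics and the average -/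

/-- A positive periodic density on the line defines a periodic change of variables. -/
theorem exists_time_change {ρ : ℝ → ℝ} (hc : Continuous ρ) (hpos : ∀ x, 0 < ρ x) {P : ℝ}
    (hP : 0 < P) (hper : Function.Periodic ρ P) :
    ∃ Ψ : ℝ → ℝ, Ψ 0 = 0 ∧ (∀ t, HasDerivAt Ψ (ρ (Ψ t))⁻¹ t) ∧
      (∀ x, Ψ (∫ y in (0 : ℝ)..x, ρ y) = x) ∧
      ∀ t, Ψ (t + ∫ y in (0 : ℝ)..P, ρ y) = Ψ t + P := by
  have hInt : ∀ a b, IntervalIntegrable ρ volume a b := fun a b => hc.intervalIntegrable a b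
  -- `τ` is time as a function of the angle; the required `Ψ` is its inverse, the angle as a
  -- function of time.
  set τ : ℝ → ℝ := fun x => ∫ y in (0 : ℝ)..x, ρ y with hτ
  have hder : ∀ x, HasDerivAt τ (ρ x) x := fun x =>
    intervalIntegral.integral_hasDerivAt_right (hInt 0 x)
      (hc.stronglyMeasurableAtFilter _ _) hc.continuousAt
  have hmono : StrictMono τ := strictMono_of_deriv_pos fun x => by
    rw [(hder x).deriv]; exact hpos x
  have hcont : Continuous τ := continuous_iff_continuousAt.2 fun x => (hder x).continuousAt
  have hsurj : Function.Surjective τ := hcont.surjective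
    (hper.tendsto_atTop_intervalIntegral_of_pos' (hInt 0 P) hpos hP)
    (hper.tendsto_atBot_intervalIntegral_of_pos' (hInt 0 P) hpos hP)
  set e := hmono.orderIsoOfSurjective τ hsurj with he
  have he' : ∀ x, e x = τ x := fun x => rfl
  have hadd : ∀ x, τ (x + P) = τ x + τ P := fun x => by
    simp only [hτ]
    rw [← intervalIntegral.integral_add_adjacent_intervals (hInt 0 x) (hInt x (x + P)),
      hper.intervalIntegral_add_eq x 0, zero_add]
  refine ⟨e.symm, ?_, fun t => ?_, fun x => ?_, fun t => ?_⟩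
  · rw [OrderIso.symm_apply_eq, he']; simp [hτ]
  · refine HasDerivAt.of_local_left_inverse (f := τ) e.symm.continuous.continuousAt (hder _)
      (hpos _).ne' (Eventually.of_forall fun y => ?_)
    rw [← he', OrderIso.apply_symm_apply]
  · rw [OrderIso.symm_apply_eq, he']
  · rw [OrderIso.symm_apply_eq, he', hadd, ← he', OrderIso.apply_symm_apply]

/-- The time of one revolution. -/
def revolutionTime (Z : E) (M : ℝ) (z : E × E) : ℝ :=
  ∫ ψ in (0 : ℝ)..(2 * Real.pi), (keplerConic Z M z).density M ψ

/-- The integral of a function of the position over one revolution. -/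
def revolutionIntegral (Z : E) (M : ℝ) (W : E → ℝ) (z : E × E) : ℝ :=
  ∫ ψ in (0 : ℝ)..(2 * Real.pi),
    W ((keplerConic Z M z).pos Z M ψ) * (keplerConic Z M z).density M ψ

theorem revolutionTime_pos {Z : E} (hZ : ‖Z‖ = 1) (M : ℝ) {z : E × E} (h : 0 < momentumSq Z z) :
    0 < revolutionTime Z M z := by
  have hk := isFrame_keplerConic hZ M h
  exact intervalIntegral.intervalIntegral_pos_of_pos
    ((Conic.continuous_density hk M).intervalIntegrable _ _) (Conic.density_pos hk M)
    (by positivity)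

/-- The Kepler orbit through a state with nonzero angular momentum is closed. -/
theorem exists_isClosedKeplerOrbit {Z : E} (hZ : ‖Z‖ = 1) (M : ℝ) {z : E × E}
    (hz : z ∈ tangentSphere E) (h : 0 < momentumSq Z z) :
    ∃ Ψ : ℝ → ℝ, Continuous Ψ ∧
      (∀ x, Ψ (∫ y in (0 : ℝ)..x, (keplerConic Z M z).density M y) = x) ∧
      IsClosedKeplerOrbit Z M z (fun t => (keplerConic Z M z).state Z M (Ψ t))
        (revolutionTime Z M z) := by
  have hk := isFrame_keplerConic hZ M h
  obtain ⟨Ψ, h0, hd, hinv, hadd⟩ := exists_time_change (Conic.continuous_density hk M)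
    (Conic.density_pos hk M) (by positivity : 0 < 2 * Real.pi)
    ((keplerConic Z M z).density_periodic M)
  refine ⟨Ψ, continuous_iff_continuousAt.2 fun t => (hd t).continuousAt, hinv,
    isKeplerOrbit_of_hasDerivAt hZ (fun t => hk.state_mem hZ _)
      (fun t => hk.inner_pos_sq_lt_one hZ _) (fun t => ?_) (fun t => ?_), ?_,
    revolutionTime_pos hZ M h, fun t => ?_⟩
  · refine ((hk.hasDerivAt_pos M (Ψ t)).scomp t (hd t)).congr_deriv ?_
    rw [smul_smul, inv_mul_cancel₀ (Conic.density_pos hk M _).ne', one_smul]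
    rfl
  · refine ((hk.hasDerivAt_vel hZ M (Ψ t)).scomp t (hd t)).congr_deriv ?_
    rw [smul_smul, inv_mul_cancel₀ (Conic.density_pos hk M _).ne', one_smul]
  · simp only [h0]
    exact keplerConic_state_zero hZ M hz h
  · simp only [revolutionTime, hadd]
    exact (keplerConic Z M z).state_periodic Z M _

/-- The definition chooses some orbit and some period. The orbit is unique, and the mean of a
periodic function is the same for all periods, so one revolution of the conic may be used;
substituting the angle for time gives the formula. -/
theorem keplerAverage_eq {Z : E} (hZ : ‖Z‖ = 1) (M : ℝ) {z : E × E}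
    (hz : z ∈ tangentSphere E) (h : 0 < momentumSq Z z) {W : E → ℝ}
    (hW : Continuous fun ψ => W ((keplerConic Z M z).pos Z M ψ)) :
    keplerAverage Z M W z = (revolutionTime Z M z)⁻¹ * revolutionIntegral Z M W z := by
  have hk := isFrame_keplerConic hZ M h
  obtain ⟨Ψ, hΨ, hinv, hcl⟩ := exists_isClosedKeplerOrbit hZ M hz h
  set k := keplerConic Z M z with hk_def
  have hex : ∃ p : (ℝ → E × E) × ℝ, IsClosedKeplerOrbit Z M z p.1 p.2 := ⟨(_, _), hcl⟩
  rw [keplerAverage, dif_pos hex]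
  obtain ⟨h1, h2, h3, h4⟩ := hex.choose_spec
  obtain ⟨g1, g2, g3, g4⟩ := hcl
  have heq : hex.choose.1 = fun t => k.state Z M (Ψ t) := h1.eq_of_eq hZ g1 (h2.trans g2.symm)
  rw [heq] at h4 ⊢
  have hWc : Continuous fun t => W (k.state Z M (Ψ t)).1 := hW.comp hΨ
  rw [average_eq_of_periodic hWc h3 g3 (fun t => by simp only [h4 t]) (fun t => by
    simp only [g4 t])]
  congr 1
  have hc := Conic.continuous_density hk M
  have hsub := intervalIntegral.integral_comp_mul_deriv (a := 0) (b := 2 * Real.pi)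
    (f := fun x => ∫ y in (0 : ℝ)..x, k.density M y) (f' := k.density M)
    (g := fun t => W (k.state Z M (Ψ t)).1)
    (fun x _ => intervalIntegral.integral_hasDerivAt_right (hc.intervalIntegrable _ _)
      (hc.stronglyMeasurableAtFilter _ _) hc.continuousAt) hc.continuousOn hWc
  simp only [Function.comp_def, hinv, intervalIntegral.integral_same] at hsub
  exact hsub.symm

/-! ### Jacobi fields -/

/-- The derivative of `keplerCoeff` as a function of `⟪Z, q⟫`. -/
def keplerCoeff' (Z : E) (M : ℝ) (q : E) : ℝ := 3 * M * ⟪Z, q⟫ / √(1 - ⟪Z, q⟫ ^ 2) ^ 5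

theorem hasDerivAt_keplerCoeff {Z : E} {M t : ℝ} {q : ℝ → E} {q' : E} (hq : HasDerivAt q q' t)
    (hlt : ⟪Z, q t⟫ ^ 2 < 1) :
    HasDerivAt (fun s => keplerCoeff Z M (q s)) (keplerCoeff' Z M (q t) * ⟪Z, q'⟫) t := by
  have hpos : 0 < 1 - ⟪Z, q t⟫ ^ 2 := by linarith
  have hr := (Real.sqrt_pos.2 hpos).ne'
  have hw : HasDerivAt (fun s => ⟪Z, q s⟫) ⟪Z, q'⟫ t := by
    simpa using (hasDerivAt_const t Z).inner ℝ hq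
  have h1 := (((hw.pow 2).const_sub 1).sqrt hpos.ne').pow 3
  refine ((hasDerivAt_const t M).div h1 (pow_ne_zero 3 hr)).congr_deriv ?_
  simp only [keplerCoeff', Pi.pow_apply, Nat.cast_ofNat, Nat.add_one_sub_one, pow_one]
  field_simp
  ring

/-- The differential of the Kepler energy on the tangent bundle of the sphere. -/
def energyForm (Z : E) (M : ℝ) (z X : E × E) : ℝ :=
  ⟪z.2, X.2⟫ - keplerCoeff Z M z.1 * ⟪Z, X.1⟫

/-- The curve `z` in the tangent bundle of the sphere solves the Kepler problem, in the
parametrization in which the derivative of time is `ρ`. -/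
structure IsTimeChangedOrbit (Z : E) (M : ℝ) (z : ℝ → E × E) (ρ : ℝ → ℝ) : Prop where
  mem : ∀ t, z t ∈ tangentSphere E
  lt : ∀ t, ⟪Z, (z t).1⟫ ^ 2 < 1
  fst : ∀ t, HasDerivAt (fun s => (z s).1) (ρ t • (z t).2) t
  snd : ∀ t, HasDerivAt (fun s => (z s).2) (ρ t • keplerForce Z M (z t)) t

/-- The linearization of `IsTimeChangedOrbit`, with variation `δ` of `ρ`. -/
structure IsJacobiField (Z : E) (M : ℝ) (z : ℝ → E × E) (ρ : ℝ → ℝ) (J : ℝ → E × E)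
    (δ : ℝ → ℝ) : Prop where
  mem : ∀ t, J t ∈ tangentAt (z t)
  fst : ∀ t, HasDerivAt (fun s => (J s).1) (δ t • (z t).2 + ρ t • (J t).2) t
  snd : ∀ t, ∃ ν : ℝ, HasDerivAt (fun s => (J s).2) (δ t • keplerForce Z M (z t) +
    ρ t • (ν • (z t).1 - (‖(z t).2‖ ^ 2 + ⟪Z, (z t).1⟫ * keplerCoeff Z M (z t).1) • (J t).1 +
      (keplerCoeff' Z M (z t).1 * ⟪Z, (J t).1⟫) • Z)) t

section Jacobi

variable {Z : E} {M : ℝ} {z J K : ℝ → E × E} {ρ δ ε : ℝ → ℝ}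

/-- Linearized conservation of energy. The term with `δ` is along the Kepler flow, where the energy
is stationary. The multiplier `ν` disappears since `⟪q, v⟫ = 0`, which is why `IsJacobiField` leaves
it unspecified. -/
theorem IsJacobiField.hasDerivAt_energyForm (hz : IsTimeChangedOrbit Z M z ρ)
    (hJ : IsJacobiField Z M z ρ J δ) (t : ℝ) :
    HasDerivAt (fun s => energyForm Z M (z s) (J s)) 0 t := by
  obtain ⟨ν, h2⟩ := hJ.snd t
  have h1 := hJ.fst t
  have hf := hasDerivAt_keplerCoeff (M := M) (hz.fst t) (hz.lt t)
  have hZJ : HasDerivAt (fun s => ⟪Z, (J s).1⟫) ⟪Z, δ t • (z t).2 + ρ t • (J t).2⟫ t := by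
    simpa using (hasDerivAt_const t Z).inner ℝ h1
  refine (((hz.snd t).inner ℝ h2).sub (hf.mul hZJ)).congr_deriv ?_
  have hm := hJ.mem t
  have hqv := (hz.mem t).2
  have hJ1 := hm.1
  have hJ2 := hm.2
  have c1 := real_inner_comm (z t).1 (z t).2
  have c2 := real_inner_comm (z t).1 (J t).1
  have c3 := real_inner_comm (J t).1 (z t).2
  simp only [keplerForce, inner_add_left, inner_add_right, inner_sub_right, inner_smul_left,
    inner_smul_right, RCLike.conj_to_real, real_inner_comm Z (z t).2, c1, c3, hqv]
  linear_combination (-ρ t * (‖(z t).2‖ ^ 2 + ⟪Z, (z t).1⟫ * keplerCoeff Z M (z t).1)) * hJ2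

/-- In true time the pairing of two Jacobi fields is constant because the flow is symplectic. A
variation `δ` of the time density adds `δ` times the Hamiltonian vector of the energy, whose pairing
with `K` is the energy differential of `K`; likewise for `ε`. -/
theorem IsJacobiField.hasDerivAt_symplecticForm
    (hJ : IsJacobiField Z M z ρ J δ) (hK : IsJacobiField Z M z ρ K ε) (t : ℝ) :
    HasDerivAt (fun s => symplecticForm (J s) (K s))
      (δ t * energyForm Z M (z t) (K t) - ε t * energyForm Z M (z t) (J t)) t := by
  obtain ⟨ν, hJ2⟩ := hJ.snd t
  obtain ⟨μ, hK2⟩ := hK.snd t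
  refine (((hJ.fst t).inner ℝ hK2).sub ((hK.fst t).inner ℝ hJ2)).congr_deriv ?_
  have mJ := (hJ.mem t).1
  have mK := (hK.mem t).1
  rw [real_inner_comm] at mJ mK
  simp only [keplerForce, energyForm, inner_add_left, inner_add_right, inner_sub_right,
    inner_smul_left, inner_smul_right, RCLike.conj_to_real, real_inner_comm Z (J t).1,
    real_inner_comm Z (K t).1, mJ, mK, real_inner_comm (J t).1 (K t).1,
    real_inner_comm (J t).2 (K t).2]
  ring

theorem IsJacobiField.comp_const_add (hJ : IsJacobiField Z M z ρ J δ) (a : ℝ) :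
    IsJacobiField Z M (fun t => z (a + t)) (fun t => ρ (a + t)) (fun t => J (a + t))
      (fun t => δ (a + t)) where
  mem t := hJ.mem _
  fst t := (hJ.fst (a + t)).comp_const_add a t
  snd t := by
    obtain ⟨ν, h⟩ := hJ.snd (a + t)
    exact ⟨ν, h.comp_const_add a t⟩

end Jacobi

theorem Conic.IsFrame.isTimeChangedOrbit {Z : E} (hZ : ‖Z‖ = 1) {k : Conic E} (hk : k.IsFrame Z)
    (M : ℝ) : IsTimeChangedOrbit Z M (k.state Z M) (k.density M) where
  mem := hk.state_mem hZ
  lt := hk.inner_pos_sq_lt_one hZ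
  fst := hk.hasDerivAt_pos M
  snd := hk.hasDerivAt_vel hZ M

/-- The variation of the state on the Kepler orbit at fixed angle. -/
def stateVariation (Z : E) (M : ℝ) (z Y : E × E) (ψ : ℝ) : E × E :=
  (fderiv ℝ (fun x => (keplerConic Z M x).pos Z M ψ) z Y,
    fderiv ℝ (fun x => (keplerConic Z M x).vel Z M ψ) z Y)

/-- The variation of the derivative of time at fixed angle. -/
def densityVariation (Z : E) (M : ℝ) (z Y : E × E) (ψ : ℝ) : ℝ :=
  fderiv ℝ (fun x => (keplerConic Z M x).density M ψ) z Y

/-- The reason for varying at fixed angle: at fixed time the variation need not be periodic, since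
neighbouring orbits may have other periods. -/
theorem stateVariation_periodic (Z : E) (M : ℝ) (z Y : E × E) :
    Function.Periodic (stateVariation Z M z Y) (2 * Real.pi) := fun ψ => by
  have h1 : ∀ x, (keplerConic Z M x).pos Z M (ψ + 2 * Real.pi) = (keplerConic Z M x).pos Z M ψ :=
    fun x => congrArg Prod.fst ((keplerConic Z M x).state_periodic Z M ψ)
  have h2 : ∀ x, (keplerConic Z M x).vel Z M (ψ + 2 * Real.pi) = (keplerConic Z M x).vel Z M ψ :=
    fun x => congrArg Prod.snd ((keplerConic Z M x).state_periodic Z M ψ)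
  simp only [stateVariation, h1, h2]

/-! ### Variation of the conics with the initial state -/

section Variation

variable {Z : E} {M : ℝ} {z Y : E × E}

theorem hasFDerivAt_pos (h : 0 < momentumSq Z z) (ψ : ℝ) :
    HasFDerivAt (fun x => (keplerConic Z M x).pos Z M ψ)
      (fderiv ℝ (fun x => (keplerConic Z M x).pos Z M ψ) z) z := by
  have h1 := ((smoothAt_keplerConic Z M h (n := 1)).pos Z M ψ).comp (f := fun x => (x, ψ)) z
    (by fun_prop)
  exact (h1.differentiableAt (by simp)).hasFDerivAt

theorem hasFDerivAt_vel (h : 0 < momentumSq Z z) (ψ : ℝ) :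
    HasFDerivAt (fun x => (keplerConic Z M x).vel Z M ψ)
      (fderiv ℝ (fun x => (keplerConic Z M x).vel Z M ψ) z) z := by
  have h1 := ((smoothAt_keplerConic Z M h (n := 1)).vel Z M ψ).comp (f := fun x => (x, ψ)) z
    (by fun_prop)
  exact (h1.differentiableAt (by simp)).hasFDerivAt

theorem hasFDerivAt_density (h : 0 < momentumSq Z z) (ψ : ℝ) :
    HasFDerivAt (fun x => (keplerConic Z M x).density M ψ)
      (fderiv ℝ (fun x => (keplerConic Z M x).density M ψ) z) z := by
  have h1 := ((smoothAt_keplerConic Z M h (n := 1)).density M ψ).comp (f := fun x => (x, ψ)) z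
    (by fun_prop)
  exact (h1.differentiableAt (by simp)).hasFDerivAt

theorem hasDerivAt_state_comp (h : 0 < momentumSq Z z) {c : ℝ → E × E} (h0 : c 0 = z)
    (hc : HasDerivAt c Y 0) (ψ : ℝ) :
    HasDerivAt (fun s => (keplerConic Z M (c s)).state Z M ψ) (stateVariation Z M z Y ψ) 0 :=
  ((hasFDerivAt_pos h ψ).comp_hasDerivAt_of_eq (0 : ℝ) hc h0.symm).prodMk
    ((hasFDerivAt_vel h ψ).comp_hasDerivAt_of_eq (0 : ℝ) hc h0.symm)

theorem eventually_momentumSq_pos (h : 0 < momentumSq Z z) {c : ℝ → E × E} (h0 : c 0 = z)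
    (hc : HasDerivAt c Y 0) : ∀ᶠ s in 𝓝 0, 0 < momentumSq Z (c s) := by
  have h1 : ContinuousAt (fun s => momentumSq Z (c s)) 0 :=
    (contDiff_momentumSq Z (n := 0)).continuous.continuousAt.comp hc.continuousAt
  exact h1.eventually (lt_mem_nhds (by simpa [h0] using h))

/-- The conic through `x` reproduces `x` at angle `0` only for `x` in `tangentSphere E`, hence the
restriction to tangent `Y` and the curve inside the bundle. -/
theorem stateVariation_zero (hZ : ‖Z‖ = 1) (hz : z ∈ tangentSphere E) (h : 0 < momentumSq Z z)
    (hY : Y ∈ tangentAt z) : stateVariation Z M z Y 0 = Y := by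
  obtain ⟨c, h0, hc, -, hmem⟩ := exists_curve_of_mem_tangentAt hz hY
  refine (hasDerivAt_state_comp (M := M) h h0 hc 0).unique (hc.congr_of_eventuallyEq ?_)
  filter_upwards [eventually_momentumSq_pos h h0 hc] with s hs
  exact keplerConic_state_zero hZ M (hmem s) hs

/-- The orbit equations hold for all conics near `z`. Differentiating them along a curve of initial
states and exchanging the mixed partial derivatives linearizes them; the curve is taken of class
`C²` for this exchange. -/
theorem isJacobiField_stateVariation (hZ : ‖Z‖ = 1) (hz : z ∈ tangentSphere E)
    (h : 0 < momentumSq Z z) (hY : Y ∈ tangentAt z) :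
    IsJacobiField Z M ((keplerConic Z M z).state Z M) ((keplerConic Z M z).density M)
      (stateVariation Z M z Y) (densityVariation Z M z Y) := by
  obtain ⟨c, h0, hc, hc2, hmem⟩ := exists_curve_of_mem_tangentAt hz hY
  have hev := eventually_momentumSq_pos h h0 hc
  have hsm : Conic.SmoothAt 2 (fun s => keplerConic Z M (c s)) 0 :=
    (smoothAt_keplerConic Z M h).comp hc2.contDiffAt h0
  have hk := isFrame_keplerConic hZ M h
  have hp : ∀ ψ, HasDerivAt (fun s => (keplerConic Z M (c s)).pos Z M ψ)
      (stateVariation Z M z Y ψ).1 0 := fun ψ => (hasDerivAt_state_comp h h0 hc ψ).fst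
  have hv : ∀ ψ, HasDerivAt (fun s => (keplerConic Z M (c s)).vel Z M ψ)
      (stateVariation Z M z Y ψ).2 0 := fun ψ => (hasDerivAt_state_comp h h0 hc ψ).snd
  have hd : ∀ ψ, HasDerivAt (fun s => (keplerConic Z M (c s)).density M ψ)
      (densityVariation Z M z Y ψ) 0 := fun ψ =>
    (hasFDerivAt_density h ψ).comp_hasDerivAt_of_eq (0 : ℝ) hc h0.symm
  refine ⟨fun ψ => ⟨?_, ?_⟩, fun ψ => ?_, fun ψ => ?_⟩
  · have h1 := (hp ψ).norm_sq
    have h2 : (fun s => ‖(keplerConic Z M (c s)).pos Z M ψ‖ ^ 2) =ᶠ[𝓝 0] fun _ => 1 := by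
      filter_upwards [hev] with s hs
      have := ((isFrame_keplerConic hZ M hs).state_mem hZ (M := M) ψ).1
      simp only [Conic.state] at this
      rw [this]; norm_num
    have h3 := (h1.congr_of_eventuallyEq h2.symm).unique (hasDerivAt_const 0 1)
    rw [h0] at h3
    simpa [Conic.state] using h3
  · have h1 := (hp ψ).inner ℝ (hv ψ)
    have h2 : (fun s => ⟪(keplerConic Z M (c s)).pos Z M ψ, (keplerConic Z M (c s)).vel Z M ψ⟫)
        =ᶠ[𝓝 0] fun _ => 0 := by
      filter_upwards [hev] with s hs
      exact ((isFrame_keplerConic hZ M hs).state_mem hZ (M := M) ψ).2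
    have h3 := (h1.congr_of_eventuallyEq h2.symm).unique (hasDerivAt_const 0 0)
    rw [h0] at h3
    simp only [Conic.state]
    linarith
  · have h1 := hasDerivAt_deriv_comm (hsm.pos Z M ψ)
      (w := fun s => (keplerConic Z M (c s)).density M ψ • (keplerConic Z M (c s)).vel Z M ψ)
      (by
        filter_upwards [hev] with s hs
        exact (isFrame_keplerConic hZ M hs).hasDerivAt_pos M ψ) ((hd ψ).smul (hv ψ))
    have h2 : (fun t => deriv (fun s => (keplerConic Z M (c s)).pos Z M t) 0) =
        fun t => (stateVariation Z M z Y t).1 := funext fun t => (hp t).deriv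
    rw [h2, h0] at h1
    refine h1.congr_deriv ?_
    rw [add_comm]; rfl
  · have hf := hasDerivAt_keplerCoeff (M := M) (hp ψ)
      (by rw [h0]; exact hk.inner_pos_sq_lt_one hZ ψ)
    have hw : HasDerivAt (fun s => ⟪Z, (keplerConic Z M (c s)).pos Z M ψ⟫)
        ⟪Z, (stateVariation Z M z Y ψ).1⟫ 0 := by
      simpa using (hasDerivAt_const (0 : ℝ) Z).inner ℝ (hp ψ)
    obtain ⟨ν, hl⟩ : ∃ ν, HasDerivAt (fun s => -(‖(keplerConic Z M (c s)).vel Z M ψ‖ ^ 2 +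
        ⟪Z, (keplerConic Z M (c s)).pos Z M ψ⟫ *
          keplerCoeff Z M ((keplerConic Z M (c s)).pos Z M ψ))) ν 0 :=
      ⟨_, (((hv ψ).norm_sq).add (hw.mul hf)).neg⟩
    have hF : HasDerivAt (fun s => keplerForce Z M ((keplerConic Z M (c s)).state Z M ψ)) _ 0 :=
      (hl.smul (hp ψ)).add (hf.smul_const Z)
    have h1 := hasDerivAt_deriv_comm (hsm.vel Z M ψ)
      (w := fun s => (keplerConic Z M (c s)).density M ψ •
        keplerForce Z M ((keplerConic Z M (c s)).state Z M ψ))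
      (by
        filter_upwards [hev] with s hs
        exact (isFrame_keplerConic hZ M hs).hasDerivAt_vel hZ M ψ) ((hd ψ).smul hF)
    have h2 : (fun t => deriv (fun s => (keplerConic Z M (c s)).vel Z M t) 0) =
        fun t => (stateVariation Z M z Y t).2 := funext fun t => (hv t).deriv
    rw [h2] at h1
    refine ⟨ν, h1.congr_deriv ?_⟩
    simp only [h0, Conic.state]
    module

/-- The differential of a first integral is constant along the variation of an orbit. -/
theorem fderivWithin_stateVariation (hZ : ‖Z‖ = 1) (hz : z ∈ tangentSphere E)
    (h : 0 < momentumSq Z z) (hY : Y ∈ tangentAt z) {G : E × E → ℝ}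
    (hG : ∀ k : Conic E, k.IsFrame Z → ∀ ψ, G (k.state Z M ψ) = G (k.state Z M 0))
    (hGd : ∀ ψ, DifferentiableWithinAt ℝ G (tangentSphere E) ((keplerConic Z M z).state Z M ψ))
    (ψ : ℝ) :
    fderivWithin ℝ G (tangentSphere E) ((keplerConic Z M z).state Z M ψ)
      (stateVariation Z M z Y ψ) = fderivWithin ℝ G (tangentSphere E) z Y := by
  obtain ⟨c, h0, hc, hc2, hmem⟩ := exists_curve_of_mem_tangentAt hz hY
  have hev := eventually_momentumSq_pos h h0 hc
  have key : ∀ φ, HasDerivAt (fun s => G ((keplerConic Z M (c s)).state Z M φ))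
      (fderivWithin ℝ G (tangentSphere E) ((keplerConic Z M z).state Z M φ)
        (stateVariation Z M z Y φ)) 0 := fun φ =>
    hasDerivAt_comp_of_mem_tangentSphere (hGd φ) (by rw [h0]) (hasDerivAt_state_comp h h0 hc φ)
      (by filter_upwards [hev] with s hs using (isFrame_keplerConic hZ M hs).state_mem hZ φ)
  have h1 := key 0
  rw [stateVariation_zero hZ hz h hY, keplerConic_state_zero hZ M hz h] at h1
  refine (key ψ).unique (h1.congr_of_eventuallyEq ?_)
  filter_upwards [hev] with s hs
  exact hG _ (isFrame_keplerConic hZ M hs) ψ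

end Variation

/-! ### Averaging commutes with the bracket -/

section Averaging

variable {Z : E} {M : ℝ} {z : E × E} {W : E → ℝ}

theorem contDiffAt_pos_density (h : 0 < momentumSq Z z) {ψ : ℝ}
    (hW : ContDiffAt ℝ 1 W ((keplerConic Z M z).pos Z M ψ)) :
    ContDiffAt ℝ 1 (fun p : (E × E) × ℝ => W ((keplerConic Z M p.1).pos Z M p.2) *
      (keplerConic Z M p.1).density M p.2) (z, ψ) := by
  have hsm := smoothAt_keplerConic Z M h (n := 1)
  exact (ContDiffAt.comp (g := W) (z, ψ) hW (hsm.pos Z M ψ)).mul (hsm.density M ψ)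

theorem hasFDerivAt_revolutionIntegral (h : 0 < momentumSq Z z)
    (hW : ∀ ψ, ContDiffAt ℝ 1 W ((keplerConic Z M z).pos Z M ψ)) :
    HasFDerivAt (revolutionIntegral Z M W) (∫ ψ in (0 : ℝ)..(2 * Real.pi),
      fderiv ℝ (fun x => W ((keplerConic Z M x).pos Z M ψ) * (keplerConic Z M x).density M ψ) z)
      z :=
  hasFDerivAt_intervalIntegral_of_contDiffAt
    (f := fun x ψ => W ((keplerConic Z M x).pos Z M ψ) * (keplerConic Z M x).density M ψ)
    fun ψ _ => contDiffAt_pos_density h (hW ψ)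

theorem hasFDerivAt_revolutionTime (h : 0 < momentumSq Z z) :
    HasFDerivAt (revolutionTime Z M) (∫ ψ in (0 : ℝ)..(2 * Real.pi),
      fderiv ℝ (fun x => (keplerConic Z M x).density M ψ) z) z :=
  hasFDerivAt_intervalIntegral_of_contDiffAt
    (f := fun x ψ => (keplerConic Z M x).density M ψ)
    fun ψ _ => (smoothAt_keplerConic Z M h).density M ψ

theorem continuous_densityVariation (h : 0 < momentumSq Z z) (Y : E × E) :
    Continuous (densityVariation Z M z Y) := by
  refine continuous_iff_continuousAt.2 fun ψ => ?_
  exact (continuousAt_fderiv_left (f := fun x ψ => (keplerConic Z M x).density M ψ)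
    ((smoothAt_keplerConic Z M h).density M ψ)).clm_apply continuousAt_const

theorem keplerFlow_mem_tangentAt {z : E × E} (hz : z ∈ tangentSphere E) :
    ((z.2, keplerForce Z M z) : E × E) ∈ tangentAt z := by
  refine ⟨hz.2, ?_⟩
  have hqq : ⟪z.1, z.1⟫ = 1 := by rw [real_inner_self_eq_norm_sq, hz.1]; norm_num
  simp only [keplerForce, inner_add_right, inner_smul_right, hqq, real_inner_self_eq_norm_sq,
    real_inner_comm Z z.1]
  ring

theorem vertical_mem_tangentAt {z : E × E} {g : E} (hg : ⟪z.1, g⟫ = 0) :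
    ((0, g) : E × E) ∈ tangentAt z := by
  simp [tangentAt, hg]

/-- A first integral of the Kepler problem commutes with the Kepler energy. -/
theorem energyForm_eq_zero (hZ : ‖Z‖ = 1) (hz : z ∈ tangentSphere E) (h : 0 < momentumSq Z z)
    {G : E × E → ℝ}
    (hG : ∀ k : Conic E, k.IsFrame Z → ∀ ψ, G (k.state Z M ψ) = G (k.state Z M 0))
    (hGd : DifferentiableWithinAt ℝ G (tangentSphere E) z) {X : E × E}
    (hX : IsHamiltonianVector G z X) : energyForm Z M z X = 0 := by
  have hk := isFrame_keplerConic hZ M h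
  have h0 := keplerConic_state_zero hZ M hz h
  have hder : HasDerivAt ((keplerConic Z M z).state Z M)
      ((keplerConic Z M z).density M 0 • ((z.2, keplerForce Z M z) : E × E)) 0 := by
    refine ((hk.hasDerivAt_pos M 0).prodMk (hk.hasDerivAt_vel hZ M 0)).congr_deriv ?_
    rw [h0, ← congrArg Prod.snd h0]
    rfl
  have h1 := hasDerivAt_comp_of_mem_tangentSphere hGd h0 hder
    (Eventually.of_forall fun ψ => hk.state_mem hZ ψ)
  have h2 : (fun ψ => G ((keplerConic Z M z).state Z M ψ)) = fun _ => G z :=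
    funext fun ψ => (hG _ hk ψ).trans (by rw [h0])
  rw [h2] at h1
  have h3 := h1.unique (hasDerivAt_const 0 _)
  rw [map_smul, smul_eq_mul, mul_eq_zero] at h3
  have h4 := h3.resolve_left (Conic.density_pos hk M 0).ne'
  -- `dG` vanishes on the Kepler flow; by the definition of `X` this is the pairing of `X` with that
  -- flow, which equals minus the energy differential of `X`.
  rw [← hX.eq _ (keplerFlow_mem_tangentAt hz)] at h4
  have h5 := keplerForce_inner_of_orthogonal Z M hX.mem.1
  simp only [symplecticForm] at h4
  rw [real_inner_comm] at h5
  rw [energyForm]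
  linear_combination h5 - h4

/-- The variation of the orbit in the direction of the Hamiltonian vector of a first integral `G`,
paired with a vertical vector. -/
theorem inner_stateVariation (hZ : ‖Z‖ = 1) (hz : z ∈ tangentSphere E) (h : 0 < momentumSq Z z)
    {G : E × E → ℝ}
    (hG : ∀ k : Conic E, k.IsFrame Z → ∀ ψ, G (k.state Z M ψ) = G (k.state Z M 0))
    (hGd : ∀ ψ, DifferentiableWithinAt ℝ G (tangentSphere E) ((keplerConic Z M z).state Z M ψ))
    {X : E × E} (hX : IsHamiltonianVector G z X) (φ : ℝ) {g : E}
    (hg : ⟪(keplerConic Z M z).pos Z M φ, g⟫ = 0) :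
    ⟪(stateVariation Z M z X φ).1, g⟫ =
      fderivWithin ℝ G (tangentSphere E) ((keplerConic Z M z).state Z M φ) (0, g) +
        (∫ ψ in (0 : ℝ)..φ, densityVariation Z M z X ψ) * ⟪(keplerConic Z M z).vel Z M φ, g⟫ := by
  set k := keplerConic Z M z with hk_def
  have hk : k.IsFrame Z := isFrame_keplerConic hZ M h
  have h0 : k.state Z M 0 = z := keplerConic_state_zero hZ M hz h
  have hGz : DifferentiableWithinAt ℝ G (tangentSphere E) z := h0 ▸ hGd 0
  have hJ : IsJacobiField Z M (k.state Z M) (k.density M) (stateVariation Z M z X)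
      (densityVariation Z M z X) := isJacobiField_stateVariation hZ hz h hX.mem
  -- the variation whose value at the angle `φ` is the given vertical vector
  set y := k.state Z M φ with hy
  have hyT : y ∈ tangentSphere E := hk.state_mem hZ φ
  have hym : 0 < momentumSq Z y := by
    rw [hy, momentumSq_state hZ hk]; exact pow_pos hk.pos_C 2
  have hyk : keplerConic Z M y = k.rotate φ := keplerConic_state hZ hk φ
  have hV : ((0, g) : E × E) ∈ tangentAt y := vertical_mem_tangentAt hg
  have hK0 := isJacobiField_stateVariation (M := M) hZ hyT hym hV
  set K : ℝ → E × E := fun ψ => stateVariation Z M y (0, g) (-φ + ψ) with hK_def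
  have hK : IsJacobiField Z M (k.state Z M) (k.density M) K
      (fun ψ => densityVariation Z M y (0, g) (-φ + ψ)) := by
    have := hK0.comp_const_add (-φ)
    simp only [hyk, Conic.rotate_state, Conic.rotate_density, add_neg_cancel_left] at this
    exact this
  have hKφ : K φ = (0, g) := by
    simp only [hK_def, neg_add_cancel]
    exact stateVariation_zero hZ hyT hym hV
  have horb := hk.isTimeChangedOrbit hZ M
  have hEJ : ∀ ψ, energyForm Z M (k.state Z M ψ) (stateVariation Z M z X ψ) = 0 := fun ψ => by
    have hd := fun t => hJ.hasDerivAt_energyForm horb t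
    rw [is_const_of_deriv_eq_zero (fun t => (hd t).differentiableAt) (fun t => (hd t).deriv) ψ 0,
      stateVariation_zero hZ hz h hX.mem, h0]
    exact energyForm_eq_zero hZ hz h hG hGz hX
  have hEK : ∀ ψ, energyForm Z M (k.state Z M ψ) (K ψ) = ⟪k.vel Z M φ, g⟫ := fun ψ => by
    have hd := fun t => hK.hasDerivAt_energyForm horb t
    rw [is_const_of_deriv_eq_zero (fun t => (hd t).differentiableAt) (fun t => (hd t).deriv) ψ φ,
      hKφ]
    simp [energyForm, Conic.state]
  have hcδ : Continuous (densityVariation Z M z X) := continuous_densityVariation h X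
  set σ : ℝ → ℝ := fun φ => ∫ ψ in (0 : ℝ)..φ, densityVariation Z M z X ψ with hσ
  have hσd : ∀ ψ, HasDerivAt σ (densityVariation Z M z X ψ) ψ := fun ψ =>
    intervalIntegral.integral_hasDerivAt_right (hcδ.intervalIntegrable _ _)
      (hcδ.stronglyMeasurableAtFilter _ _) hcδ.continuousAt
  -- The field of `X` has energy `0` and `K` has the constant energy `⟪v, g⟫`, so the pairing grows
  -- exactly like `σ` times this constant.
  have hd : ∀ ψ, HasDerivAt (fun s => symplecticForm (stateVariation Z M z X s) (K s) -
      σ s * ⟪k.vel Z M φ, g⟫) 0 ψ := fun ψ => by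
    refine ((hJ.hasDerivAt_symplecticForm hK ψ).sub
      ((hσd ψ).mul_const ⟪k.vel Z M φ, g⟫)).congr_deriv ?_
    rw [hEJ, hEK]; ring
  have hconst := is_const_of_deriv_eq_zero (fun t => (hd t).differentiableAt)
    (fun t => (hd t).deriv) φ 0
  have hσ0 : σ 0 = 0 := by simp [hσ]
  have hKmem : K 0 ∈ tangentAt z := h0 ▸ hK.mem 0
  -- At angle `0` the first field is `X`, so the pairing is `dG (K 0)`; invariance of `dG` along
  -- variations moves this to angle `φ`, where `K` is `(0, g)`.
  have hω0 : symplecticForm (stateVariation Z M z X 0) (K 0) =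
      fderivWithin ℝ G (tangentSphere E) y (0, g) := by
    rw [stateVariation_zero hZ hz h hX.mem, hX.eq _ hKmem]
    have hGy : ∀ ψ, DifferentiableWithinAt ℝ G (tangentSphere E)
        ((keplerConic Z M y).state Z M ψ) := fun ψ => by
      rw [hyk, Conic.rotate_state]; exact hGd _
    have := fderivWithin_stateVariation hZ hyT hym hV hG hGy (-φ)
    rw [hyk, Conic.rotate_state, add_neg_cancel, h0] at this
    rw [← this]
    simp only [hK_def, add_zero]
  rw [hω0, hσ0, hKφ] at hconst
  simp only [symplecticForm, inner_zero_left, sub_zero, zero_mul] at hconst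
  linarith

/-- The time of one revolution does not change in the direction of the Hamiltonian vector of a
first integral. -/
theorem integral_densityVariation_eq_zero (hZ : ‖Z‖ = 1) (hz : z ∈ tangentSphere E)
    (h : 0 < momentumSq Z z) {G : E × E → ℝ}
    (hG : ∀ k : Conic E, k.IsFrame Z → ∀ ψ, G (k.state Z M ψ) = G (k.state Z M 0))
    (hGd : ∀ ψ, DifferentiableWithinAt ℝ G (tangentSphere E) ((keplerConic Z M z).state Z M ψ))
    {X : E × E} (hX : IsHamiltonianVector G z X) :
    ∫ ψ in (0 : ℝ)..(2 * Real.pi), densityVariation Z M z X ψ = 0 := by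
  have hk := isFrame_keplerConic hZ M h
  set k := keplerConic Z M z
  have h0 : k.state Z M 0 = z := keplerConic_state_zero hZ M hz h
  have hper := k.state_periodic Z M 0
  rw [zero_add] at hper
  have hpos : k.pos Z M (2 * Real.pi) = k.pos Z M 0 := congrArg Prod.fst hper
  have hvel : k.vel Z M (2 * Real.pi) = k.vel Z M 0 := congrArg Prod.snd hper
  have hort : ⟪k.pos Z M 0, k.vel Z M 0⟫ = 0 := (hk.state_mem hZ 0).2
  -- The same test vector, the velocity, is used at the angles `0` and `2π`. All terms except `σ`
  -- are periodic, and the velocity is nonzero, so `σ (2π) = 0`.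
  have e1 := inner_stateVariation hZ hz h hG hGd hX 0 (g := k.vel Z M 0) hort
  have e2 := inner_stateVariation hZ hz h hG hGd hX (2 * Real.pi) (g := k.vel Z M 0)
    (by rw [show keplerConic Z M z = k from rfl, hpos]; exact hort)
  have hJp := stateVariation_periodic Z M z X 0
  rw [zero_add] at hJp
  rw [show keplerConic Z M z = k from rfl, hJp, hper, e1, hvel] at e2
  simp only [intervalIntegral.integral_same, zero_mul, add_zero] at e2
  have hne : ⟪k.vel Z M 0, k.vel Z M 0⟫ ≠ 0 := by
    rw [real_inner_self_eq_norm_sq, hk.norm_vel_sq hZ]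
    have := hk.pos_C
    positivity
  have h3 : (∫ ψ in (0 : ℝ)..(2 * Real.pi), densityVariation Z M z X ψ) *
      ⟪k.vel Z M 0, k.vel Z M 0⟫ = 0 := by linarith
  exact (mul_eq_zero.1 h3).resolve_right hne

/-- If the derivative of a first integral `G` of the Kepler problem in the direction of the vertical
gradient of `W` is the derivative of a function `Φ` along the orbit, then the integral of `W` over
one revolution does not change in the direction of the Hamiltonian vector of `G`. -/
theorem fderiv_revolutionIntegral_eq_zero (hZ : ‖Z‖ = 1) (hz : z ∈ tangentSphere E)
    (h : 0 < momentumSq Z z) {G : E × E → ℝ}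
    (hG : ∀ k : Conic E, k.IsFrame Z → ∀ ψ, G (k.state Z M ψ) = G (k.state Z M 0))
    (hGd : ∀ ψ, DifferentiableWithinAt ℝ G (tangentSphere E) ((keplerConic Z M z).state Z M ψ))
    {X : E × E} (hX : IsHamiltonianVector G z X)
    (hW : ∀ ψ, ContDiffAt ℝ 1 W ((keplerConic Z M z).pos Z M ψ)) {g : ℝ → E}
    (hWg : ∀ ψ, HasFDerivAt W (innerSL ℝ (g ψ)) ((keplerConic Z M z).pos Z M ψ))
    (hg : ∀ ψ, ⟪(keplerConic Z M z).pos Z M ψ, g ψ⟫ = 0) {Φ : E → ℝ}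
    (hΦ : ∀ ψ, HasDerivAt (fun t => Φ ((keplerConic Z M z).pos Z M t))
      ((keplerConic Z M z).density M ψ * fderivWithin ℝ G (tangentSphere E)
        ((keplerConic Z M z).state Z M ψ) (0, g ψ)) ψ) :
    (∫ ψ in (0 : ℝ)..(2 * Real.pi), fderiv ℝ (fun x => W ((keplerConic Z M x).pos Z M ψ) *
      (keplerConic Z M x).density M ψ) z) X = 0 := by
  have hk := isFrame_keplerConic hZ M h
  have hcf : Continuous fun ψ => fderiv ℝ (fun x => W ((keplerConic Z M x).pos Z M ψ) *
      (keplerConic Z M x).density M ψ) z := continuous_iff_continuousAt.2 fun ψ =>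
    continuousAt_fderiv_left (f := fun x ψ => W ((keplerConic Z M x).pos Z M ψ) *
      (keplerConic Z M x).density M ψ) (contDiffAt_pos_density h (hW ψ))
  rw [ContinuousLinearMap.intervalIntegral_apply (hcf.intervalIntegrable _ _)]
  set k := keplerConic Z M z with hk_def
  have hcδ : Continuous (densityVariation Z M z X) := continuous_densityVariation h X
  set σ : ℝ → ℝ := fun φ => ∫ ψ in (0 : ℝ)..φ, densityVariation Z M z X ψ with hσ
  have hσd : ∀ ψ, HasDerivAt σ (densityVariation Z M z X ψ) ψ := fun ψ =>
    intervalIntegral.integral_hasDerivAt_right (hcδ.intervalIntegrable _ _)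
      (hcδ.stronglyMeasurableAtFilter _ _) hcδ.continuousAt
  -- The drift `σ` times the velocity contributes `σ` times the derivative of `W`, and the variation
  -- of the density contributes `σ' W`. Together they form the derivative of `σ W`, and `Φ` accounts
  -- for the rest.
  have hder : ∀ ψ, HasDerivAt (fun t => Φ (k.pos Z M t) + σ t * W (k.pos Z M t))
      (fderiv ℝ (fun x => W ((keplerConic Z M x).pos Z M ψ) *
        (keplerConic Z M x).density M ψ) z X) ψ := fun ψ => by
    have hWp : HasDerivAt (fun t => W (k.pos Z M t))
        (innerSL ℝ (g ψ) (k.density M ψ • k.vel Z M ψ)) ψ :=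
      (hWg ψ).comp_hasDerivAt ψ (hk.hasDerivAt_pos M ψ)
    refine ((hΦ ψ).add ((hσd ψ).mul hWp)).congr_deriv ?_
    have hpr := ((hWg ψ).comp z (hasFDerivAt_pos h ψ)).mul (hasFDerivAt_density (M := M) h ψ)
    have e : fderiv ℝ (fun x => W ((keplerConic Z M x).pos Z M ψ) *
        (keplerConic Z M x).density M ψ) z X =
        W (k.pos Z M ψ) * densityVariation Z M z X ψ +
          k.density M ψ * ⟪g ψ, (stateVariation Z M z X ψ).1⟫ := by
      exact (congrArg (fun L : E × E →L[ℝ] ℝ => L X) hpr.fderiv).trans rfl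
    rw [e, real_inner_comm, inner_stateVariation hZ hz h hG hGd hX ψ (hg ψ)]
    simp only [innerSL_apply_apply, inner_smul_right, real_inner_comm (k.vel Z M ψ) (g ψ)]
    simp only [hσ, ← hk_def]
    ring
  rw [intervalIntegral.integral_eq_sub_of_hasDerivAt (fun ψ _ => hder ψ)
    ((hcf.clm_apply continuous_const).intervalIntegrable _ _)]
  have hper := k.state_periodic Z M 0
  rw [zero_add] at hper
  have hpos : k.pos Z M (2 * Real.pi) = k.pos Z M 0 := congrArg Prod.fst hper
  have hσ1 : σ (2 * Real.pi) = 0 := integral_densityVariation_eq_zero hZ hz h hG hGd hX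
  have hσ0 : σ 0 = 0 := by simp [hσ]
  rw [hpos, hσ1, hσ0]
  ring

end Averaging

/-! ### The first integral of the two-center problem -/

/-- The component in the direction `T` of the Laplace-Runge-Lenz vector of the Kepler problem on the
sphere. -/
def lrlComponent (Z T : E) (M : ℝ) (z : E × E) : ℝ :=
  (⟪Z, z.1⟫ * ‖perp Z z.2‖ ^ 2 - ⟪Z, z.2⟫ * ⟪perp Z z.1, perp Z z.2⟫) * ⟪T, perp Z z.1⟫ -
    (⟪Z, z.1⟫ * ⟪perp Z z.1, perp Z z.2⟫ - ⟪Z, z.2⟫ * ‖perp Z z.1‖ ^ 2) * ⟪T, perp Z z.2⟫ -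
    M / ‖perp Z z.1‖ * ⟪T, perp Z z.1⟫

/-- The squared norm of the contraction of the angular momentum bivector with `T`. -/
def momentumSqAlong (Z T : E) (z : E × E) : ℝ :=
  ⟪T, perp Z z.1⟫ ^ 2 * ‖perp Z z.2‖ ^ 2 -
    2 * ⟪T, perp Z z.1⟫ * ⟪T, perp Z z.2⟫ * ⟪perp Z z.1, perp Z z.2⟫ +
    ⟪T, perp Z z.2⟫ ^ 2 * ‖perp Z z.1‖ ^ 2

/-- The function `C² - k A_T - (1 - c) |C_T|²` for a second center `c Z + k T`. -/
def twoCenterIntegral (Z T : E) (M c k : ℝ) (z : E × E) : ℝ :=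
  momentumSq Z z - k * lrlComponent Z T M z - (1 - c) * momentumSqAlong Z T z

theorem contDiffAt_twoCenterIntegral (Z T : E) (M c k : ℝ) {z : E × E} (hz : perp Z z.1 ≠ 0)
    {n : WithTop ℕ∞} : ContDiffAt ℝ n (twoCenterIntegral Z T M c k) z := by
  have h1 : ContDiffAt ℝ n (fun z : E × E => perp Z z.1) z :=
    ((contDiff_perp Z).comp contDiff_fst).contDiffAt
  have h2 : ContDiffAt ℝ n (fun z : E × E => perp Z z.2) z :=
    ((contDiff_perp Z).comp contDiff_snd).contDiffAt
  have h3 : ContDiffAt ℝ n (fun z : E × E => ‖perp Z z.1‖) z := h1.norm ℝ hz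
  have h5 : ContDiffAt ℝ n (fun z : E × E => ⟪Z, z.1⟫) z := contDiffAt_const.inner ℝ contDiffAt_fst
  have h6 : ContDiffAt ℝ n (fun z : E × E => ⟪Z, z.2⟫) z := contDiffAt_const.inner ℝ contDiffAt_snd
  have h7 : ContDiffAt ℝ n (fun z : E × E => ⟪T, perp Z z.1⟫) z := contDiffAt_const.inner ℝ h1
  have h8 : ContDiffAt ℝ n (fun z : E × E => ⟪T, perp Z z.2⟫) z := contDiffAt_const.inner ℝ h2
  have h9 : ContDiffAt ℝ n (fun z : E × E => ⟪perp Z z.1, perp Z z.2⟫) z := h1.inner ℝ h2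
  have h10 := h1.norm_sq ℝ
  have h11 := h2.norm_sq ℝ
  refine ((contDiff_momentumSq Z).contDiffAt.sub (contDiffAt_const.mul ?_)).sub
    (contDiffAt_const.mul ?_)
  · exact ((((h5.mul h11).sub (h6.mul h9)).mul h7).sub
      (((h5.mul h9).sub (h6.mul h10)).mul h8)).sub
        ((contDiffAt_const.div h3 (norm_ne_zero_iff.2 hz)).mul h7)
  · exact (((h7.pow 2).mul h11).sub (((contDiffAt_const.mul h7).mul h8).mul h9)).add
      ((h8.pow 2).mul h10)

theorem hasDerivAt_norm_perp {Z : E} {q : ℝ → E} {q' : E} {t : ℝ} (hq : HasDerivAt q q' t)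
    (hne : perp Z (q t) ≠ 0) :
    HasDerivAt (fun s => ‖perp Z (q s)‖) (⟪perp Z (q t), perp Z q'⟫ / ‖perp Z (q t)‖) t := by
  have hn := norm_ne_zero_iff.2 hne
  have h := ((hasDerivAt_perp (Z := Z) hq).norm_sq).sqrt (pow_ne_zero 2 hn)
  simp only [Real.sqrt_sq (norm_nonneg _)] at h
  refine h.congr_deriv ?_
  field_simp

/-- The function `twoCenterIntegral` is a first integral of the Kepler problem. -/
theorem hasDerivAt_twoCenterIntegral {Z : E} (hZ : ‖Z‖ = 1) (T : E) (c k : ℝ) {M ρ t : ℝ}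
    {q v : ℝ → E} (hmem : (q t, v t) ∈ tangentSphere E) (hlt : ⟪Z, q t⟫ ^ 2 < 1)
    (hq : HasDerivAt q (ρ • v t) t) (hv : HasDerivAt v (ρ • keplerForce Z M (q t, v t)) t) :
    HasDerivAt (fun s => twoCenterIntegral Z T M c k (q s, v s)) 0 t := by
  have hn2 : ‖perp Z (q t)‖ ^ 2 = 1 - ⟪Z, q t⟫ ^ 2 := by rw [norm_perp_sq hZ, hmem.1]; norm_num
  have hne : perp Z (q t) ≠ 0 := by
    intro h0
    rw [h0, norm_zero] at hn2
    linarith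
  have hn := norm_ne_zero_iff.2 hne
  have hQ := hasDerivAt_perp (Z := Z) hq
  have hU := hasDerivAt_perp (Z := Z) hv
  have hN := hasDerivAt_norm_perp (Z := Z) hq hne
  have hC := hasDerivAt_momentumSq hZ hq hv
  have hw : HasDerivAt (fun s => ⟪Z, q s⟫) ⟪Z, ρ • v t⟫ t := by
    simpa using (hasDerivAt_const t Z).inner ℝ hq
  have hp : HasDerivAt (fun s => ⟪Z, v s⟫) ⟪Z, ρ • keplerForce Z M (q t, v t)⟫ t := by
    simpa using (hasDerivAt_const t Z).inner ℝ hv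
  have hZZ : ⟪Z, Z⟫ = 1 := by rw [real_inner_self_eq_norm_sq, hZ]; norm_num
  have hcoeff : keplerCoeff Z M (q t) = M / ‖perp Z (q t)‖ ^ 3 := by
    rw [keplerCoeff, ← hn2, Real.sqrt_sq (norm_nonneg _)]
  have hF : ⟪Z, keplerForce Z M (q t, v t)⟫ =
      -(‖v t‖ ^ 2 + ⟪Z, q t⟫ * keplerCoeff Z M (q t)) * ⟪Z, q t⟫ + keplerCoeff Z M (q t) := by
    simp [keplerForce, inner_add_right, inner_smul_right, hZ]
  set lam := ‖v t‖ ^ 2 + ⟪Z, q t⟫ * keplerCoeff Z M (q t) with hlam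
  have hperpF : perp Z (keplerForce Z M (q t, v t)) = -lam • perp Z (q t) := perp_keplerForce hZ M _
  rw [perp_smul] at hQ hN
  rw [perp_smul, hperpF] at hU
  rw [inner_smul_right] at hw hp
  rw [hF] at hp
  have hTQ : HasDerivAt (fun s => ⟪T, perp Z (q s)⟫) (ρ * ⟪T, perp Z (v t)⟫) t := by
    simpa [inner_smul_right] using (hasDerivAt_const t T).inner ℝ hQ
  have hTU : HasDerivAt (fun s => ⟪T, perp Z (v s)⟫) (ρ * (-lam * ⟪T, perp Z (q t)⟫)) t := by
    simpa [inner_smul_right] using (hasDerivAt_const t T).inner ℝ hU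
  have hQQ : HasDerivAt (fun s => ‖perp Z (q s)‖ ^ 2)
      (2 * ρ * ⟪perp Z (q t), perp Z (v t)⟫) t := by
    refine hQ.norm_sq.congr_deriv ?_
    rw [inner_smul_right]; ring
  have hUU : HasDerivAt (fun s => ‖perp Z (v s)‖ ^ 2)
      (-2 * ρ * lam * ⟪perp Z (q t), perp Z (v t)⟫) t := by
    refine hU.norm_sq.congr_deriv ?_
    rw [inner_smul_right, inner_smul_right, real_inner_comm]; ring
  have hQU : HasDerivAt (fun s => ⟪perp Z (q s), perp Z (v s)⟫)
      (ρ * (‖perp Z (v t)‖ ^ 2 - lam * ‖perp Z (q t)‖ ^ 2)) t := by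
    refine (hQ.inner ℝ hU).congr_deriv ?_
    simp only [inner_smul_right, inner_smul_left, real_inner_self_eq_norm_sq, RCLike.conj_to_real]
    ring
  rw [inner_smul_right] at hN
  -- The terms with `lam` cancel. The force coefficient `M / ‖Q‖³`, with `Q` the projected position,
  -- leaves precisely the derivative of `M ⟪T, Q⟫ / ‖Q‖`, which the last term of `lrlComponent`
  -- compensates.
  have hA : HasDerivAt (fun s => lrlComponent Z T M (q s, v s)) 0 t := by
    refine (((((hw.mul hUU).sub (hp.mul hQU)).mul hTQ).sub
      (((hw.mul hQU).sub (hp.mul hQQ)).mul hTU)).sub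
        (((hasDerivAt_const t M).div hN hn).mul hTQ)).congr_deriv ?_
    simp only [Pi.mul_apply, Pi.sub_apply, Pi.div_apply]
    rw [hcoeff]
    field_simp
    ring
  have hB : HasDerivAt (fun s => momentumSqAlong Z T (q s, v s)) 0 t := by
    refine ((((hTQ.pow 2).mul hUU).sub (((hTQ.const_mul 2).mul hTU).mul hQU)).add
      ((hTU.pow 2).mul hQQ)).congr_deriv ?_
    simp only [Pi.mul_apply, Pi.pow_apply]
    push_cast
    ring
  refine ((hC.sub (hA.const_mul k)).sub (hB.const_mul (1 - c))).congr_deriv ?_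
  ring

theorem twoCenterIntegral_state {Z : E} (hZ : ‖Z‖ = 1) (T : E) (M c k : ℝ) {κ : Conic E}
    (hκ : κ.IsFrame Z) (ψ : ℝ) : twoCenterIntegral Z T M c k (κ.state Z M ψ) =
      twoCenterIntegral Z T M c k (κ.state Z M 0) := by
  have hd : ∀ t, HasDerivAt (fun s => twoCenterIntegral Z T M c k (κ.state Z M s)) 0 t := fun t =>
    hasDerivAt_twoCenterIntegral hZ T c k (hκ.state_mem hZ t) (hκ.inner_pos_sq_lt_one hZ t)
      (hκ.hasDerivAt_pos M t) (hκ.hasDerivAt_vel hZ M t)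
  exact is_const_of_deriv_eq_zero (fun t => (hd t).differentiableAt) (fun t => (hd t).deriv) ψ 0

/-- The derivative of `twoCenterIntegral` in a vertical direction. -/
theorem hasDerivAt_twoCenterIntegral_vertical (Z T : E) (M c k : ℝ) (q v g : E) :
    HasDerivAt (fun s : ℝ => twoCenterIntegral Z T M c k (q, v + s • g))
      ((2 * ‖perp Z q‖ ^ 2 * ⟪perp Z v, perp Z g⟫ -
          2 * ⟪perp Z q, perp Z v⟫ * ⟪perp Z q, perp Z g⟫) -
        k * ((2 * ⟪Z, q⟫ * ⟪perp Z v, perp Z g⟫ - ⟪Z, g⟫ * ⟪perp Z q, perp Z v⟫ -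
            ⟪Z, v⟫ * ⟪perp Z q, perp Z g⟫) * ⟪T, perp Z q⟫ -
          (⟪Z, q⟫ * ⟪perp Z q, perp Z g⟫ - ⟪Z, g⟫ * ‖perp Z q‖ ^ 2) * ⟪T, perp Z v⟫ -
          (⟪Z, q⟫ * ⟪perp Z q, perp Z v⟫ - ⟪Z, v⟫ * ‖perp Z q‖ ^ 2) * ⟪T, perp Z g⟫) -
        (1 - c) * (2 * ⟪T, perp Z q⟫ ^ 2 * ⟪perp Z v, perp Z g⟫ -
          2 * ⟪T, perp Z q⟫ * (⟪T, perp Z g⟫ * ⟪perp Z q, perp Z v⟫ +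
            ⟪T, perp Z v⟫ * ⟪perp Z q, perp Z g⟫) +
          2 * ⟪T, perp Z v⟫ * ⟪T, perp Z g⟫ * ‖perp Z q‖ ^ 2)) 0 := by
  have hv : HasDerivAt (fun s : ℝ => v + s • g) g 0 := by
    simpa using ((hasDerivAt_id (0 : ℝ)).smul_const g).const_add v
  have hU := hasDerivAt_perp (Z := Z) hv
  have hp : HasDerivAt (fun s : ℝ => ⟪Z, v + s • g⟫) ⟪Z, g⟫ 0 := by
    simpa using (hasDerivAt_const (0 : ℝ) Z).inner ℝ hv
  have hTU : HasDerivAt (fun s : ℝ => ⟪T, perp Z (v + s • g)⟫) ⟪T, perp Z g⟫ 0 := by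
    simpa using (hasDerivAt_const (0 : ℝ) T).inner ℝ hU
  have hUU := hU.norm_sq
  have hQU : HasDerivAt (fun s : ℝ => ⟪perp Z q, perp Z (v + s • g)⟫) ⟪perp Z q, perp Z g⟫ 0 := by
    simpa using (hasDerivAt_const (0 : ℝ) (perp Z q)).inner ℝ hU
  have hC := (hUU.const_mul (‖perp Z q‖ ^ 2)).sub (hQU.pow 2)
  have hA := ((((hUU.const_mul ⟪Z, q⟫).sub (hp.mul hQU)).mul_const ⟪T, perp Z q⟫).sub
    (((hQU.const_mul ⟪Z, q⟫).sub (hp.mul_const (‖perp Z q‖ ^ 2))).mul hTU)).sub_const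
      (M / ‖perp Z q‖ * ⟪T, perp Z q⟫)
  have hB := ((hUU.const_mul (⟪T, perp Z q⟫ ^ 2)).sub
    ((hTU.const_mul (2 * ⟪T, perp Z q⟫)).mul hQU)).add ((hTU.pow 2).mul_const (‖perp Z q‖ ^ 2))
  refine ((hC.sub (hA.const_mul k)).sub (hB.const_mul (1 - c))).congr_deriv ?_
  simp only [Pi.sub_apply, zero_smul, add_zero]
  push_cast
  ring

/-- The vertical derivative of `twoCenterIntegral` in the direction of the gradient of the potential
of the second center is a total derivative. -/
theorem fderivWithin_twoCenterIntegral_vertical {Z T : E} (hZ : ‖Z‖ = 1) (hT : ‖T‖ = 1)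
    (hZT : ⟪Z, T⟫ = 0) {c k : ℝ} (hck : c ^ 2 + k ^ 2 = 1) (M M₂ : ℝ) {z : E × E}
    (hz : z ∈ tangentSphere E) (hlt : ⟪Z, z.1⟫ ^ 2 < 1) :
    fderivWithin ℝ (twoCenterIntegral Z T M c k) (tangentSphere E) z
      (0, -keplerCoeff (c • Z + k • T) M₂ z.1 •
        (c • Z + k • T - ⟪c • Z + k • T, z.1⟫ • z.1)) =
      -(k * keplerCoeff (c • Z + k • T) M₂ z.1) *
        (⟪c • T - k • Z, z.2⟫ * (1 - ⟪c • Z + k • T, z.1⟫ ^ 2) +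
          ⟪c • T - k • Z, z.1⟫ * ⟪c • Z + k • T, z.1⟫ * ⟪c • Z + k • T, z.2⟫) := by
  obtain ⟨q, v⟩ := z
  have hqq : ⟪q, q⟫ = 1 := by rw [real_inner_self_eq_norm_sq, hz.1]; norm_num
  have hqv : ⟪q, v⟫ = 0 := hz.2
  have hvq : ⟪v, q⟫ = 0 := by rw [real_inner_comm]; exact hqv
  have hZZ : ⟪Z, Z⟫ = 1 := by rw [real_inner_self_eq_norm_sq, hZ]; norm_num
  have hTT : ⟪T, T⟫ = 1 := by rw [real_inner_self_eq_norm_sq, hT]; norm_num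
  have hTZ : ⟪T, Z⟫ = 0 := by rw [real_inner_comm]; exact hZT
  have hne : perp Z q ≠ 0 := by
    intro h0
    have := norm_perp_sq hZ q
    rw [h0, hz.1] at this
    norm_num at this
    simp only at hlt
    linarith
  set f := keplerCoeff (c • Z + k • T) M₂ q with hf
  set g := -f • (c • Z + k • T - ⟪c • Z + k • T, q⟫ • q) with hg
  have hgq : ⟪q, g⟫ = 0 := by
    simp only [hg, inner_smul_right, inner_sub_right, inner_add_right, inner_add_left,
      inner_smul_left, RCLike.conj_to_real, hqq, real_inner_comm q Z, real_inner_comm q T]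
    ring
  have hd := (contDiffAt_twoCenterIntegral Z T M c k (z := (q, v)) hne (n := 1)).differentiableAt
    (by simp)
  rw [fderivWithin_tangentSphere_apply hz (vertical_mem_tangentAt hgq) hd.hasFDerivAt
    (EventuallyEq.refl _ _)]
  have hline : HasDerivAt (fun s : ℝ => ((q, v + s • g) : E × E)) (0, g) 0 := by
    refine (hasDerivAt_const (0 : ℝ) q).prodMk ?_
    simpa using ((hasDerivAt_id (0 : ℝ)).smul_const g).const_add v
  have h1 := hd.hasFDerivAt.comp_hasDerivAt_of_eq (0 : ℝ) hline (by simp)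
  rw [h1.unique (hasDerivAt_twoCenterIntegral_vertical Z T M c k q v g)]
  have tq : ∀ x, ⟪T, perp Z x⟫ = ⟪T, x⟫ := fun x => by
    simp [perp, inner_sub_right, inner_smul_right, hTZ]
  simp only [tq, inner_perp_perp hZ, norm_perp_sq hZ, hgq, hqv]
  rw [show ‖q‖ = 1 from hz.1]
  have hvg : ⟪v, g⟫ = -f * (c * ⟪Z, v⟫ + k * ⟪T, v⟫) := by
    simp only [hg, inner_smul_right, inner_sub_right, inner_add_right, hvq, real_inner_comm v Z,
      real_inner_comm v T]
    ring
  have hZg : ⟪Z, g⟫ = -f * (c - (c * ⟪Z, q⟫ + k * ⟪T, q⟫) * ⟪Z, q⟫) := by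
    simp only [hg, inner_smul_right, inner_sub_right, inner_add_right, inner_add_left,
      inner_smul_left, RCLike.conj_to_real, hZZ, hZT]
    ring
  have hTg : ⟪T, g⟫ = -f * (k - (c * ⟪Z, q⟫ + k * ⟪T, q⟫) * ⟪T, q⟫) := by
    simp only [hg, inner_smul_right, inner_sub_right, inner_add_right, inner_add_left,
      inner_smul_left, RCLike.conj_to_real, hTT, hTZ]
    ring
  rw [hvg, hZg, hTg]
  -- Only the components of `q` and `v` along `Z` and `T` survive; what remains is a polynomial
  -- identity modulo `c² + k² = 1`.
  simp only [inner_sub_left, inner_add_left, inner_smul_left, RCLike.conj_to_real]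
  generalize ⟪Z, q⟫ = w
  generalize ⟪Z, v⟫ = w'
  generalize ⟪T, q⟫ = τ
  generalize ⟪T, v⟫ = τ'
  linear_combination (-f * k * (c * w + k * τ) * (w * τ' - τ * w')) * hck

/-- For a unit vector `T₂` orthogonal to `Z₂` the quotient is the cosine of the azimuth of `q` about
`Z₂`. It is the counterpart, for the second center, of the term `M Q / ‖Q‖` in the
Laplace-Runge-Lenz vector. -/
theorem hasDerivAt_secondCenterFunction {Z₂ T₂ : E} {ρ t : ℝ} {q : ℝ → E} {v : E} (A M₂ : ℝ)
    (hq : HasDerivAt q (ρ • v) t) (hlt : ⟪Z₂, q t⟫ ^ 2 < 1) :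
    HasDerivAt (fun s => -(A * M₂) * (⟪T₂, q s⟫ / √(1 - ⟪Z₂, q s⟫ ^ 2)))
      (ρ * (-(A * keplerCoeff Z₂ M₂ (q t)) * (⟪T₂, v⟫ * (1 - ⟪Z₂, q t⟫ ^ 2) +
        ⟪T₂, q t⟫ * ⟪Z₂, q t⟫ * ⟪Z₂, v⟫))) t := by
  have hpos : 0 < 1 - ⟪Z₂, q t⟫ ^ 2 := by linarith
  have hr := (Real.sqrt_pos.2 hpos).ne'
  have hs : √(1 - ⟪Z₂, q t⟫ ^ 2) ^ 2 = 1 - ⟪Z₂, q t⟫ ^ 2 := Real.sq_sqrt hpos.le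
  have hw : HasDerivAt (fun s => ⟪Z₂, q s⟫) (ρ * ⟪Z₂, v⟫) t := by
    simpa [inner_smul_right] using (hasDerivAt_const t Z₂).inner ℝ hq
  have hl : HasDerivAt (fun s => ⟪T₂, q s⟫) (ρ * ⟪T₂, v⟫) t := by
    simpa [inner_smul_right] using (hasDerivAt_const t T₂).inner ℝ hq
  refine ((hl.div (((hw.pow 2).const_sub 1).sqrt hpos.ne') hr).const_mul (-(A * M₂))).congr_deriv ?_
  simp only [keplerCoeff, Pi.pow_apply, Nat.cast_ofNat, Nat.add_one_sub_one, pow_one]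
  rw [← hs, Real.sqrt_sq (Real.sqrt_nonneg _)]
  field_simp
  ring

theorem hasFDerivAt_keplerEnergy {Z : E} (hZ : ‖Z‖ = 1) (M : ℝ) {z : E × E}
    (hz : z ∈ tangentSphere E) (hlt : ⟪Z, z.1⟫ ^ 2 < 1) :
    ∃ L : E × E →L[ℝ] ℝ, HasFDerivAt (keplerEnergy Z M) L z ∧
      ∀ X ∈ tangentAt z, L X = energyForm Z M z X := by
  have h1 : HasFDerivAt (fun z : E × E => ‖z.2‖ ^ 2) _ z :=
    (hasStrictFDerivAt_norm_sq z.2).hasFDerivAt.comp z hasFDerivAt_snd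
  have h2 : HasFDerivAt (fun z : E × E => keplerPotential Z M z.1) _ z :=
    (hasFDerivAt_keplerPotential hZ M hz.1 hlt).comp z hasFDerivAt_fst
  refine ⟨_, (h1.mul_const (2⁻¹ : ℝ)).add h2, fun X hX => ?_⟩
  have hX1 := hX.1
  simp [energyForm, hX1]
  ring

/-- The averaged two-center Hamiltonian, with second center `c Z + k T` on the unit sphere of a
Hilbert space, commutes with `twoCenterIntegral`. -/
theorem averaged_twoCenter [CompleteSpace E] {Z T Z₂ : E} (hZ : ‖Z‖ = 1) (hT : ‖T‖ = 1)
    (hZT : ⟪Z, T⟫ = 0) {c k : ℝ} (hck : c ^ 2 + k ^ 2 = 1) (hZ₂_def : Z₂ = c • Z + k • T)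
    {M : ℝ} (hM : M ≠ 0) (M₂ : ℝ) {γ : ℝ → E × E} (hγ : IsKeplerOrbit Z M γ)
    (havoid : ∀ t, (γ t).1 ≠ Z₂ ∧ (γ t).1 ≠ -Z₂) :
    (∃ γ' S, IsClosedKeplerOrbit Z M (γ 0) γ' S) ∧
    DifferentiableWithinAt ℝ (fun z => keplerEnergy Z M z +
      keplerAverage Z M (keplerPotential Z₂ M₂) z) (tangentSphere E) (γ 0) ∧
    DifferentiableWithinAt ℝ (twoCenterIntegral Z T M c k) (tangentSphere E) (γ 0) ∧
    poissonBracket (fun z => keplerEnergy Z M z +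
      keplerAverage Z M (keplerPotential Z₂ M₂) z)
      (twoCenterIntegral Z T M c k) (γ 0) = 0 := by
  have hZ₂ : ‖Z₂‖ = 1 := by
    rw [hZ₂_def, ← sq_eq_sq₀ (norm_nonneg _) zero_le_one, norm_add_sq_real, norm_smul, norm_smul,
      hZ, hT, inner_smul_left, inner_smul_right, hZT, mul_one, mul_one, Real.norm_eq_abs,
      Real.norm_eq_abs, sq_abs, sq_abs]
    linear_combination hck
  set z := γ 0 with hz_def
  have hz : z ∈ tangentSphere E := hγ.mem 0
  have h : 0 < momentumSq Z z := hγ.momentumSq_pos hZ hM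
  have hlt0 : ⟪Z, z.1⟫ ^ 2 < 1 := inner_sq_lt_one hZ hz.1 (hγ.ne_center 0) (hγ.ne_antipode 0)
  have hkF := isFrame_keplerConic hZ M h
  obtain ⟨Ψ, hΨ, hinv, hcl⟩ := exists_isClosedKeplerOrbit hZ M hz h
  have hγeq : γ = fun t => (keplerConic Z M z).state Z M (Ψ t) :=
    hγ.eq_of_eq hZ hcl.1 hcl.2.1.symm
  -- the orbit avoids the second center
  have hlt : ∀ ψ, ⟪Z₂, (keplerConic Z M z).pos Z M ψ⟫ ^ 2 < 1 := fun ψ => by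
    have h1 : (γ (∫ y in (0 : ℝ)..ψ, (keplerConic Z M z).density M y)).1 =
        (keplerConic Z M z).pos Z M ψ := by
      rw [hγeq]; simp only [hinv]; rfl
    have h2 := havoid (∫ y in (0 : ℝ)..ψ, (keplerConic Z M z).density M y)
    rw [h1] at h2
    exact inner_sq_lt_one hZ₂ (hkF.state_mem hZ ψ).1 h2.1 h2.2
  set W := keplerPotential Z₂ M₂ with hW_def
  have hWsm : ∀ q : E, ‖q‖ = 1 → ⟪Z₂, q⟫ ^ 2 < 1 → ContDiffAt ℝ 1 W q := fun q hq hq2 =>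
    contDiffAt_keplerPotential hZ₂ M₂ (by rw [hq]; linarith)
  have hW : ∀ ψ, ContDiffAt ℝ 1 W ((keplerConic Z M z).pos Z M ψ) := fun ψ =>
    hWsm _ (hkF.state_mem hZ ψ).1 (hlt ψ)
  -- the explicit average
  have hev : (fun z => keplerEnergy Z M z + keplerAverage Z M W z) =ᶠ[𝓝[tangentSphere E] z]
      fun x => keplerEnergy Z M x + (revolutionTime Z M x)⁻¹ * revolutionIntegral Z M W x := by
    have h1 : ∀ᶠ x in 𝓝 z, 0 < momentumSq Z x :=
      (contDiff_momentumSq Z (n := 0)).continuous.continuousAt.eventually (lt_mem_nhds h)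
    -- By compactness of one revolution, neighbouring orbits also avoid the second center and its
    -- antipode. The explicit formula for the average thus holds near `z`, as differentiation
    -- requires.
    have h2 : ∀ᶠ x in 𝓝 z, ∀ ψ ∈ Icc (0 : ℝ) (2 * Real.pi),
        ⟪Z₂, (keplerConic Z M x).pos Z M ψ⟫ ^ 2 < 1 := by
      refine isCompact_Icc.eventually_forall_of_forall_eventually fun ψ _ => ?_
      have hc : ContinuousAt (fun p : (E × E) × ℝ => ⟪Z₂, (keplerConic Z M p.1).pos Z M p.2⟫ ^ 2)
          (z, ψ) := (continuousAt_const.inner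
        ((smoothAt_keplerConic Z M h (n := 0)).pos Z M ψ).continuousAt).pow 2
      exact hc.eventually (gt_mem_nhds (hlt ψ))
    filter_upwards [nhdsWithin_le_nhds h1, nhdsWithin_le_nhds h2, self_mem_nhdsWithin]
      with x hx1 hx2 hx3
    have hkx := isFrame_keplerConic hZ M hx1
    rw [keplerAverage_eq hZ M hx3 hx1]
    refine continuous_iff_continuousAt.2 fun ψ => ?_
    have hx4 : ⟪Z₂, (keplerConic Z M x).pos Z M ψ⟫ ^ 2 < 1 := by
      obtain ⟨φ, hφ, hφ2⟩ := ((keplerConic Z M x).state_periodic Z M).exists_mem_Ico₀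
        (by positivity) ψ
      have := congrArg Prod.fst hφ2
      simp only [Conic.state] at this
      rw [this]
      exact hx2 φ ⟨hφ.1, hφ.2.le⟩
    exact ContinuousAt.comp (g := W) (f := fun ψ => (keplerConic Z M x).pos Z M ψ)
      (hWsm _ (hkx.state_mem hZ (M := M) ψ).1 hx4).continuousAt
      (hkx.hasDerivAt_pos M ψ).continuousAt
  obtain ⟨L, hL, hLX⟩ := hasFDerivAt_keplerEnergy hZ M hz hlt0
  have hT0 := (revolutionTime_pos hZ M h).ne'
  have hTd := hasFDerivAt_revolutionTime (M := M) h
  have hNd := hasFDerivAt_revolutionIntegral h hW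
  have hmain := hL.add (((hasDerivAt_inv hT0).comp_hasFDerivAt z hTd).mul hNd)
  -- the first integral
  have hne : ∀ ψ, perp Z ((keplerConic Z M z).state Z M ψ).1 ≠ 0 := fun ψ => by
    have := hkF.norm_perp_pos hZ M ψ
    exact norm_pos_iff.1 (this ▸ (keplerConic Z M z).sine_pos M ψ)
  have hGd : ∀ ψ, DifferentiableWithinAt ℝ (twoCenterIntegral Z T M c k) (tangentSphere E)
      ((keplerConic Z M z).state Z M ψ) := fun ψ =>
    ((contDiffAt_twoCenterIntegral Z T M c k (hne ψ) (n := 1)).differentiableAt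
      (by simp)).differentiableWithinAt
  have h0 := keplerConic_state_zero hZ M hz h
  have hGz : DifferentiableWithinAt ℝ (twoCenterIntegral Z T M c k) (tangentSphere E) z :=
    h0 ▸ hGd 0
  refine ⟨⟨_, _, hcl⟩, ?_, hGz, ?_⟩
  · exact (hmain.hasFDerivWithinAt.congr_of_eventuallyEq hev
      (hev.eq_of_nhdsWithin hz)).differentiableWithinAt
  · have hG : ∀ κ : Conic E, κ.IsFrame Z → ∀ ψ, twoCenterIntegral Z T M c k (κ.state Z M ψ) =
        twoCenterIntegral Z T M c k (κ.state Z M 0) := fun κ hκ ψ =>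
      twoCenterIntegral_state hZ T M c k hκ ψ
    have hX := isHamiltonianVector_hamiltonianVector (twoCenterIntegral Z T M c k) hz
    rw [poissonBracket_eq _ _ hz]
    set X := hamiltonianVector (twoCenterIntegral Z T M c k) z
    rw [fderivWithin_tangentSphere_apply hz hX.mem hmain hev]
    have hgrad : ∀ ψ, ⟪(keplerConic Z M z).pos Z M ψ,
        -keplerCoeff Z₂ M₂ ((keplerConic Z M z).pos Z M ψ) •
          (Z₂ - ⟪Z₂, (keplerConic Z M z).pos Z M ψ⟫ • (keplerConic Z M z).pos Z M ψ)⟫ = 0 :=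
      fun ψ => by
        rw [inner_smul_right, inner_sub_right, inner_smul_right, real_inner_self_eq_norm_sq,
          show ‖(keplerConic Z M z).pos Z M ψ‖ = 1 from (hkF.state_mem hZ ψ).1, real_inner_comm]
        ring
    have e1 : L X = 0 := by rw [hLX X hX.mem, energyForm_eq_zero hZ hz h hG hGz hX]
    have e2 : (∫ ψ in (0 : ℝ)..(2 * Real.pi),
        fderiv ℝ (fun x => (keplerConic Z M x).density M ψ) z) X = 0 := by
      have hcf : Continuous fun ψ => fderiv ℝ (fun x => (keplerConic Z M x).density M ψ) z :=
        continuous_iff_continuousAt.2 fun ψ =>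
          continuousAt_fderiv_left (f := fun x ψ => (keplerConic Z M x).density M ψ)
            ((smoothAt_keplerConic Z M h).density M ψ)
      rw [ContinuousLinearMap.intervalIntegral_apply (hcf.intervalIntegrable _ _)]
      exact integral_densityVariation_eq_zero hZ hz h hG hGd hX
    have e3 := fderiv_revolutionIntegral_eq_zero hZ hz h hG hGd hX hW
      (fun ψ => hasFDerivAt_keplerPotential hZ₂ M₂ (hkF.state_mem hZ ψ).1 (hlt ψ)) hgrad
      -- `c T - k Z` is the unit vector orthogonal to `Z₂` in the plane of the two centers.
      (Φ := fun q => -(k * M₂) * (⟪c • T - k • Z, q⟫ / √(1 - ⟪Z₂, q⟫ ^ 2)))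
      (fun ψ => by
        have hv := fderivWithin_twoCenterIntegral_vertical hZ hT hZT hck M M₂
          (hkF.state_mem hZ (M := M) ψ) (hkF.inner_pos_sq_lt_one hZ ψ)
        rw [← hZ₂_def] at hv
        have hs := hasDerivAt_secondCenterFunction (T₂ := c • T - k • Z) k M₂
          (hkF.hasDerivAt_pos M ψ) (hlt ψ)
        refine hs.congr_deriv ?_
        exact congrArg (fun r => (keplerConic Z M z).density M ψ * r) hv.symm)
    simp only [add_apply, smul_apply, e1, e2, e3,
      smul_zero, add_zero]

/-! ### The two centers on `S^d` -/

section TwoCenter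

variable {d : ℕ}

theorem norm_center (hd : 1 ≤ d) (a : ℝ) : ‖center d a‖ = 1 := by
  have h := inner_center_self hd a
  rw [real_inner_self_eq_norm_sq] at h
  nlinarith [norm_nonneg (center d a)]

theorem penultimate_ne_last (hd : 1 ≤ d) : (⟨d - 1, by omega⟩ : Fin (d + 1)) ≠ Fin.last d := by
  simp [Fin.ext_iff]; omega

theorem norm_poleAxis (hd : 1 ≤ d) (a : ℝ) : ‖poleAxis d a‖ = 1 := by
  have hs : √(1 + a ^ 2) ^ 2 = 1 + a ^ 2 := Real.sq_sqrt (by positivity)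
  have hs0 : √(1 + a ^ 2) ≠ 0 := (Real.sqrt_pos.2 (by positivity)).ne'
  have h1 := penultimate_ne_last hd
  have h : ⟪poleAxis d a, poleAxis d a⟫ = 1 := by
    rw [inner_poleAxis hd]
    simp [poleAxis, centerAxis, lastAxis, h1, h1.symm]
    field_simp
    rw [hs]
  rw [real_inner_self_eq_norm_sq] at h
  nlinarith [norm_nonneg (poleAxis d a)]

/-- The second center in terms of the first one. -/
theorem center_neg (a : ℝ) : center d (-a) =
    ((1 - a ^ 2) / (1 + a ^ 2)) • center d a + (-2 * a / (1 + a ^ 2)) • poleAxis d a := by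
  have h : (1 : ℝ) + a ^ 2 ≠ 0 := by positivity
  simp only [center, poleAxis, neg_sq]
  match_scalars <;> field_simp <;> ring

theorem apply_last (hd : 1 ≤ d) (a : ℝ) (x : Ambient d) :
    x (Fin.last d) = (√(1 + a ^ 2))⁻¹ * (a * ⟪poleAxis d a, x⟫ - ⟪center d a, x⟫) := by
  have hs : √(1 + a ^ 2) ^ 2 = 1 + a ^ 2 := Real.sq_sqrt (by positivity)
  have hs0 : √(1 + a ^ 2) ≠ 0 := (Real.sqrt_pos.2 (by positivity)).ne'
  rw [inner_poleAxis hd, inner_center hd]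
  field_simp
  rw [hs]; ring

/-- The last coordinate entering `projVelocity` splits into components along the first center and
along `poleAxis`. The former gives `lrlComponent`, together with the mass term and with `k = -2a /
(1 + a²)`; the latter gives `momentumSqAlong`, with the factor `1 - c = 2a² / (1 + a²)`. -/
theorem integralD_eq_twoCenterIntegral (hd : 1 ≤ d) (a m₁ : ℝ) :
    integralD (d := d) a m₁ = twoCenterIntegral (center d a) (poleAxis d a) (m₁ * √(1 + a ^ 2))
      ((1 - a ^ 2) / (1 + a ^ 2)) (-2 * a / (1 + a ^ 2)) := by
  funext z
  have hs : √(1 + a ^ 2) ^ 2 = 1 + a ^ 2 := Real.sq_sqrt (by positivity)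
  have hs0 : √(1 + a ^ 2) ≠ 0 := (Real.sqrt_pos.2 (by positivity)).ne'
  have ht : ∀ x, ⟪poleAxis d a, x⟫ = ⟪poleAxis d a, orthPart a x⟫ := fun x => by
    rw [orthPart, inner_sub_right, inner_smul_right, inner_poleAxis_center hd]; ring
  have hp : ∀ x, perp (center d a) x = orthPart a x := fun x => rfl
  simp only [integralD, angularSq, lrlVector, projVelocity, twoCenterIntegral, momentumSq,
    lrlComponent, momentumSqAlong, hp, apply_last hd a, inner_neg_right, inner_sub_left,
    inner_sub_right, inner_smul_left, inner_smul_right, RCLike.conj_to_real]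
  simp only [ht z.1, ht z.2, real_inner_self_eq_norm_sq,
    real_inner_comm (orthPart a z.1) (orthPart a z.2),
    real_inner_comm (poleAxis d a) (orthPart a z.1),
    real_inner_comm (poleAxis d a) (orthPart a z.2)]
  have hc : (1 - a ^ 2) / (1 + a ^ 2) = 1 - 2 * a ^ 2 / √(1 + a ^ 2) ^ 2 := by
    rw [hs]; field_simp; ring
  rw [hc, ← hs, Real.sqrt_sq (Real.sqrt_nonneg _)]
  by_cases hz : ‖orthPart a z.1‖ = 0
  · have hz' : orthPart a z.1 = 0 := norm_eq_zero.1 hz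
    simp [hz']
  · field_simp
    ring

end TwoCenter

end SphericalTwoCenter

end

open SphericalTwoCenter in
theorem proposition2 (d : ℕ) (hd : 1 ≤ d) (a m₁ m₂ : ℝ) (hm₁ : m₁ ≠ 0) :
    ∀ z ∈ averagingRegion d a m₁,
      (∃ γ T, IsClosedKeplerOrbit (center d a) (m₁ * √(1 + a ^ 2)) z γ T) ∧
      DifferentiableWithinAt ℝ (averagedEnergy a m₁ m₂) (tangentSphere (Ambient d)) z ∧
      DifferentiableWithinAt ℝ (integralD a m₁) (tangentSphere (Ambient d)) z ∧
      poissonBracket (averagedEnergy a m₁ m₂) (integralD a m₁) z = 0 := by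
  rintro z ⟨γ, hγ, rfl, havoid⟩
  have h : (1 : ℝ) + a ^ 2 ≠ 0 := by positivity
  have hs0 : √(1 + a ^ 2) ≠ 0 := (Real.sqrt_pos.2 (by positivity)).ne'
  rw [integralD_eq_twoCenterIntegral hd]
  exact averaged_twoCenter (norm_center hd a) (norm_poleAxis hd a)
    (by rw [real_inner_comm]; exact inner_poleAxis_center hd a) (by field_simp; ring)
    (center_neg a) (mul_ne_zero hm₁ hs0) (m₂ * √(1 + a ^ 2)) hγ havoid
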